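/- All Lie algebras and vector spaces are real and finite dimensional. **Definitions.** Let $\mathfrak g$ be a Lie algebra and $\sigma\in\mathrm{Aut}(\mathfrak g)$ with $\sigma^3=1$, $\sigma\neq 1$. Put $\mathfrak h=\ker(\sigma-1)$, $\mathbb V=\ker(\sigma^2+\sigma+1)$, so that $\mathfrak g=\mathfrak h\oplus\mathbb V$ and $[\mathfrak h,\mathbb V]\subseteq\mathbb V$, and let $J$ be the complex structure of $\mathbb V$ determined by $\sigma|_{\mathbb V}=-\tfrac12+\tfrac{\sqrt3}{2}J$. The isotropy representation is $\iota:\mathfrak h\to\mathfrak{gl}_J(\mathbb V)$, $\iota(F)=(\mathrm{ad}_F)|_{\mathbb V}$. The pair $(\mathfrak g,\sigma)$ is a *Riemannian 3-symmetric Lie algebra* if $\iota$ is *compactly embedded*: there is a compact connected Lie group $H$ with Lie algebra $\mathfrak h$ and an effective representation $\pi:H\to GL_J(\mathbb V)$ with $(d\pi)_e=\iota$ (one says that $H$ integrates $\iota$). An *isotropy-invariant metric* is an $H$-invariant inner product $g$ on $\mathbb V$ with $g(J\cdot,J\cdot)=g$. The *transvection algebra* is $\underline{\mathfrak g}=\mathbb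 V+[\mathbb V,\mathbb V]$. Let $\tau(v,w)=[v,w]_{\mathbb V}$ for $v,w\in\mathbb V$; the *intrinsic torsion* of $g$ is the unique linear map $\eta^g:\mathbb V\to\mathfrak{so}(\mathbb V,g)$ with $\eta^g_vw-\eta^g_wv=\tau(v,w)$. A subspace $E\subseteq\mathbb V$ is invariant under $\eta^g$ if $\eta^g_vE\subseteq E$ for all $v\in\mathbb V$. A semisimple Lie algebra $L$ is *Hermitian symmetric* if $L=\mathfrak k\oplus\mathcal H$ with $[\mathfrak k,\mathfrak k]\subseteq\mathfrak k$, $[\mathfrak k,\mathcal H]\subseteq\mathcal H$, $[\mathcal H,\mathcal H]\subseteq\mathfrak k$, there is an $\mathrm{ad}_{\mathfrak k}$-invariant complex structure $J_{\mathcal H}$ on $\mathcal H$ with $[J_{\mathcal H}x,J_{\mathcal H}y]=[x,y]$, and the representation of $\mathfrak k$ on $(\mathcal H,J_{\mathcal H})$ is compactly embedded. A faithful representation $\rho:L\to\mathfrak{sl}(V)$ on a vector space with complex structure $J_V$ is *admissible* if no nonzero $v\in V$ satisfies $\rho(L)v=0$, $\rho(F)$ commutes with $J_V$ for $F\in\mathfrak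 k$, and $\rho(x)$ anticommutes with $J_V$ and $\rho(J_{\mathcal H}x)=\rho(x)\circ J_V$ for $x\in\mathcal H$. **Theorem.** Let $(\mathfrak g,\sigma)$ be a Riemannian 3-symmetric Lie algebra. Then there are $r\ge 0$, subalgebras $L_0,\mathfrak n,L_1,\dots,L_r$ and subspaces $V_1,\dots,V_r$ of $\mathfrak g$ such that $$\underline{\mathfrak g}=L_0\oplus\mathfrak n\oplus\bigoplus_{i=1}^r (V_i\rtimes_{\rho_i}L_i)$$ is a direct product of Lie algebras, where - $L_0$ is semisimple and $\sigma$-invariant, and either $L_0=0$ or $(L_0,\sigma|_{L_0})$ is Riemannian 3-symmetric; - $\mathfrak n\subseteq\mathbb V$ is $\sigma$-invariant and $[\mathfrak n,[\mathfrak n,\mathfrak n]]=0$; - for $1\le i\le r$, $V_i\subseteq\mathbb V$ is an abelian ideal of the $i$-th factor $V_i\rtimes_{\rho_i}L_i$, $J(V_i)\subseteq V_i$, $L_i=\mathfrak k_i\oplus\mathcal H_i$ with $\mathfrak k_i=L_i\cap\mathfrak h$, $\mathcal H_i=L_i\cap\mathbb V$ is a simple Hermitian symmetric Lie algebra with complex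 structure $J|_{\mathcal H_i}$, and $\rho_i:L_i\to\mathfrak{sl}(V_i)$, $\rho_i(x)v=[x,v]$, is admissible with respect to $J|_{V_i}$. With $\mathcal H_0=L_0\cap\mathbb V$, the corresponding splitting is $$\mathbb V=\mathcal H_0\oplus\mathfrak n\oplus\bigoplus_{i=1}^r(V_i\oplus\mathcal H_i),$$ and its factors $\mathcal H_0$, $\mathfrak n$, $V_i\oplus\mathcal H_i$ $(1\le i\le r)$ are 1. $J$-invariant, and pairwise $g$-orthogonal for every isotropy-invariant metric $g$; 2. invariant under the intrinsic torsion $\eta^g$ for every isotropy-invariant metric $g$. -/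

import Mathlib

namespace ThreeSymmetric

noncomputable section

attribute [local instance 100] LieRing.ofAssociativeRing

/-! ## Linear groups integrating a representation -/

/-- The exponential of an endomorphism of a finite dimensional real vector space, computed through
matrices in a basis (the result does not depend on the basis). -/
def endExp {M : Type*} [AddCommGroup M] [Module ℝ M] [Module.Finite ℝ M]
    (X : Module.End ℝ M) : Module.End ℝ M :=
  Matrix.toLin (Module.finBasis ℝ M) (Module.finBasis ℝ M)
    (NormedSpace.exp (LinearMap.toMatrix (Module.finBasis ℝ M) (Module.finBasis ℝ M) X))

/-- The set of matrices of the elements of a group `K` of linear automorphisms of `M`. It carries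
the topology of the space of square matrices, so that topological properties of `K` are properties
of this set. -/
def matrixSet {M : Type*} [AddCommGroup M] [Module ℝ M] [Module.Finite ℝ M]
    (K : Subgroup (M ≃ₗ[ℝ] M)) :
    Set (Matrix (Fin (Module.finrank ℝ M)) (Fin (Module.finrank ℝ M)) ℝ) :=
  (fun a : M ≃ₗ[ℝ] M =>
    LinearMap.toMatrix (Module.finBasis ℝ M) (Module.finBasis ℝ M) (a : M →ₗ[ℝ] M)) '' K

/-- `K` is a compact connected Lie group of `J`-complex linear automorphisms of `M` which integrates
the representation `ρ : k → gl(M)`: the map `ρ` is an isomorphism of `k` onto the Lie algebra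
`{X | exp (t X) ∈ K for all t}` of `K`. (A compact connected Lie group with Lie algebra `k` and an
effective representation in `GL_J(M)` tangent to `ρ` is the same thing as its image `K`.) -/
structure Integrates {k M : Type*} [LieRing k] [LieAlgebra ℝ k]
    [AddCommGroup M] [Module ℝ M] [Module.Finite ℝ M]
    (ρ : k →ₗ⁅ℝ⁆ Module.End ℝ M) (J : Module.End ℝ M) (K : Subgroup (M ≃ₗ[ℝ] M)) : Prop where
  isCompact : IsCompact (matrixSet K)
  isConnected : IsConnected (matrixSet K)
  complexLinear : ∀ a ∈ K, ∀ v : M, a (J v) = J (a v)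
  faithful : Function.Injective ρ
  lieAlgebra : ∀ X : Module.End ℝ M,
    (∀ t : ℝ, ∃ a ∈ K, (a : M →ₗ[ℝ] M) = endExp (t • X)) ↔ ∃ F : k, ρ F = X

/-- A representation is compactly embedded (with respect to the complex structure `J`) if some
compact connected Lie group integrates it. -/
def IsCompactlyEmbedded {k M : Type*} [LieRing k] [LieAlgebra ℝ k]
    [AddCommGroup M] [Module ℝ M] [Module.Finite ℝ M]
    (ρ : k →ₗ⁅ℝ⁆ Module.End ℝ M) (J : Module.End ℝ M) : Prop :=
  ∃ K : Subgroup (M ≃ₗ[ℝ] M), Integrates ρ J K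

/-- The representation `F ↦ (ad F)|_M` of a subalgebra `k` on a subspace `M` with `[k, M] ⊆ M`. -/
def adRep {L : Type*} [LieRing L] [LieAlgebra ℝ L] (k : LieSubalgebra ℝ L) (M : Submodule ℝ L)
    (h : ∀ F ∈ k, ∀ x ∈ M, ⁅F, x⁆ ∈ M) : k →ₗ⁅ℝ⁆ Module.End ℝ M where
  toFun F :=
    { toFun := fun x => ⟨⁅(F : L), (x : L)⁆, h F F.2 x x.2⟩
      map_add' := fun x y => Subtype.ext (lie_add (F : L) (x : L) (y : L))
      map_smul' := fun c x => Subtype.ext (lie_smul c (F : L) (x : L)) }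
  map_add' F G := LinearMap.ext fun x => Subtype.ext (add_lie (F : L) (G : L) (x : L))
  map_smul' c F := LinearMap.ext fun x => Subtype.ext (smul_lie c (F : L) (x : L))
  map_lie' {F G} := LinearMap.ext fun x => Subtype.ext (lie_lie (F : L) (G : L) (x : L))

/-! ## Hermitian symmetric Lie algebras and admissible representations -/

/-- `L = k ⊕ H` is a Hermitian symmetric Lie algebra with complex structure `J` on `H`. -/
structure IsHermitianSymmetric {L : Type*} [LieRing L] [LieAlgebra ℝ L] [Module.Finite ℝ L]
    (k : LieSubalgebra ℝ L) (H : Submodule ℝ L) (J : Module.End ℝ H) : Prop where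
  semisimple : LieAlgebra.IsSemisimple ℝ L
  isCompl : IsCompl k.toSubmodule H
  lie_k_H : ∀ F ∈ k, ∀ x ∈ H, ⁅F, x⁆ ∈ H
  lie_H_H : ∀ x ∈ H, ∀ y ∈ H, ⁅x, y⁆ ∈ k
  J_sq : ∀ x, J (J x) = -x
  J_equivariant : ∀ (F : k) (x : H), adRep k H lie_k_H F (J x) = J (adRep k H lie_k_H F x)
  J_lie : ∀ x y : H, ⁅(J x : L), (J y : L)⁆ = ⁅(x : L), (y : L)⁆
  compact : IsCompactlyEmbedded (adRep k H lie_k_H) J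

/-- A faithful representation `ρ : L → sl(V)` of a Hermitian symmetric Lie algebra `L = k ⊕ H` on
a real vector space `V` with linear complex structure `JV` is admissible. -/
structure IsAdmissible {L V : Type*} [LieRing L] [LieAlgebra ℝ L] [Module.Finite ℝ L]
    [AddCommGroup V] [Module ℝ V]
    (k : LieSubalgebra ℝ L) (H : Submodule ℝ L) (JH : Module.End ℝ H)
    (JV : Module.End ℝ V) (ρ : L →ₗ⁅ℝ⁆ Module.End ℝ V) : Prop where
  hermitian : IsHermitianSymmetric k H JH
  J_sq : ∀ v, JV (JV v) = -v
  faithful : Function.Injective ρ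
  trace_eq_zero : ∀ x, LinearMap.trace ℝ V (ρ x) = 0
  fixed_eq_zero : ∀ v : V, (∀ x, ρ x v = 0) → v = 0
  commute : ∀ F ∈ k, ∀ v, ρ F (JV v) = JV (ρ F v)
  anticommute : ∀ x ∈ H, ∀ v, ρ x (JV v) = -JV (ρ x v)
  compat : ∀ (x : H) (v : V), ρ (JH x : L) v = ρ (x : L) (JV v)

/-! ## Riemannian 3-symmetric Lie algebras -/

section

variable {𝔤 : Type*} [LieRing 𝔤] [LieAlgebra ℝ 𝔤]

/-- The isotropy algebra `𝔥 = ker (σ - 1)`. -/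
def isotropy (σ : 𝔤 ≃ₗ⁅ℝ⁆ 𝔤) : LieSubalgebra ℝ 𝔤 where
  carrier := {x | σ x = x}
  zero_mem' := by simp
  add_mem' := by
    intro x y hx hy
    simp only [Set.mem_ofPred_eq] at *
    rw [map_add, hx, hy]
  smul_mem' := by
    intro c x hx
    simp only [Set.mem_ofPred_eq] at *
    rw [map_smul, hx]
  lie_mem' := by
    intro x y hx hy
    change σ x = x at hx
    change σ y = y at hy
    change σ ⁅x, y⁆ = ⁅x, y⁆
    rw [LieEquiv.map_lie, hx, hy]

/-- The subspace `𝕍 = ker (σ² + σ + 1)`. -/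
def tangent (σ : 𝔤 ≃ₗ⁅ℝ⁆ 𝔤) : Submodule ℝ 𝔤 where
  carrier := {x | σ (σ x) + σ x + x = 0}
  zero_mem' := by simp
  add_mem' := by
    intro x y hx hy
    simp only [Set.mem_ofPred_eq, map_add] at *
    calc _ = (σ (σ x) + σ x + x) + (σ (σ y) + σ y + y) := by abel
      _ = 0 := by rw [hx, hy, add_zero]
  smul_mem' := by
    intro c x hx
    simp only [Set.mem_ofPred_eq, map_smul] at *
    rw [← smul_add, ← smul_add, hx, smul_zero]

/-- The endomorphism `(2 σ + 1) / √3` of `𝔤`; on `𝕍` it is the complex structure `J` determined by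
`σ = -1/2 + (√3/2) J`. -/
def sigmaJ (σ : 𝔤 ≃ₗ⁅ℝ⁆ 𝔤) : Module.End ℝ 𝔤 :=
  (1 / √3 : ℝ) • ((2 : ℝ) • (σ : 𝔤 →ₗ[ℝ] 𝔤) + LinearMap.id)

theorem sigmaJ_apply (σ : 𝔤 ≃ₗ⁅ℝ⁆ 𝔤) (x : 𝔤) :
    sigmaJ σ x = (1 / √3 : ℝ) • ((2 : ℝ) • σ x + x) := rfl

theorem sigmaJ_mem (σ : 𝔤 ≃ₗ⁅ℝ⁆ 𝔤) : ∀ x ∈ tangent σ, sigmaJ σ x ∈ tangent σ := by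
  intro x hx
  have h1 : σ x ∈ tangent σ := by
    change σ (σ (σ x)) + σ (σ x) + σ x = 0
    change σ (σ x) + σ x + x = 0 at hx
    rw [← map_add, ← map_add, hx, map_zero]
  rw [sigmaJ_apply]
  exact Submodule.smul_mem _ _ (Submodule.add_mem _ (Submodule.smul_mem _ _ h1) hx)

/-- The complex structure `J` of `𝕍`. -/
def J (σ : 𝔤 ≃ₗ⁅ℝ⁆ 𝔤) : Module.End ℝ (tangent σ) := (sigmaJ σ).restrict (sigmaJ_mem σ)

theorem lie_isotropy_tangent (σ : 𝔤 ≃ₗ⁅ℝ⁆ 𝔤) :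
    ∀ F ∈ isotropy σ, ∀ x ∈ tangent σ, ⁅F, x⁆ ∈ tangent σ := by
  intro F hF x hx
  change σ F = F at hF
  change σ (σ x) + σ x + x = 0 at hx
  change σ (σ ⁅F, x⁆) + σ ⁅F, x⁆ + ⁅F, x⁆ = 0
  rw [LieEquiv.map_lie, hF, LieEquiv.map_lie, hF, ← lie_add, ← lie_add, hx, lie_zero]

/-- The isotropy representation `F ↦ (ad F)|_𝕍` of `𝔥` on `𝕍`. -/
def isotropyRep (σ : 𝔤 ≃ₗ⁅ℝ⁆ 𝔤) : isotropy σ →ₗ⁅ℝ⁆ Module.End ℝ (tangent σ) :=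
  adRep (isotropy σ) (tangent σ) (lie_isotropy_tangent σ)

/-- `(𝔤, σ)` is a Riemannian 3-symmetric Lie algebra: `σ` has order 3 and the isotropy
representation is compactly embedded. -/
structure IsRiemannian3Symmetric [Module.Finite ℝ 𝔤] (σ : 𝔤 ≃ₗ⁅ℝ⁆ 𝔤) : Prop where
  cube : ∀ x, σ (σ (σ x)) = x
  ne_one : ∃ x, σ x ≠ x
  compact : IsCompactlyEmbedded (isotropyRep σ) (J σ)

/-- The transvection algebra `𝕍 + [𝕍, 𝕍]`. -/
def transvection (σ : 𝔤 ≃ₗ⁅ℝ⁆ 𝔤) : Submodule ℝ 𝔤 :=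
  tangent σ ⊔ Submodule.span ℝ {z | ∃ v ∈ tangent σ, ∃ w ∈ tangent σ, z = ⁅v, w⁆}

/-- `g` is an isotropy invariant metric, where `K` is the isotropy group acting on `𝕍`: an inner
product on `𝕍` which is invariant under `K` and under `J`. -/
structure IsInvariantMetric (σ : 𝔤 ≃ₗ⁅ℝ⁆ 𝔤) (K : Subgroup (tangent σ ≃ₗ[ℝ] tangent σ))
    (g : LinearMap.BilinForm ℝ (tangent σ)) : Prop where
  symm : ∀ v w, g v w = g w v
  pos : ∀ v, v ≠ 0 → 0 < g v v
  invariant : ∀ a ∈ K, ∀ v w, g (a v) (a w) = g v w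
  hermitian : ∀ v w, g (J σ v) (J σ w) = g v w

/-- The projection of `𝔤 = 𝔥 ⊕ 𝕍` onto `𝕍`, namely `1 - (1 + σ + σ²)/3`. -/
def tangentPart (σ : 𝔤 ≃ₗ⁅ℝ⁆ 𝔤) : Module.End ℝ 𝔤 :=
  (1 / 3 : ℝ) • ((2 : ℝ) • LinearMap.id - (σ : 𝔤 →ₗ[ℝ] 𝔤) -
    (σ : 𝔤 →ₗ[ℝ] 𝔤) ∘ₗ (σ : 𝔤 →ₗ[ℝ] 𝔤))

theorem tangentPart_apply (σ : 𝔤 ≃ₗ⁅ℝ⁆ 𝔤) (x : 𝔤) :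
    tangentPart σ x = (1 / 3 : ℝ) • ((2 : ℝ) • x - σ x - σ (σ x)) := rfl

theorem tangentPart_mem (σ : 𝔤 ≃ₗ⁅ℝ⁆ 𝔤) (hσ : ∀ x, σ (σ (σ x)) = x) (x : 𝔤) :
    tangentPart σ x ∈ tangent σ := by
  change σ (σ (tangentPart σ x)) + σ (tangentPart σ x) + tangentPart σ x = 0
  simp only [tangentPart_apply, map_smul, map_sub, hσ]
  module

theorem tangentPart_of_isotropy (σ : 𝔤 ≃ₗ⁅ℝ⁆ 𝔤) (x : 𝔤) (hx : x ∈ isotropy σ) :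
    tangentPart σ x = 0 := by
  change σ x = x at hx
  simp only [tangentPart_apply, hx]
  module

theorem tangentPart_of_tangent (σ : 𝔤 ≃ₗ⁅ℝ⁆ 𝔤) (x : 𝔤) (hx : x ∈ tangent σ) :
    tangentPart σ x = x := by
  change σ (σ x) + σ x + x = 0 at hx
  have h : σ (σ x) = -σ x - x := by
    rw [add_assoc] at hx
    rw [eq_neg_of_add_eq_zero_left hx]
    abel
  simp only [tangentPart_apply, h]
  module

/-- The torsion `τ(v, w) = [v, w]_𝕍`. -/
def torsion (σ : 𝔤 ≃ₗ⁅ℝ⁆ 𝔤) (v w : tangent σ) : 𝔤 := tangentPart σ ⁅(v : 𝔤), (w : 𝔤)⁆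

/-- `η` is the intrinsic torsion tensor `η^g : 𝕍 → so(𝕍, g)`, that is
`η_v w - η_w v = τ(v, w)`. -/
structure IsIntrinsicTorsion (σ : 𝔤 ≃ₗ⁅ℝ⁆ 𝔤) (g : LinearMap.BilinForm ℝ (tangent σ))
    (η : tangent σ →ₗ[ℝ] Module.End ℝ (tangent σ)) : Prop where
  skew : ∀ u v w, g (η u v) w + g v (η u w) = 0
  torsion_eq : ∀ v w, ((η v w : tangent σ) : 𝔤) - (η w v : tangent σ) = torsion σ v w

/-- The intrinsic torsion tensor exists and is unique. -/
theorem existsUnique_intrinsicTorsion [Module.Finite ℝ 𝔤] (σ : 𝔤 ≃ₗ⁅ℝ⁆ 𝔤)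
    (hσ : ∀ x, σ (σ (σ x)) = x) (K : Subgroup (tangent σ ≃ₗ[ℝ] tangent σ))
    (g : LinearMap.BilinForm ℝ (tangent σ)) (hg : IsInvariantMetric σ K g) :
    ∃! η, IsIntrinsicTorsion σ g η := by
  have hsep : ∀ v, (∀ w, g v w = 0) → v = 0 := by
    intro v hv
    by_contra hne
    exact absurd (hv v) (hg.pos v hne).ne'
  have hinj : Function.Injective g := by
    intro v w hvw
    refine sub_eq_zero.mp (hsep _ fun u => ?_)
    rw [map_sub, hvw, sub_self, LinearMap.zero_apply]
  let e : tangent σ ≃ₗ[ℝ] Module.Dual ℝ (tangent σ) :=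
    LinearEquiv.ofInjectiveOfFinrankEq g hinj Subspace.dual_finrank_eq.symm
  have he : ∀ φ v, g (e.symm φ) v = φ v := fun φ v => by
    change (e (e.symm φ)) v = φ v
    rw [LinearEquiv.apply_symm_apply]
  let T : tangent σ →ₗ[ℝ] tangent σ →ₗ[ℝ] tangent σ :=
    LinearMap.mk₂ ℝ (fun v w => ⟨torsion σ v w, tangentPart_mem σ hσ _⟩)
      (by intro a b c; ext; simp [torsion]) (by intro a b c; ext; simp [torsion])
      (by intro a b c; ext; simp [torsion]) (by intro a b c; ext; simp [torsion])
  have hT : ∀ v w, ((T v w : tangent σ) : 𝔤) = torsion σ v w := fun v w => rfl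
  have hTs : ∀ v w, T v w = -T w v := by
    intro v w
    ext
    rw [Submodule.coe_neg, hT, hT, torsion, torsion, ← map_neg, lie_skew]
  let c : tangent σ → tangent σ → Module.Dual ℝ (tangent σ) := fun u v =>
    (1 / 2 : ℝ) • (g (T u v) - (g.flip u).comp (T v) - (g.flip v).comp (T u))
  have hc : ∀ u v w, c u v w = (1 / 2 : ℝ) * (g (T u v) w - g (T v w) u - g (T u w) v) :=
    fun u v w => rfl
  let η : tangent σ →ₗ[ℝ] Module.End ℝ (tangent σ) :=
    LinearMap.mk₂ ℝ (fun u v => e.symm (c u v))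
      (by intro a b d; rw [← map_add]; congr 1; ext w; simp [hc]; ring)
      (by intro a b d; rw [← map_smul]; congr 1; ext w; simp [hc]; ring)
      (by intro a b d; rw [← map_add]; congr 1; ext w; simp [hc]; ring)
      (by intro a b d; rw [← map_smul]; congr 1; ext w; simp [hc]; ring)
  have hη : ∀ u v w, g (η u v) w = (1 / 2 : ℝ) * (g (T u v) w - g (T v w) u - g (T u w) v) := by
    intro u v w
    change g (e.symm (c u v)) w = _
    rw [he, hc]
  refine ⟨η, ⟨?_, ?_⟩, ?_⟩
  · intro u v w
    rw [hg.symm v, hη, hη, hTs w v]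
    simp only [map_neg, LinearMap.neg_apply]
    ring
  · intro v w
    rw [← hT, ← Submodule.coe_sub]
    congr 1
    refine sub_eq_zero.mp (hsep _ fun u => ?_)
    simp only [map_sub, LinearMap.sub_apply, hη]
    rw [hTs w v]
    simp only [map_neg, LinearMap.neg_apply]
    ring
  · rintro ζ ⟨hs, ht⟩
    have ht' : ∀ v w, ζ v w - ζ w v = T v w := by
      intro v w
      ext
      rw [Submodule.coe_sub, ht, hT]
    ext1 u
    ext1 v
    refine sub_eq_zero.mp (hsep _ fun w => ?_)
    rw [map_sub, LinearMap.sub_apply, hη, ← ht' u v, ← ht' v w, ← ht' u w]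
    simp only [map_sub, LinearMap.sub_apply]
    have h1 := hs u v w
    have h2 := hs v u w
    have h3 := hs w u v
    rw [hg.symm v (ζ u w)] at h1
    rw [hg.symm u (ζ v w)] at h2
    rw [hg.symm u (ζ w v)] at h3
    linarith

/-! ## Splittings -/

/-- The subspace `T` of `𝔤` is the (internal) direct product of the Lie algebras `A j`. -/
structure IsDirectProduct {ι : Type*} (T : Submodule ℝ 𝔤) (A : ι → LieSubalgebra ℝ 𝔤) : Prop where
  independent : iSupIndep fun j => (A j).toSubmodule
  iSup_eq : ⨆ j, (A j).toSubmodule = T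
  lie_eq_zero : ∀ i j, i ≠ j → ∀ x ∈ A i, ∀ y ∈ A j, ⁅x, y⁆ = 0

/-- The Lie algebra `S` is the (internal) semidirect product `V ⋊ L` of the abelian ideal `V` and
the subalgebra `L`, which acts on `V` by the bracket. -/
structure IsSemidirect (S : LieSubalgebra ℝ 𝔤) (V : Submodule ℝ 𝔤) (L : LieSubalgebra ℝ 𝔤) :
    Prop where
  sup_eq : V ⊔ L.toSubmodule = S.toSubmodule
  disjoint : Disjoint V L.toSubmodule
  abelian : ∀ v ∈ V, ∀ w ∈ V, ⁅v, w⁆ = 0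
  lie_mem : ∀ x ∈ L, ∀ v ∈ V, ⁅x, v⁆ ∈ V

/-- `L` is zero or, with the restriction of `σ`, a semisimple Riemannian 3-symmetric Lie algebra. -/
def IsSemisimpleFactor [Module.Finite ℝ 𝔤] (σ : 𝔤 ≃ₗ⁅ℝ⁆ 𝔤) (L : LieSubalgebra ℝ 𝔤) : Prop :=
  LieAlgebra.IsSemisimple ℝ L ∧
    ∃ σL : L ≃ₗ⁅ℝ⁆ L, (∀ x : L, ((σL x : L) : 𝔤) = σ x) ∧
      (Subsingleton L ∨ IsRiemannian3Symmetric σL)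

/-- `N` is a `σ`-invariant subalgebra contained in `𝕍` (so `σ` has no nonzero fixed vector in `N`)
which is nilpotent of step at most 2. -/
structure IsNilpotentFactor (σ : 𝔤 ≃ₗ⁅ℝ⁆ 𝔤) (N : LieSubalgebra ℝ 𝔤) : Prop where
  le_tangent : N.toSubmodule ≤ tangent σ
  map_mem : ∀ x ∈ N, σ x ∈ N
  two_step : ∀ x ∈ N, ∀ y ∈ N, ∀ z ∈ N, ⁅x, ⁅y, z⁆⁆ = 0

/-- `S = V ⋊ L` where `V ⊆ 𝕍`, `L` is a simple Hermitian symmetric Lie algebra with decomposition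
`L = (L ∩ 𝔥) ⊕ (L ∩ 𝕍)`, and the representation of `L` on `V` by the bracket is admissible, all
complex structures being the restrictions of `J`. -/
structure IsMixedFactor [Module.Finite ℝ 𝔤] (σ : 𝔤 ≃ₗ⁅ℝ⁆ 𝔤) (S : LieSubalgebra ℝ 𝔤)
    (V : Submodule ℝ 𝔤) (L : LieSubalgebra ℝ 𝔤) : Prop where
  semidirect : IsSemidirect S V L
  le_tangent : V ≤ tangent σ
  simple : LieAlgebra.IsSimple ℝ L
  admissible : ∃ (ρ : L →ₗ⁅ℝ⁆ Module.End ℝ V)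
    (JH : Module.End ℝ ((tangent σ).comap L.toSubmodule.subtype)) (JV : Module.End ℝ V),
    (∀ (x : L) (v : V), ((ρ x v : V) : 𝔤) = ⁅(x : 𝔤), (v : 𝔤)⁆) ∧
    (∀ x, ((JH x : L) : 𝔤) = sigmaJ σ (x : L)) ∧
    (∀ v, ((JV v : V) : 𝔤) = sigmaJ σ v) ∧
    IsAdmissible ((isotropy σ).comap L.incl) ((tangent σ).comap L.toSubmodule.subtype) JH JV ρ

/-- The labels of the factors `L₀`, `𝔫` and `Vᵢ ⋊ Lᵢ`, `i < r`. -/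
inductive FactorIndex (r : ℕ) : Type
  | semisimple : FactorIndex r
  | nilpotent : FactorIndex r
  | mixed (i : Fin r) : FactorIndex r

/-- The family of Lie algebras `L₀`, `𝔫`, `Sᵢ`. -/
def factors {r : ℕ} (L₀ N : LieSubalgebra ℝ 𝔤) (S : Fin r → LieSubalgebra ℝ 𝔤) :
    FactorIndex r → LieSubalgebra ℝ 𝔤
  | .semisimple => L₀
  | .nilpotent => N
  | .mixed i => S i

/-- The family of subspaces `H₀ = L₀ ∩ 𝕍`, `𝔫` and `Vᵢ ⊕ Hᵢ` with `Hᵢ = Lᵢ ∩ 𝕍`. -/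
def tangentFactors {r : ℕ} (σ : 𝔤 ≃ₗ⁅ℝ⁆ 𝔤) (L₀ N : LieSubalgebra ℝ 𝔤)
    (V : Fin r → Submodule ℝ 𝔤) (L : Fin r → LieSubalgebra ℝ 𝔤) :
    FactorIndex r → Submodule ℝ 𝔤
  | .semisimple => L₀.toSubmodule ⊓ tangent σ
  | .nilpotent => N.toSubmodule
  | .mixed i => V i ⊔ ((L i).toSubmodule ⊓ tangent σ)

end

end

end ThreeSymmetric

/-! Averaging over the compact isotropy group gives an inner product `G` on the Lie algebra that is
invariant under σ and 𝔥 (`Integrates.exists_form`). From there on 𝔤 denotes the transvection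
algebra, B its Killing form, r the radical of B, C the centralizer of r and M the B-orthogonal
complement of C. Two inputs carry the argument. First, B is negative definite on 𝔥 and 𝔥 is
B-orthogonal to 𝕍, so any x with B(x, x_𝔥) = 0 lies in 𝕍. Second, the torsion is J-antilinear in
each argument whereas 𝔥 commutes with J. Comparing the Jacobi identity for x and for Jx shows that
an ideal inside 𝕍 commutes with all torsion (`lie_tangentPart_lie_eq_zero`). Hence r is the largest
ideal contained in 𝕍, the quotient by r has nondegenerate Killing form (`isKilling_quotient`), and
derivations modulo r are inner modulo r (`exists_lie_sub_mem_rad`).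

The torsion takes values in C, 𝔤 = C + M, and C ∩ M lies in r. Inner derivations give, in the manner
of Whitehead's second lemma, [C, C] ∩ r = 0 (`eq_zero_of_mem_derived_of_mem_rad`). They also give a
central element Z of 𝔥 that acts modulo r as J on M ∩ 𝕍 and as 0 on C ∩ 𝕍
(`exists_isComplexCenter`). On C ∩ r the operator Z + J/2 commutes with ad v for v in 𝕍, and 𝔥 is
spanned by brackets of tangent vectors up to torsion, which acts there by zero. So (Z + J/2)Z has
trace zero on every eigenspace of Z(Z + J). This excludes the eigenvalues -s(s + 1) with s > 0, and
forces Z = 0 on the kernel of Z(Z + J) (`lie_eq_smul_of_mem_centerEigenspace`).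

The trace argument yields the splitting. Let H be the G-orthogonal complement of r in 𝕍. The torsion
of two vectors of M ∩ H would satisfy Za = -2Ja, the excluded case s = 1, so it vanishes. Together
with [C, C] ∩ r = 0 this makes 𝔥 ⊕ H a semisimple subalgebra complementary to r (`levi`). Further, r
is the sum of ker Z, which commutes with this Levi factor, and the image of Z(Z + J) on C ∩ r. The
factors are L₀ = levi ∩ C, 𝔫 = r ∩ ker Z, and V_i ⋊ I_i, where the I_i are the simple ideals of the
Levi factor inside M and V_i = [I_i, r] (`exists_splitting`). Antilinearity again shows that I_i
annihilates V_j for i ≠ j.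

Compact embeddedness of the factors comes from a compact group of automorphisms whose Lie algebra is
computed with inner derivations (`isCompactlyEmbedded_adRep`). Every tangent factor except 𝔫 is
spanned by brackets with the isotropy elements of that factor, which annihilate the other factors.
This gives orthogonality for every invariant metric, and the Koszul formula then gives invariance
under the intrinsic torsion. -/

namespace ThreeSymmetric

noncomputable section

attribute [local instance 100] LieRing.ofAssociativeRing

/-! ## Calculus of curves in finite dimensional vector spaces -/

section WeakDerivative

variable {M N P : Type*} [AddCommGroup M] [Module ℝ M] [AddCommGroup N] [Module ℝ N]
  [AddCommGroup P] [Module ℝ P]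

/-- The curve `c` has derivative `c'` at `t` after composition with any linear functional. -/
def HasWeakDerivAt (c : ℝ → M) (c' : M) (t : ℝ) : Prop :=
  ∀ ξ : Module.Dual ℝ M, HasDerivAt (fun s => ξ (c s)) (ξ c') t

/-- Linear functionals separate the points of a real vector space. Testing against them makes
derivatives available without choosing a norm. -/
theorem HasWeakDerivAt.unique {c : ℝ → M} {a b : M} {t : ℝ} (ha : HasWeakDerivAt c a t)
    (hb : HasWeakDerivAt c b t) : a = b := by
  rw [← sub_eq_zero, ← Module.forall_dual_apply_eq_zero_iff ℝ]
  intro ξ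
  rw [map_sub, (ha ξ).unique (hb ξ), sub_self]

theorem HasWeakDerivAt.map {c : ℝ → M} {a : M} {t : ℝ} (hc : HasWeakDerivAt c a t)
    (f : M →ₗ[ℝ] N) : HasWeakDerivAt (fun s => f (c s)) (f a) t :=
  fun ξ => hc (ξ ∘ₗ f)

theorem hasWeakDerivAt_const (a : M) (t : ℝ) : HasWeakDerivAt (fun _ => a) 0 t := by
  intro ξ
  simpa using hasDerivAt_const t (ξ a)

theorem HasWeakDerivAt.add {c d : ℝ → M} {a b : M} {t : ℝ} (hc : HasWeakDerivAt c a t)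
    (hd : HasWeakDerivAt d b t) : HasWeakDerivAt (fun s => c s + d s) (a + b) t := by
  intro ξ
  simp only [map_add]
  exact (hc ξ).add (hd ξ)

/-- Expanding the first argument in a finite basis turns the pairing into a finite sum of products
of real functions, to which the scalar product rule applies. -/
theorem HasWeakDerivAt.bilin [Module.Finite ℝ M] {c : ℝ → M} {d : ℝ → N} {a : M} {b : N} {t : ℝ}
    (β : M →ₗ[ℝ] N →ₗ[ℝ] P) (hc : HasWeakDerivAt c a t) (hd : HasWeakDerivAt d b t) :
    HasWeakDerivAt (fun s => β (c s) (d s)) (β a (d t) + β (c t) b) t := by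
  intro ξ
  let e := Module.finBasis ℝ M
  have key : ∀ x y, ξ (β x y) = ∑ i, e.coord i x * ξ (β (e i) y) := by
    intro x y
    conv_lhs => rw [← e.sum_repr x]
    simp only [map_sum, map_smul, LinearMap.sum_apply, LinearMap.smul_apply, smul_eq_mul,
      Module.Basis.coord_apply]
  rw [map_add, key, key, ← Finset.sum_add_distrib,
    show (fun s => ξ (β (c s) (d s))) = fun s => ∑ i, e.coord i (c s) * ξ (β (e i) (d s)) from
      funext fun s => key _ _]
  exact HasDerivAt.fun_sum fun i _ => (hc (e.coord i)).mul (hd (ξ ∘ₗ β (e i)))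

theorem HasWeakDerivAt.comp_neg {c : ℝ → M} {a : M} {t : ℝ} (hc : HasWeakDerivAt c a (-t)) :
    HasWeakDerivAt (fun s => c (-s)) (-a) t := by
  intro ξ
  have := HasDerivAt.comp t (hc ξ) (hasDerivAt_neg t)
  simpa [Function.comp_def] using this

theorem eq_of_hasWeakDerivAt_zero {c : ℝ → M} (hc : ∀ t, HasWeakDerivAt c 0 t) (t : ℝ) :
    c t = c 0 := by
  rw [← sub_eq_zero, ← Module.forall_dual_apply_eq_zero_iff ℝ]
  intro ξ
  have h : ∀ t, HasDerivAt (fun s => ξ (c s)) 0 t := fun t => by simpa using hc t ξ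
  have := is_const_of_deriv_eq_zero (f := fun s => ξ (c s))
    (fun t => (h t).differentiableAt) (fun t => (h t).deriv) t 0
  rw [map_sub, this, sub_self]

end WeakDerivative

/-! ### One-parameter groups of endomorphisms. -/

section Exponential

variable {M N P : Type*} [AddCommGroup M] [Module ℝ M] [Module.Finite ℝ M]
  [AddCommGroup N] [Module ℝ N] [Module.Finite ℝ N] [AddCommGroup P] [Module ℝ P]
  [Module.Finite ℝ P]

section

attribute [local instance] Matrix.linftyOpNormedRing Matrix.linftyOpNormedAlgebra

theorem matrix_hasDerivAt_exp {n : ℕ} (A : Matrix (Fin n) (Fin n) ℝ) (t : ℝ)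
    (ξ : Module.Dual ℝ (Matrix (Fin n) (Fin n) ℝ)) :
    HasDerivAt (fun s : ℝ => ξ (NormedSpace.exp (s • A))) (ξ (A * NormedSpace.exp (t • A))) t := by
  have h := hasDerivAt_exp_smul_const' (𝕂 := ℝ) A t
  exact (LinearMap.toContinuousLinearMap ξ).hasFDerivAt.comp_hasDerivAt t h

end

theorem hasWeakDerivAt_endExp (X : Module.End ℝ M) (t : ℝ) :
    HasWeakDerivAt (fun s : ℝ => endExp (s • X)) (X * endExp (t • X)) t := by
  intro ξ
  have h := matrix_hasDerivAt_exp
    (LinearMap.toMatrix (Module.finBasis ℝ M) (Module.finBasis ℝ M) X) t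
    (ξ ∘ₗ (Matrix.toLin (Module.finBasis ℝ M) (Module.finBasis ℝ M)).toLinearMap)
  simp only [LinearMap.comp_apply, LinearEquiv.coe_coe] at h
  rw [Matrix.toLin_mul _ (Module.finBasis ℝ M), Matrix.toLin_toMatrix] at h
  simp only [endExp, map_smul]
  exact h

theorem endExp_zero : endExp (0 : Module.End ℝ M) = 1 := by
  simp [endExp]
  rfl

theorem hasWeakDerivAt_endExp_zero (X : Module.End ℝ M) :
    HasWeakDerivAt (fun s : ℝ => endExp (s • X)) X 0 := by
  simpa [endExp_zero] using hasWeakDerivAt_endExp X 0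

theorem hasWeakDerivAt_endExp_apply (X : Module.End ℝ M) (v : M) (t : ℝ) :
    HasWeakDerivAt (fun s : ℝ => endExp (s • X) v) (X (endExp (t • X) v)) t :=
  (hasWeakDerivAt_endExp X t).map (LinearMap.applyₗ v)

theorem endExp_commute (X : Module.End ℝ M) (t : ℝ) : Commute X (endExp (t • X)) := by
  let e := LinearMap.toMatrixAlgEquiv (Module.finBasis ℝ M)
  have h : Commute (e X) (e (endExp (t • X))) := by
    have : e (endExp (t • X)) = NormedSpace.exp (t • e X) := by
      change LinearMap.toMatrix _ _ (Matrix.toLin _ _ _) = _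
      rw [LinearMap.toMatrix_toLin, map_smul]
      rfl
    rw [this]
    exact ((Commute.refl (e X)).smul_right t).exp_right
  have := h.map e.symm
  simpa using this

/-- The product has derivative zero because `X` commutes with its exponentials, and it equals 1 at
`t = 0`. -/
theorem endExp_neg_mul (X : Module.End ℝ M) (t : ℝ) :
    endExp ((-t) • X) * endExp (t • X) = 1 := by
  have h : ∀ t : ℝ, HasWeakDerivAt (fun s : ℝ => endExp ((-s) • X) * endExp (s • X)) 0 t := by
    intro t
    have h1 := HasWeakDerivAt.comp_neg (hasWeakDerivAt_endExp X (-t))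
    have h2 := HasWeakDerivAt.bilin (LinearMap.mul ℝ (Module.End ℝ M)) h1 (hasWeakDerivAt_endExp X t)
    simp only [LinearMap.mul_apply'] at h2
    rw [(endExp_commute X (-t)).eq, ← mul_assoc, ← add_mul, neg_add_cancel, zero_mul] at h2
    exact h2
  simpa [endExp_zero] using eq_of_hasWeakDerivAt_zero h t

theorem endExp_mul_neg (X : Module.End ℝ M) (t : ℝ) :
    endExp (t • X) * endExp ((-t) • X) = 1 := by
  simpa using endExp_neg_mul X (-t)

/-- The exponentials of compatible endomorphisms respect a bilinear map. -/
theorem endExp_bilin (X : Module.End ℝ M) (Y : Module.End ℝ N) (W : Module.End ℝ P)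
    (β : M →ₗ[ℝ] N →ₗ[ℝ] P) (h : ∀ x y, W (β x y) = β (X x) y + β x (Y y)) (t : ℝ) (x : M) (y : N) :
    β (endExp (t • X) x) (endExp (t • Y) y) = endExp (t • W) (β x y) := by
  -- Pulling the left side back by the exponential of `-s W` gives a curve with zero derivative,
  -- hence a constant one.
  have hd : ∀ t : ℝ, HasWeakDerivAt (fun s : ℝ => endExp ((-s) • W)
      (β (endExp (s • X) x) (endExp (s • Y) y))) 0 t := by
    intro t
    have h1 := HasWeakDerivAt.comp_neg (hasWeakDerivAt_endExp W (-t))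
    have h2 := HasWeakDerivAt.bilin β (hasWeakDerivAt_endExp_apply X x t)
      (hasWeakDerivAt_endExp_apply Y y t)
    rw [← h] at h2
    have h3 := HasWeakDerivAt.bilin LinearMap.id h1 h2
    simp only [LinearMap.id_apply] at h3
    rw [(endExp_commute W (-t)).eq, LinearMap.neg_apply, Module.End.mul_apply,
      neg_add_cancel] at h3
    exact h3
  have := congrArg (endExp (t • W)) (eq_of_hasWeakDerivAt_zero hd t)
  rw [← Module.End.mul_apply, endExp_mul_neg] at this
  simpa [endExp_zero] using this

theorem endExp_intertwine (X : Module.End ℝ M) (Y : Module.End ℝ N) (f : M →ₗ[ℝ] N)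
    (h : ∀ x, f (X x) = Y (f x)) (t : ℝ) (x : M) :
    f (endExp (t • X) x) = endExp (t • Y) (f x) := by
  -- `f` is encoded as the bilinear map (a, x) ↦ a f(x) on ℝ × M, with the zero endomorphism on ℝ.
  have := endExp_bilin (0 : Module.End ℝ ℝ) X Y
    ((LinearMap.lsmul ℝ N).compl₂ f) (by intro a b; simp [h]) t 1 x
  simpa [endExp_zero] using this

/-- The exponential of an endomorphism as an automorphism. -/
def expEquiv (X : Module.End ℝ M) : M ≃ₗ[ℝ] M :=
  LinearEquiv.ofLinearMap (endExp X) (endExp (-X))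
    (by have := endExp_mul_neg X 1; rwa [one_smul, neg_smul, one_smul] at this)
    (by have := endExp_neg_mul X 1; rwa [one_smul, neg_smul, one_smul] at this)

theorem expEquiv_apply (X : Module.End ℝ M) (x : M) : expEquiv X x = endExp X x := rfl

end Exponential

/-! ## The topology of linear groups -/

section Topology

variable {M : Type*} [AddCommGroup M] [Module ℝ M] [Module.Finite ℝ M]

/-- The matrix of a linear automorphism. -/
def autMatrix (a : M ≃ₗ[ℝ] M) :
    Matrix (Fin (Module.finrank ℝ M)) (Fin (Module.finrank ℝ M)) ℝ :=
  LinearMap.toMatrix (Module.finBasis ℝ M) (Module.finBasis ℝ M) (a : M →ₗ[ℝ] M)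

/-- The topology on the group of linear automorphisms induced by that of matrices. -/
@[reducible] def autTopology : TopologicalSpace (M ≃ₗ[ℝ] M) :=
  TopologicalSpace.induced autMatrix inferInstance

attribute [local instance] autTopology

theorem continuous_autMatrix : Continuous (autMatrix (M := M)) := continuous_induced_dom

theorem isInducing_autMatrix : Topology.IsInducing (autMatrix (M := M)) := ⟨rfl⟩

theorem autMatrix_mul (a b : M ≃ₗ[ℝ] M) : autMatrix (a * b) = autMatrix a * autMatrix b :=
  LinearMap.toMatrix_mul _ _ _

theorem autMatrix_one : autMatrix (1 : M ≃ₗ[ℝ] M) = 1 :=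
  LinearMap.toMatrix_one _

theorem autMatrix_inv (a : M ≃ₗ[ℝ] M) : autMatrix a⁻¹ = (autMatrix a)⁻¹ := by
  refine (Matrix.inv_eq_left_inv ?_).symm
  rw [← autMatrix_mul, inv_mul_cancel, autMatrix_one]

theorem isUnit_det_autMatrix (a : M ≃ₗ[ℝ] M) : IsUnit (autMatrix a).det := by
  rw [← Matrix.isUnit_iff_isUnit_det]
  refine IsUnit.of_mul_eq_one (autMatrix a⁻¹) ?_
  rw [← autMatrix_mul, mul_inv_cancel, autMatrix_one]

instance isTopologicalGroup_aut : IsTopologicalGroup (M ≃ₗ[ℝ] M) where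
  continuous_mul := by
    rw [continuous_induced_rng]
    have : (autMatrix ∘ fun p : (M ≃ₗ[ℝ] M) × (M ≃ₗ[ℝ] M) => p.1 * p.2) =
        fun p => autMatrix p.1 * autMatrix p.2 := funext fun p => autMatrix_mul _ _
    rw [this]
    exact (continuous_autMatrix.comp continuous_fst).matrix_mul
      (continuous_autMatrix.comp continuous_snd)
  continuous_inv := by
    rw [continuous_induced_rng]
    have : (autMatrix ∘ fun a : M ≃ₗ[ℝ] M => a⁻¹) =
        fun a => ((autMatrix a).det)⁻¹ • (autMatrix a).adjugate := by
      funext a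
      simp only [Function.comp_apply, autMatrix_inv, Matrix.inv_def, Ring.inverse_eq_inv']
    rw [this]
    have hc := continuous_autMatrix (M := M)
    exact Continuous.smul (M := ℝ) (hc.matrix_det.inv₀ fun a => (isUnit_det_autMatrix a).ne_zero)
      hc.matrix_adjugate

/-- Linear functions of the matrix are continuous. -/
theorem continuous_aut_dual (ξ : Module.Dual ℝ (Module.End ℝ M)) :
    Continuous fun a : M ≃ₗ[ℝ] M => ξ (a : M →ₗ[ℝ] M) := by
  have h : (fun a : M ≃ₗ[ℝ] M => ξ (a : M →ₗ[ℝ] M)) =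
      (ξ ∘ₗ (Matrix.toLin (Module.finBasis ℝ M) (Module.finBasis ℝ M)).toLinearMap) ∘
        autMatrix := by
    funext a
    simp [autMatrix]
  rw [h]
  exact (LinearMap.continuous_of_finiteDimensional _).comp continuous_autMatrix

/-- A map into a group of automorphisms is continuous if its linear functionals are. -/
theorem continuous_aut_of_dual {X : Type*} [TopologicalSpace X] {f : X → (M ≃ₗ[ℝ] M)}
    (h : ∀ ξ : Module.Dual ℝ (Module.End ℝ M), Continuous fun x => ξ (f x : M →ₗ[ℝ] M)) :
    Continuous f := by
  rw [continuous_induced_rng]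
  refine continuous_matrix fun i j => ?_
  exact h ((Matrix.entryLinearMap ℝ ℝ i j) ∘ₗ
    (LinearMap.toMatrix (Module.finBasis ℝ M) (Module.finBasis ℝ M)).toLinearMap)

theorem isCompact_matrixSet_iff (K : Subgroup (M ≃ₗ[ℝ] M)) :
    IsCompact (matrixSet K) ↔ IsCompact (K : Set (M ≃ₗ[ℝ] M)) :=
  (isInducing_autMatrix (M := M)).isCompact_iff.symm

end Topology

end

end ThreeSymmetric

namespace ThreeSymmetric

noncomputable section

attribute [local instance 100] LieRing.ofAssociativeRing
attribute [local instance] autTopology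

/-! ## Invariant inner products -/

section Averaging

variable {M : Type*} [AddCommGroup M] [Module ℝ M] [Module.Finite ℝ M]

/-- A symmetric positive definite bilinear form. -/
structure IsInner {M : Type*} [AddCommGroup M] [Module ℝ M] (g : LinearMap.BilinForm ℝ M) :
    Prop where
  symm : ∀ v w, g v w = g w v
  pos : ∀ v, v ≠ 0 → 0 < g v v

theorem IsInner.eq_zero {M : Type*} [AddCommGroup M] [Module ℝ M] {g : LinearMap.BilinForm ℝ M}
    (hg : IsInner g) {v : M} (h : g v v = 0) : v = 0 := by
  by_contra hv
  exact (hg.pos v hv).ne' h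

theorem IsInner.nonneg {M : Type*} [AddCommGroup M] [Module ℝ M] {g : LinearMap.BilinForm ℝ M}
    (hg : IsInner g) (v : M) : 0 ≤ g v v := by
  by_cases h : v = 0
  · simp [h]
  · exact (hg.pos v h).le

/-- The standard inner product in a basis. -/
def basisForm : LinearMap.BilinForm ℝ M :=
  ∑ i, (LinearMap.mul ℝ ℝ).compl₁₂ ((Module.finBasis ℝ M).coord i) ((Module.finBasis ℝ M).coord i)

theorem basisForm_apply (v w : M) : basisForm v w =
    ∑ i, (Module.finBasis ℝ M).coord i v * (Module.finBasis ℝ M).coord i w := by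
  simp [basisForm]

theorem isInner_basisForm : IsInner (basisForm (M := M)) where
  symm v w := by simp [basisForm_apply, mul_comm]
  pos v hv := by
    rw [basisForm_apply]
    obtain ⟨i, hi⟩ : ∃ i, (Module.finBasis ℝ M).coord i v ≠ 0 := by
      by_contra! h
      exact hv ((Module.finBasis ℝ M).ext_elem fun i => by simpa using h i)
    exact Finset.sum_pos' (fun j _ => mul_self_nonneg _)
      ⟨i, Finset.mem_univ _, mul_self_pos.mpr hi⟩

/-- Haar averaging of the standard inner product over `K`. The integrand uses inverses so that left
invariance of the measure gives invariance of the form. -/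
theorem exists_invariant_inner (K : Subgroup (M ≃ₗ[ℝ] M)) (hK : IsCompact (K : Set (M ≃ₗ[ℝ] M))) :
    ∃ g : LinearMap.BilinForm ℝ M, IsInner g ∧ ∀ a ∈ K, ∀ v w, g (a v) (a w) = g v w := by
  let _ : MeasurableSpace K := borel K
  have : BorelSpace K := ⟨rfl⟩
  have : CompactSpace K := isCompact_iff_compactSpace.mp hK
  let μ : MeasureTheory.Measure K := MeasureTheory.Measure.haarMeasure ⊤
  have hcont : ∀ v w : M, Continuous fun a : K => basisForm (a.1⁻¹ v) (a.1⁻¹ w) := by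
    intro v w
    have h : ∀ v i, Continuous fun a : K => (Module.finBasis ℝ M).coord i (a.1⁻¹ v) := by
      intro v i
      exact (continuous_aut_dual ((Module.finBasis ℝ M).coord i ∘ₗ LinearMap.applyₗ v)).comp
        (continuous_inv.comp continuous_subtype_val)
    simp only [basisForm_apply]
    exact continuous_finsetSum _ fun i _ => (h v i).mul (h w i)
  have hint : ∀ v w : M, MeasureTheory.Integrable
      (fun a : K => basisForm (a.1⁻¹ v) (a.1⁻¹ w)) μ := fun v w =>
    (hcont v w).integrable_of_hasCompactSupport (HasCompactSupport.of_compactSpace _)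
  let g : LinearMap.BilinForm ℝ M := LinearMap.mk₂ ℝ
    (fun v w => ∫ a : K, basisForm (a.1⁻¹ v) (a.1⁻¹ w) ∂μ)
    (by
      intro v v' w
      rw [← MeasureTheory.integral_add (hint _ _) (hint _ _)]
      simp)
    (by
      intro c v w
      rw [smul_eq_mul, ← MeasureTheory.integral_const_mul]
      simp)
    (by
      intro v w w'
      rw [← MeasureTheory.integral_add (hint _ _) (hint _ _)]
      simp)
    (by
      intro c v w
      rw [smul_eq_mul, ← MeasureTheory.integral_const_mul]
      simp)
  have hg : ∀ v w, g v w = ∫ a : K, basisForm (a.1⁻¹ v) (a.1⁻¹ w) ∂μ := fun v w => rfl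
  refine ⟨g, ⟨?_, ?_⟩, ?_⟩
  · intro v w
    rw [hg, hg]
    exact MeasureTheory.integral_congr_ae
      (Filter.Eventually.of_forall fun a => isInner_basisForm.symm _ _)
  · intro v hv
    rw [hg]
    refine (hcont v v).integral_pos_of_hasCompactSupport_nonneg_nonzero
      (HasCompactSupport.of_compactSpace _) (fun a => isInner_basisForm.nonneg _) (x := 1) ?_
    refine (isInner_basisForm.pos _ ?_).ne'
    simpa using hv
  · intro b hb v w
    rw [hg, hg, ← MeasureTheory.integral_mul_left_eq_self (μ := μ) _ (⟨b, hb⟩ : K)]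
    refine MeasureTheory.integral_congr_ae (Filter.Eventually.of_forall fun a => ?_)
    have : ∀ u : M, (b * a.1)⁻¹ (b u) = a.1⁻¹ u := by
      intro u
      rw [mul_inv_rev, LinearEquiv.mul_apply]
      congr 1
      exact b.symm_apply_apply u
    simp only [Subgroup.coe_mul, this]

/-- A form invariant under a group is skew with respect to its Lie algebra. -/
theorem skew_of_invariant {g : LinearMap.BilinForm ℝ M} {X : Module.End ℝ M}
    (h : ∀ (t : ℝ) v w, g (endExp (t • X) v) (endExp (t • X) w) = g v w) (v w : M) :
    g (X v) w + g v (X w) = 0 := by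
  have h1 := HasWeakDerivAt.bilin g (hasWeakDerivAt_endExp_apply X v 0)
    (hasWeakDerivAt_endExp_apply X w 0)
  simp only [h, zero_smul, endExp_zero, Module.End.one_apply] at h1
  exact h1.unique (hasWeakDerivAt_const (M := ℝ) _ 0)

theorem Integrates.skew {k : Type*} [LieRing k] [LieAlgebra ℝ k] {ρ : k →ₗ⁅ℝ⁆ Module.End ℝ M}
    {J : Module.End ℝ M} {K : Subgroup (M ≃ₗ[ℝ] M)} (hK : Integrates ρ J K)
    {g : LinearMap.BilinForm ℝ M} (hg : ∀ a ∈ K, ∀ v w, g (a v) (a w) = g v w) (F : k) (v w : M) :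
    g (ρ F v) w + g v (ρ F w) = 0 := by
  refine skew_of_invariant (fun t v w => ?_) v w
  obtain ⟨a, ha, h⟩ := (hK.lieAlgebra (ρ F)).mpr ⟨F, rfl⟩ t
  rw [← h]
  exact hg a ha v w

/-- An inner product has an orthonormal basis. -/
theorem IsInner.exists_basis {g : LinearMap.BilinForm ℝ M} (hg : IsInner g) :
    ∃ b : Module.Basis (Fin (Module.finrank ℝ M)) ℝ M, ∀ i j, g (b i) (b j) = if i = j then 1 else 0 := by
  let core : InnerProductSpace.Core ℝ M :=
    { inner := fun v w => g v w
      conj_inner_symm := fun v w => by simpa using hg.symm w v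
      re_inner_nonneg := fun v => by simpa using hg.nonneg v
      add_left := fun u v w => by simp
      smul_left := fun u v r => by simp
      definite := fun v h => hg.eq_zero h }
  let _ := core.toNormedAddCommGroup
  let _ : InnerProductSpace ℝ M := InnerProductSpace.ofCore core.toCore
  let b := stdOrthonormalBasis ℝ M
  refine ⟨b.toBasis, fun i j => ?_⟩
  have := orthonormal_iff_ite.mp b.orthonormal i j
  rw [OrthonormalBasis.coe_toBasis]
  exact this

end Averaging

end

end ThreeSymmetric

namespace ThreeSymmetric

noncomputable section

attribute [local instance 100] LieRing.ofAssociativeRing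
attribute [local instance] autTopology

/-! ## Compactly embedded subalgebras of Lie algebras with nondegenerate Killing form -/

section SymmetryGroup

variable {L : Type*} [LieRing L] [LieAlgebra ℝ L]

/-- The automorphisms of a Lie algebra which commute with two endomorphisms and preserve a bilinear
form. -/
def symmetryGroup (p j : Module.End ℝ L) (G : LinearMap.BilinForm ℝ L) :
    Subgroup (L ≃ₗ[ℝ] L) where
  carrier := {φ | (∀ x y, φ ⁅x, y⁆ = ⁅φ x, φ y⁆) ∧ (∀ x, φ (p x) = p (φ x)) ∧
    (∀ x, φ (j x) = j (φ x)) ∧ ∀ x y, G (φ x) (φ y) = G x y}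
  one_mem' := by simp
  mul_mem' := by
    rintro φ ψ ⟨h1, h2, h3, h4⟩ ⟨k1, k2, k3, k4⟩
    refine ⟨fun x y => ?_, fun x => ?_, fun x => ?_, fun x y => ?_⟩ <;>
      simp [LinearEquiv.mul_apply, *]
  inv_mem' := by
    rintro φ ⟨h1, h2, h3, h4⟩
    have h : ∀ x, φ (φ⁻¹ x) = x := φ.apply_symm_apply
    refine ⟨fun x y => φ.injective ?_, fun x => φ.injective ?_, fun x => φ.injective ?_,
      fun x y => ?_⟩
    · rw [h1, h, h, h]
    · rw [h2, h, h]
    · rw [h3, h, h]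
    · rw [← h4, h, h]

variable [Module.Finite ℝ L]

theorem continuous_dual_bilin {X M N P : Type*} [TopologicalSpace X] [AddCommGroup M] [Module ℝ M]
    [Module.Finite ℝ M] [AddCommGroup N] [Module ℝ N] [AddCommGroup P] [Module ℝ P]
    {c : X → M} {d : X → N} (hc : ∀ ξ : Module.Dual ℝ M, Continuous fun x => ξ (c x))
    (hd : ∀ ξ : Module.Dual ℝ N, Continuous fun x => ξ (d x)) (β : M →ₗ[ℝ] N →ₗ[ℝ] P)
    (ξ : Module.Dual ℝ P) : Continuous fun x => ξ (β (c x) (d x)) := by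
  let e := Module.finBasis ℝ M
  have key : ∀ x y, ξ (β x y) = ∑ i, e.coord i x * ξ (β (e i) y) := by
    intro x y
    conv_lhs => rw [← e.sum_repr x]
    simp only [map_sum, map_smul, LinearMap.sum_apply, LinearMap.smul_apply, smul_eq_mul,
      Module.Basis.coord_apply]
  rw [show (fun s => ξ (β (c s) (d s))) = fun s => ∑ i, e.coord i (c s) * ξ (β (e i) (d s)) from
      funext fun s => key _ _]
  exact continuous_finsetSum _ fun i _ => (hc (e.coord i)).mul (hd (ξ ∘ₗ β (e i)))

theorem isClosed_setOf_dual_eq {X M : Type*} [TopologicalSpace X] [AddCommGroup M] [Module ℝ M]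
    {c d : X → M} (hc : ∀ ξ : Module.Dual ℝ M, Continuous fun x => ξ (c x))
    (hd : ∀ ξ : Module.Dual ℝ M, Continuous fun x => ξ (d x)) : IsClosed {x | c x = d x} := by
  have : {x | c x = d x} = ⋂ ξ : Module.Dual ℝ M, {x | ξ (c x) = ξ (d x)} := by
    ext x
    simp only [Set.mem_ofPred_eq, Set.mem_iInter]
    refine ⟨fun h ξ => by rw [h], fun h => ?_⟩
    rw [← sub_eq_zero, ← Module.forall_dual_apply_eq_zero_iff ℝ]
    intro ξ
    rw [map_sub, h, sub_self]
  rw [this]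
  exact isClosed_iInter fun ξ => isClosed_eq (hc ξ) (hd ξ)

/-- The defining conditions are closed conditions on matrices, and preserving an inner product
bounds the entries in an orthonormal basis. -/
theorem isCompact_symmetryGroup (p j : Module.End ℝ L) {G : LinearMap.BilinForm ℝ L}
    (hG : IsInner G) : IsCompact (symmetryGroup p j G : Set (L ≃ₗ[ℝ] L)) := by
  rw [(isInducing_autMatrix (M := L)).isCompact_iff]
  let e := Module.finBasis ℝ L
  let E : Matrix (Fin (Module.finrank ℝ L)) (Fin (Module.finrank ℝ L)) ℝ ≃ₗ[ℝ] Module.End ℝ L :=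
    Matrix.toLin e e
  let S : Set (Matrix (Fin (Module.finrank ℝ L)) (Fin (Module.finrank ℝ L)) ℝ) :=
    {A | (∀ x y, E A ⁅x, y⁆ = ⁅E A x, E A y⁆) ∧ (∀ x, E A (p x) = p (E A x)) ∧
      (∀ x, E A (j x) = j (E A x)) ∧ ∀ x y, G (E A x) (E A y) = G x y}
  have hES : ∀ a : L ≃ₗ[ℝ] L, E (autMatrix a) = a := fun a => Matrix.toLin_toMatrix _ _ _
  have hS : autMatrix '' (symmetryGroup p j G : Set (L ≃ₗ[ℝ] L)) = S := by
    ext A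
    constructor
    · rintro ⟨φ, h, rfl⟩
      change (∀ x y, E _ ⁅x, y⁆ = ⁅E _ x, E _ y⁆) ∧ _
      rw [hES]
      exact h
    · intro h
      -- Preserving `G` forces injectivity, so the closed set `S` of matrices contains only
      -- automorphisms and no determinant condition is needed.
      have hinj : Function.Injective (E A) := by
        rw [injective_iff_map_eq_zero]
        intro x hx
        refine hG.eq_zero ?_
        rw [← h.2.2.2, hx, map_zero]
      have hE : ((LinearEquiv.ofInjectiveEndo (E A) hinj : L ≃ₗ[ℝ] L) : L →ₗ[ℝ] L) = E A := rfl
      refine ⟨LinearEquiv.ofInjectiveEndo (E A) hinj, h, ?_⟩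
      rw [autMatrix, hE]
      exact LinearMap.toMatrix_toLin _ _ _
  rw [hS]
  have hcont : ∀ x, ∀ ξ : Module.Dual ℝ L, Continuous fun A => ξ (E A x) := fun x ξ =>
    (ξ ∘ₗ LinearMap.applyₗ x ∘ₗ E.toLinearMap).continuous_of_finiteDimensional
  have hclosed : IsClosed S := by
    have : S = (⋂ x, ⋂ y, {A | E A ⁅x, y⁆ = ⁅E A x, E A y⁆}) ∩ ((⋂ x, {A | E A (p x) = p (E A x)}) ∩
      ((⋂ x, {A | E A (j x) = j (E A x)}) ∩ ⋂ x, ⋂ y, {A | G (E A x) (E A y) = G x y})) := by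
      ext A
      simp [S]
    rw [this]
    refine IsClosed.inter (isClosed_iInter fun x => isClosed_iInter fun y => ?_)
      (IsClosed.inter (isClosed_iInter fun x => ?_) (IsClosed.inter (isClosed_iInter fun x => ?_)
        (isClosed_iInter fun x => isClosed_iInter fun y => ?_)))
    · exact isClosed_setOf_dual_eq (hcont _) (continuous_dual_bilin (hcont x) (hcont y)
        (LieModule.toEnd ℝ L L).toLinearMap)
    · exact isClosed_setOf_dual_eq (hcont _) fun ξ => hcont x (ξ ∘ₗ p)
    · exact isClosed_setOf_dual_eq (hcont _) fun ξ => hcont x (ξ ∘ₗ j)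
    · exact isClosed_setOf_dual_eq (continuous_dual_bilin (hcont x) (hcont y) G)
        fun ξ => continuous_const
  obtain ⟨b, hb⟩ := hG.exists_basis
  -- Change of basis: entries lie in [-1, 1] in a `G`-orthonormal basis, while the topology is
  -- defined through the fixed basis.
  let Ψ : Matrix (Fin (Module.finrank ℝ L)) (Fin (Module.finrank ℝ L)) ℝ →ₗ[ℝ]
      Matrix (Fin (Module.finrank ℝ L)) (Fin (Module.finrank ℝ L)) ℝ :=
    E.symm.toLinearMap ∘ₗ (Matrix.toLin b b).toLinearMap
  let B : Set (Matrix (Fin (Module.finrank ℝ L)) (Fin (Module.finrank ℝ L)) ℝ) :=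
    Set.univ.pi fun _ => Set.univ.pi fun _ => Set.Icc (-1) 1
  have hB : IsCompact B := isCompact_univ_pi fun _ => isCompact_univ_pi fun _ => isCompact_Icc
  refine (hB.image Ψ.continuous_of_finiteDimensional).of_isClosed_subset hclosed ?_
  intro A hA
  refine ⟨LinearMap.toMatrix b b (E A), ?_, ?_⟩
  · intro i _ l _
    have hnorm : ∀ x, G x x = ∑ i, b.repr x i * b.repr x i := by
      intro x
      conv_lhs => rw [← b.sum_repr x]
      simp only [map_sum, map_smul, LinearMap.sum_apply, LinearMap.smul_apply, hb, smul_eq_mul,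
        mul_ite, mul_one, mul_zero, Finset.sum_ite_eq', Finset.mem_univ, if_true]
    have h1 : ∑ i, b.repr (E A (b l)) i * b.repr (E A (b l)) i = 1 := by
      rw [← hnorm, hA.2.2.2, hb, if_pos rfl]
    have h2 : b.repr (E A (b l)) i * b.repr (E A (b l)) i ≤ 1 := by
      rw [← h1]
      exact Finset.single_le_sum (f := fun i => b.repr (E A (b l)) i * b.repr (E A (b l)) i)
        (fun i _ => mul_self_nonneg _) (Finset.mem_univ i)
    rw [LinearMap.toMatrix_apply]
    exact abs_le.mp (abs_le_one_iff_mul_self_le_one.mpr h2)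
  · simp [Ψ]

end SymmetryGroup

/-! ### The Lie algebra of the symmetry group. -/

section CompactLemma

variable {L : Type*} [LieRing L] [LieAlgebra ℝ L] [Module.Finite ℝ L]

theorem continuous_expEquiv_smul {M : Type*} [AddCommGroup M] [Module ℝ M] [Module.Finite ℝ M]
    (X : Module.End ℝ M) : Continuous fun t : ℝ => expEquiv (t • X) := by
  refine continuous_aut_of_dual fun ξ => ?_
  rw [continuous_iff_continuousAt]
  exact fun t => (hasWeakDerivAt_endExp X t ξ).continuousAt

/-- The integrating group is the restriction to `H` of the identity component of the group of
automorphisms of `L` preserving `G`, the projection to `H`, and `J`. It contains the exponentials of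
`k`. Conversely, a one-parameter group in it differentiates to a derivation of `L`, which is inner
because the Killing form is nondegenerate. The absence of `k`-fixed vectors in `H` then places the
generator in `k`. -/
theorem isCompactlyEmbedded_adRep [LieAlgebra.IsKilling ℝ L] (k : LieSubalgebra ℝ L)
    (H : Submodule ℝ L) (hc : IsCompl k.toSubmodule H) (h : ∀ F ∈ k, ∀ x ∈ H, ⁅F, x⁆ ∈ H)
    (J : Module.End ℝ H) (hJ : ∀ F x, adRep k H h F (J x) = J (adRep k H h F x))
    (hf : Function.Injective (adRep k H h)) (hfix : ∀ y ∈ H, (∀ F ∈ k, ⁅F, y⁆ = 0) → y = 0)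
    {G : LinearMap.BilinForm ℝ L} (hG : IsInner G)
    (hs : ∀ F ∈ k, ∀ x y, G ⁅F, x⁆ y + G x ⁅F, y⁆ = 0) :
    IsCompactlyEmbedded (adRep k H h) J := by
  let pH : L →ₗ[ℝ] H := H.projectionOnto k.toSubmodule hc.symm
  let pk : L →ₗ[ℝ] k := k.toSubmodule.projectionOnto H hc
  have pH_H : ∀ x : H, pH x = x := Submodule.projectionOnto_apply_left hc.symm
  have pH_k : ∀ x : k, pH x = 0 := Submodule.projectionOnto_apply_right hc.symm
  have pk_k : ∀ x : k, pk x = x := Submodule.projectionOnto_apply_left hc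
  have pk_H : ∀ x : H, pk x = 0 := Submodule.projectionOnto_apply_right hc
  have hdec : ∀ x, (pk x : L) + pH x = x := fun x =>
    Submodule.projection_add_projection_eq_self hc x
  have pH_lie : ∀ (F : k) x, pH ⁅(F : L), x⁆ = adRep k H h F (pH x) := by
    intro F x
    conv_lhs => rw [← hdec x]
    rw [lie_add, map_add, ← LieSubalgebra.coe_bracket, pH_k, zero_add]
    exact pH_H (adRep k H h F (pH x))
  let p : Module.End ℝ L := H.subtype ∘ₗ pH
  let j : Module.End ℝ L := H.subtype ∘ₗ J ∘ₗ pH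
  let Γ := symmetryGroup p j G
  have hΓH : ∀ φ ∈ Γ, ∀ y : H, ((pH (φ y) : H) : L) = φ y := by
    intro φ hφ y
    have := hφ.2.1 y
    change φ (pH y : L) = (pH (φ y) : L) at this
    rw [← this, pH_H]
  let res : Γ →* (H ≃ₗ[ℝ] H) := MonoidHom.mk'
    (fun φ => LinearEquiv.ofLinearMap (pH ∘ₗ (φ.1 : L →ₗ[ℝ] L) ∘ₗ H.subtype)
      (pH ∘ₗ ((φ⁻¹).1 : L →ₗ[ℝ] L) ∘ₗ H.subtype)
      (by
        ext y
        simp only [LinearMap.comp_apply, Submodule.subtype_apply, LinearEquiv.coe_coe,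
          LinearMap.id_apply]
        rw [hΓH _ (φ⁻¹).2, show φ.1 ((φ⁻¹).1 y) = y from φ.1.apply_symm_apply y, pH_H])
      (by
        ext y
        simp only [LinearMap.comp_apply, Submodule.subtype_apply, LinearEquiv.coe_coe,
          LinearMap.id_apply]
        rw [hΓH _ φ.2, show (φ⁻¹).1 (φ.1 y) = y from φ.1.symm_apply_apply y, pH_H]))
    (by
      intro φ ψ
      ext y
      change (pH (φ.1 (ψ.1 y)) : L) = pH (φ.1 (pH (ψ.1 y)))
      rw [hΓH _ ψ.2])
  have hres : ∀ (φ : Γ) (y : H), ((res φ y : H) : L) = φ.1 y := fun φ y => hΓH φ.1 φ.2 y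
  have hrescont : Continuous res := by
    refine continuous_aut_of_dual fun ξ => ?_
    exact (continuous_aut_dual (ξ ∘ₗ (LinearMap.compRight ℝ pH) ∘ₗ
      (LinearMap.lcomp ℝ L H.subtype))).comp continuous_subtype_val
  have : CompactSpace Γ := isCompact_iff_compactSpace.mp (isCompact_symmetryGroup p j hG)
  let C : Subgroup Γ := Subgroup.connectedComponentOfOne Γ
  have hC : (C : Set Γ) = connectedComponent 1 := rfl
  let K : Subgroup (H ≃ₗ[ℝ] H) := C.map res
  have hK : (K : Set (H ≃ₗ[ℝ] H)) = res '' connectedComponent 1 := rfl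
  -- one parameter groups generated by `k`
  have hexp : ∀ (F : k) (t : ℝ), expEquiv (t • LieAlgebra.ad ℝ L F) ∈ Γ := by
    intro F t
    refine ⟨fun x y => ?_, fun x => ?_, fun x => ?_, fun x y => ?_⟩ <;>
      simp only [expEquiv_apply]
    · exact (endExp_bilin (LieAlgebra.ad ℝ L F) (LieAlgebra.ad ℝ L F) (LieAlgebra.ad ℝ L F)
        (LieModule.toEnd ℝ L L).toLinearMap (fun x y => by simp) t x y).symm
    · refine (endExp_intertwine _ _ p (fun x => ?_) t x).symm
      simp only [p, LinearMap.comp_apply, LieAlgebra.ad_apply, pH_lie]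
      rfl
    · refine (endExp_intertwine _ _ j (fun x => ?_) t x).symm
      simp only [j, LinearMap.comp_apply, LieAlgebra.ad_apply, pH_lie, ← hJ]
      rfl
    · have := endExp_bilin (LieAlgebra.ad ℝ L F) (LieAlgebra.ad ℝ L F) (0 : Module.End ℝ ℝ) G
        (fun x y => by simpa using (hs F F.2 x y).symm) t x y
      simpa [endExp_zero] using this
  refine ⟨K, ⟨?_, ?_, ?_, hf, ?_⟩⟩
  · rw [isCompact_matrixSet_iff, hK]
    exact (isClosed_connectedComponent.isCompact).image hrescont
  · change IsConnected (autMatrix '' (K : Set (H ≃ₗ[ℝ] H)))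
    rw [hK]
    exact (isConnected_connectedComponent.image res hrescont.continuousOn).image _
      continuous_autMatrix.continuousOn
  · rintro _ ⟨φ, -, rfl⟩ v
    apply Subtype.ext
    rw [hres]
    have := φ.2.2.2.1 v
    change φ.1 (J (pH v) : L) = (J (pH (φ.1 v)) : L) at this
    rw [pH_H] at this
    rw [this]
    congr 2
  · intro X
    constructor
    · intro hX
      have hφ : ∀ t : ℝ, ∃ φ ∈ Γ, ∀ y : H, φ y = (endExp (t • X) y : H) := by
        intro t
        obtain ⟨a, ⟨φ, -, rfl⟩, ha⟩ := hX t
        refine ⟨φ.1, φ.2, fun y => ?_⟩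
        rw [← ha, ← hres]
        rfl
      choose φ hφΓ hφH using hφ
      obtain ⟨l, hl⟩ := LinearMap.exists_leftInverse_of_injective
        (adRep k H h).toLinearMap (LinearMap.ker_eq_bot.mpr hf)
      have hl' : ∀ F, l (adRep k H h F) = F := fun F => LinearMap.congr_fun hl F
      -- An automorphism preserving the splitting is determined on `k` by its restriction to `H`:
      -- the representation is faithful, and `φ t` conjugates ad F. The left inverse `l` reads the
      -- conjugate back as an element of `k`.
      have hφk : ∀ (t : ℝ) (F : k), φ t F =
          l (endExp (t • X) * adRep k H h F * endExp ((-t) • X)) := by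
        intro t F
        have h0 : φ t F = (pk (φ t F) : L) := by
          have h1 := (hφΓ t).2.1 F
          change φ t (pH F : L) = (pH (φ t F) : L) at h1
          rw [pH_k, Submodule.coe_zero, map_zero] at h1
          have h2 := hdec (φ t F)
          rw [← h1, add_zero] at h2
          exact h2.symm
        have h1 : adRep k H h (pk (φ t F)) * endExp (t • X) =
            endExp (t • X) * adRep k H h F := by
          ext y
          change ⁅(pk (φ t F) : L), (endExp (t • X) y : L)⁆ = endExp (t • X) (adRep k H h F y)
          rw [← hφH, ← hφH, ← h0]
          exact ((hφΓ t).1 F y).symm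
        rw [← h1, mul_assoc, endExp_mul_neg, mul_one, hl', ← h0]
      -- The derivative of `φ t` at `t = 0`: it is `X` on `H`, and on `k` it is the commutator with
      -- `X` read back through `l`.
      let D : Module.End ℝ L := H.subtype ∘ₗ X ∘ₗ pH +
        k.toSubmodule.subtype ∘ₗ l ∘ₗ (LinearMap.mulLeft ℝ X - LinearMap.mulRight ℝ X) ∘ₗ
          (adRep k H h).toLinearMap ∘ₗ pk
      have hD : ∀ x, D x = (X (pH x) : L) +
          l (X * adRep k H h (pk x) - adRep k H h (pk x) * X) := fun x => rfl
      have hderiv : ∀ x, HasWeakDerivAt (fun t => φ t x) (D x) 0 := by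
        intro x
        have h1 : ∀ t, φ t x = (endExp (t • X) (pH x) : L) +
            l (endExp (t • X) * adRep k H h (pk x) * endExp ((-t) • X)) := by
          intro t
          rw [← hφk, ← hφH, ← map_add, add_comm, hdec]
        simp only [h1, hD]
        refine ((hasWeakDerivAt_endExp_zero X).map (H.subtype ∘ₗ LinearMap.applyₗ (pH x))).add ?_
        have h2 := (hasWeakDerivAt_endExp_zero X).map (LinearMap.mulRight ℝ (adRep k H h (pk x)))
        have h3 : HasWeakDerivAt (fun s : ℝ => endExp ((-s) • X)) (-X) 0 :=
          HasWeakDerivAt.comp_neg (c := fun s : ℝ => endExp (s • X)) (by simpa using hasWeakDerivAt_endExp_zero X)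
        have h4 := (h2.bilin (LinearMap.mul ℝ (Module.End ℝ H)) h3).map
          (k.toSubmodule.subtype ∘ₗ l)
        simp only [LinearMap.mul_apply', LinearMap.mulRight_apply, neg_zero, zero_smul, endExp_zero,
          mul_one, one_mul] at h4
        have h5 : ∀ A : Module.End ℝ H, X * A + A * -X = X * A - A * X := fun A => by
          ext
          simp [sub_eq_add_neg]
        rw [h5] at h4
        exact h4
      have hφ0 : ∀ x, φ 0 x = x := by
        intro x
        conv_lhs => rw [← hdec x]
        rw [map_add, hφH, hφk]
        simp [endExp_zero, hl', hdec]
      have hleib : ∀ x y, D ⁅x, y⁆ = ⁅D x, y⁆ + ⁅x, D y⁆ := by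
        intro x y
        refine (hderiv ⁅x, y⁆).unique ?_
        have h1 := HasWeakDerivAt.bilin (LieModule.toEnd ℝ L L).toLinearMap (hderiv x) (hderiv y)
        simp only [LieHom.coe_toLinearMap, LieModule.toEnd_apply_apply, hφ0] at h1
        simpa only [(hφΓ _).1] using h1
      let D' : LieDerivation ℝ L L :=
        { D with
          leibniz' := fun x y => by
            change D ⁅x, y⁆ = ⁅x, D y⁆ - ⁅y, D x⁆
            rw [hleib, ← lie_skew (D x) y]
            abel }
      obtain ⟨z, hz⟩ := LieDerivation.IsKilling.exists_eq_ad D'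
      have hz' : ∀ x, ⁅z, x⁆ = D x := fun x => by
        rw [show D x = D' x from rfl, ← hz]
        simp
      -- `D` maps `k` into `k`, so for `F` in `k` the bracket of `F` with the `H`-part of `z` lies
      -- in `k ∩ H = 0`; the absence of fixed vectors finishes.
      have hzk : (pH z : L) = 0 := by
        refine hfix _ (pH z).2 fun F hF => ?_
        have h1 : ⁅F, (pH z : L)⁆ ∈ k := by
          have h2 : ⁅F, z⁆ ∈ k := by
            rw [← lie_skew, hz', hD]
            refine neg_mem (add_mem ?_ (Subtype.mem _))
            rw [show pH F = 0 from pH_k ⟨F, hF⟩, map_zero]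
            exact zero_mem _
          have h3 : ⁅F, (pH z : L)⁆ = ⁅F, z⁆ - ⁅F, (pk z : L)⁆ := by
            rw [← lie_sub, ← hdec z]
            simp [pk_k, pk_H, pH_k, pH_H]
          rw [h3]
          exact sub_mem h2 (k.lie_mem hF (pk z).2)
        exact (Submodule.disjoint_def.mp hc.disjoint) _ h1 (h F hF _ (pH z).2)
      refine ⟨pk z, ?_⟩
      ext y
      change ⁅(pk z : L), (y : L)⁆ = X y
      have h1 := hz' y
      rw [← hdec z, hzk, add_zero, hD, pH_H, pk_H] at h1
      simpa using h1
    · rintro ⟨F, rfl⟩ t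
      refine ⟨res ⟨_, hexp F t⟩, ⟨⟨_, hexp F t⟩, ?_, rfl⟩, ?_⟩
      · have hpath : Continuous fun s : ℝ => (⟨_, hexp F s⟩ : Γ) :=
          (continuous_expEquiv_smul _).subtype_mk _
        refine (isPreconnected_range hpath).subset_connectedComponent ⟨0, ?_⟩ ⟨t, rfl⟩
        apply Subtype.ext
        ext x
        simp [expEquiv_apply, endExp_zero]
      · ext y
        refine (hres _ y).trans ?_
        exact (endExp_intertwine (adRep k H h F) (LieAlgebra.ad ℝ L F) H.subtype
          (fun x => rfl) t y).symm

end CompactLemma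

end

end ThreeSymmetric

namespace ThreeSymmetric

noncomputable section

attribute [local instance 100] LieRing.ofAssociativeRing

/-! ## Algebra of 3-symmetric Lie algebras -/

section Identities

variable {𝔤 : Type*} [LieRing 𝔤] [LieAlgebra ℝ 𝔤] {σ : 𝔤 ≃ₗ⁅ℝ⁆ 𝔤}

theorem mem_isotropy {x : 𝔤} : x ∈ isotropy σ ↔ σ x = x := Iff.rfl

theorem mem_tangent {x : 𝔤} : x ∈ tangent σ ↔ σ (σ x) + σ x + x = 0 := Iff.rfl

theorem sigma_sigma_of_tangent {x : 𝔤} (hx : x ∈ tangent σ) : σ (σ x) = -σ x - x := by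
  have := mem_tangent.mp hx
  rw [add_assoc] at this
  rw [eq_neg_of_add_eq_zero_left this]
  abel

theorem sigma_mem_tangent {x : 𝔤} (hx : x ∈ tangent σ) : σ x ∈ tangent σ := by
  rw [mem_tangent, ← map_add, ← map_add, mem_tangent.mp hx, map_zero]

theorem sigmaJ_sigmaJ {x : 𝔤} (hx : x ∈ tangent σ) : sigmaJ σ (sigmaJ σ x) = -x := by
  have h3 : (1 / √3 : ℝ) * (1 / √3) = 1 / 3 := by
    rw [div_mul_div_comm, Real.mul_self_sqrt (by norm_num)]
    norm_num
  simp only [sigmaJ_apply, map_smul, map_add, sigma_sigma_of_tangent hx]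
  have : (1 / √3 : ℝ) • ((2 : ℝ) • (1 / √3 : ℝ) • ((2 : ℝ) • (-σ x - x) + σ x) +
      (1 / √3 : ℝ) • ((2 : ℝ) • σ x + x)) =
      ((1 / √3 : ℝ) * (1 / √3)) • ((-3 : ℝ) • x) := by module
  rw [this, h3]
  module

theorem sigma_eq_sigmaJ (x : 𝔤) : σ x = (-(1 / 2) : ℝ) • x + (√3 / 2) • sigmaJ σ x := by
  rw [sigmaJ_apply, smul_smul]
  have : √3 / 2 * (1 / √3) = 1 / 2 := by field_simp
  rw [this]
  module

theorem sigmaJ_mem_of_sigma_mem {S : Submodule ℝ 𝔤} (hS : ∀ x ∈ S, σ x ∈ S) {x : 𝔤} (hx : x ∈ S) :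
    sigmaJ σ x ∈ S := by
  rw [sigmaJ_apply]
  exact S.smul_mem _ (S.add_mem (S.smul_mem _ (hS x hx)) hx)

theorem sigma_mem_of_sigmaJ_mem {S : Submodule ℝ 𝔤} {x : 𝔤} (hx : x ∈ S) (hj : sigmaJ σ x ∈ S) :
    σ x ∈ S := by
  rw [sigma_eq_sigmaJ]
  exact S.add_mem (S.smul_mem _ hx) (S.smul_mem _ hj)

theorem sigmaJ_lie_isotropy {F : 𝔤} (hF : F ∈ isotropy σ) (x : 𝔤) :
    sigmaJ σ ⁅F, x⁆ = ⁅F, sigmaJ σ x⁆ := by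
  simp only [sigmaJ_apply, LieEquiv.map_lie, mem_isotropy.mp hF, lie_smul, lie_add]

theorem tangentPart_lie_isotropy {F : 𝔤} (hF : F ∈ isotropy σ) (x : 𝔤) :
    tangentPart σ ⁅F, x⁆ = ⁅F, tangentPart σ x⁆ := by
  simp only [tangentPart_apply, LieEquiv.map_lie, mem_isotropy.mp hF, lie_smul, lie_sub]

theorem disjoint_isotropy_tangent {x : 𝔤} (h1 : x ∈ isotropy σ) (h2 : x ∈ tangent σ) : x = 0 := by
  rw [← tangentPart_of_tangent σ x h2, tangentPart_of_isotropy σ x h1]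

/-- The projection of `𝔤 = 𝔥 ⊕ 𝕍` onto `𝔥`. -/
def isotropyPart (σ : 𝔤 ≃ₗ⁅ℝ⁆ 𝔤) : Module.End ℝ 𝔤 := LinearMap.id - tangentPart σ

theorem isotropyPart_apply (x : 𝔤) : isotropyPart σ x = x - tangentPart σ x := rfl

theorem isotropyPart_add_tangentPart (x : 𝔤) : isotropyPart σ x + tangentPart σ x = x := by
  rw [isotropyPart_apply, sub_add_cancel]

theorem isotropyPart_of_isotropy {x : 𝔤} (hx : x ∈ isotropy σ) : isotropyPart σ x = x := by
  rw [isotropyPart_apply, tangentPart_of_isotropy σ x hx, sub_zero]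

theorem isotropyPart_of_tangent {x : 𝔤} (hx : x ∈ tangent σ) : isotropyPart σ x = 0 := by
  rw [isotropyPart_apply, tangentPart_of_tangent σ x hx, sub_self]

theorem isotropyPart_lie_isotropy {F : 𝔤} (hF : F ∈ isotropy σ) (x : 𝔤) :
    isotropyPart σ ⁅F, x⁆ = ⁅F, isotropyPart σ x⁆ := by
  rw [isotropyPart_apply, isotropyPart_apply, tangentPart_lie_isotropy hF, lie_sub]

theorem tangentPart_mem_of_sigma_mem {S : Submodule ℝ 𝔤} (hS : ∀ x ∈ S, σ x ∈ S) {x : 𝔤}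
    (hx : x ∈ S) : tangentPart σ x ∈ S := by
  rw [tangentPart_apply]
  exact S.smul_mem _ (S.sub_mem (S.sub_mem (S.smul_mem _ hx) (hS x hx)) (hS _ (hS x hx)))

theorem isotropyPart_mem_of_sigma_mem {S : Submodule ℝ 𝔤} (hS : ∀ x ∈ S, σ x ∈ S) {x : 𝔤}
    (hx : x ∈ S) : isotropyPart σ x ∈ S := by
  rw [isotropyPart_apply]
  exact S.sub_mem hx (tangentPart_mem_of_sigma_mem hS hx)

/-- Over ℂ, the bracket of two vectors in the ω-eigenspace of σ lies in the ω²-eigenspace, while the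
bracket of an ω- and an ω²-vector is fixed. So the torsion is J-antilinear in each argument. -/
theorem tangentPart_lie_sigmaJ_left {v w : 𝔤} (hv : v ∈ tangent σ) (hw : w ∈ tangent σ) :
    tangentPart σ ⁅sigmaJ σ v, w⁆ = -sigmaJ σ (tangentPart σ ⁅v, w⁆) := by
  simp only [tangentPart_apply, sigmaJ_apply, map_smul, map_sub, LieEquiv.map_lie,
    sigma_sigma_of_tangent hv, sigma_sigma_of_tangent hw, smul_lie, add_lie, lie_sub,
    sub_lie, lie_neg, neg_lie, map_add, map_neg]
  module

theorem tangentPart_lie_sigmaJ_right {v w : 𝔤} (hv : v ∈ tangent σ) (hw : w ∈ tangent σ) :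
    tangentPart σ ⁅v, sigmaJ σ w⁆ = -sigmaJ σ (tangentPart σ ⁅v, w⁆) := by
  rw [← lie_skew, map_neg, tangentPart_lie_sigmaJ_left hw hv, ← lie_skew v w, map_neg,
    map_neg]

/-- The complementary type condition: the 𝔥-component only sees pairs from conjugate eigenspaces, so
J is skew for it. -/
theorem isotropyPart_lie_sigmaJ_left {v w : 𝔤} (hv : v ∈ tangent σ) (hw : w ∈ tangent σ) :
    isotropyPart σ ⁅sigmaJ σ v, w⁆ = -isotropyPart σ ⁅v, sigmaJ σ w⁆ := by
  simp only [isotropyPart_apply, tangentPart_apply, sigmaJ_apply, map_smul, LieEquiv.map_lie,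
    sigma_sigma_of_tangent hv, sigma_sigma_of_tangent hw, smul_lie, add_lie, lie_add, lie_sub,
    sub_lie, lie_neg, neg_lie, map_add, map_neg, lie_smul, map_sub]
  module

theorem isotropyPart_lie_sigmaJ {v w : 𝔤} (hv : v ∈ tangent σ) (hw : w ∈ tangent σ) :
    isotropyPart σ ⁅sigmaJ σ v, sigmaJ σ w⁆ = isotropyPart σ ⁅v, w⁆ := by
  rw [isotropyPart_lie_sigmaJ_left hv (sigmaJ_mem σ w hw), sigmaJ_sigmaJ hw, lie_neg, map_neg,
    neg_neg]

variable (hσ : ∀ x, σ (σ (σ x)) = x)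
include hσ

theorem isotropyPart_mem (x : 𝔤) : isotropyPart σ x ∈ isotropy σ := by
  rw [mem_isotropy]
  simp only [isotropyPart_apply, tangentPart_apply, map_smul, map_sub, hσ]
  module

/-- If the brackets of `x ∈ 𝕍` with `𝕍` have no component in `𝔥`, then `x` commutes with the
torsion. -/
theorem lie_tangentPart_lie_eq_zero {x : 𝔤} (hx : x ∈ tangent σ)
    (h : ∀ y ∈ tangent σ, ⁅x, y⁆ ∈ tangent σ) {y z : 𝔤} (hy : y ∈ tangent σ) (hz : z ∈ tangent σ) :
    ⁅x, tangentPart σ ⁅y, z⁆⁆ = 0 := by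
  have hR : isotropyPart σ ⁅y, z⁆ ∈ isotropy σ := isotropyPart_mem hσ _
  have hT : tangentPart σ ⁅y, z⁆ ∈ tangent σ := tangentPart_mem σ hσ _
  -- The 𝕍-component of the Jacobi identity for x, y, z, with [y, z] split into torsion and 𝔥-part.
  have key : ∀ x ∈ tangent σ, (∀ y ∈ tangent σ, ⁅x, y⁆ ∈ tangent σ) →
      ⁅x, tangentPart σ ⁅y, z⁆⁆ + ⁅x, isotropyPart σ ⁅y, z⁆⁆ =
        tangentPart σ ⁅⁅x, y⁆, z⁆ + tangentPart σ ⁅y, ⁅x, z⁆⁆ := by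
    intro x hx h
    have h1 : ⁅x, isotropyPart σ ⁅y, z⁆⁆ ∈ tangent σ := by
      rw [← lie_skew]
      exact neg_mem (lie_isotropy_tangent σ _ hR _ hx)
    rw [← map_add, ← leibniz_lie, ← lie_add, add_comm, isotropyPart_add_tangentPart]
    refine (tangentPart_of_tangent σ _ ?_).symm
    have h2 := add_mem (h _ hT) h1
    rwa [← lie_add, add_comm, isotropyPart_add_tangentPart] at h2
  have hlie : ∀ y ∈ tangent σ, ⁅sigmaJ σ x, y⁆ = -sigmaJ σ ⁅x, y⁆ := by
    intro y hy
    have h0 : ⁅sigmaJ σ x, y⁆ ∈ tangent σ := by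
      have h1 := isotropyPart_lie_sigmaJ_left hx hy
      rw [isotropyPart_of_tangent (h _ (sigmaJ_mem σ y hy)), neg_zero] at h1
      rw [← isotropyPart_add_tangentPart (σ := σ) ⁅sigmaJ σ x, y⁆, h1, zero_add]
      exact tangentPart_mem σ hσ _
    rw [← tangentPart_of_tangent σ _ h0, tangentPart_lie_sigmaJ_left hx hy,
      tangentPart_of_tangent σ _ (h y hy)]
  have e1 := key x hx h
  -- Replacing x by Jx multiplies the right side and the term with the 𝔥-part by J, but the torsion
  -- term by -J. Comparison with `e1` leaves 2J[x, τ(y, z)] = 0.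
  have e2 := key (sigmaJ σ x) (sigmaJ_mem σ x hx) fun y hy => by
    rw [hlie y hy]
    exact neg_mem (sigmaJ_mem σ _ (h y hy))
  have hjR : ⁅sigmaJ σ x, isotropyPart σ ⁅y, z⁆⁆ = sigmaJ σ ⁅x, isotropyPart σ ⁅y, z⁆⁆ := by
    rw [← lie_skew, ← sigmaJ_lie_isotropy hR, ← lie_skew x, map_neg]
  rw [hlie _ hT, hlie y hy, hlie z hz, hjR, neg_lie, lie_neg, map_neg, map_neg,
    tangentPart_lie_sigmaJ_left (h y hy) hz, tangentPart_lie_sigmaJ_right hy (h z hz), neg_neg,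
    neg_neg, ← map_add, ← e1, map_add, add_left_inj, neg_eq_iff_add_eq_zero, ← map_add] at e2
  have e3 := congrArg (sigmaJ σ) e2
  have h4 := h _ hT
  rw [sigmaJ_sigmaJ (add_mem h4 h4), map_zero, neg_eq_zero, ← two_smul ℝ] at e3
  exact (smul_eq_zero.mp e3).resolve_left two_ne_zero

omit hσ in
/-- An ideal contained in `𝕍` commutes with the brackets of `𝕍` that lie in `𝕍`. -/
theorem lie_lie_eq_zero_of_ideal (hσ : ∀ x, σ (σ (σ x)) = x) {I : LieIdeal ℝ 𝔤}
    (hI : ∀ x ∈ I, x ∈ tangent σ) {x y z : 𝔤} (hx : x ∈ I) (hy : y ∈ tangent σ)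
    (hz : z ∈ tangent σ) (hyz : ⁅y, z⁆ ∈ tangent σ) : ⁅x, ⁅y, z⁆⁆ = 0 := by
  rw [← tangentPart_of_tangent σ _ hyz]
  exact lie_tangentPart_lie_eq_zero hσ (hI x hx) (fun y _ => hI _ (lie_mem_left ℝ 𝔤 I x y hx)) hy hz

/-- An ideal contained in `𝕍` lies in the radical of the Killing form. -/
theorem killingForm_eq_zero_of_ideal [Module.Finite ℝ 𝔤] {I : LieIdeal ℝ 𝔤}
    (hI : ∀ x ∈ I, x ∈ tangent σ) {x : 𝔤} (hx : x ∈ I) (y : 𝔤) : killingForm ℝ 𝔤 x y = 0 := by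
  rw [killingForm_apply_apply]
  set N : Module.End ℝ 𝔤 := LieAlgebra.ad ℝ 𝔤 x ∘ₗ LieAlgebra.ad ℝ 𝔤 y with hN
  have hNa : ∀ z, N z = ⁅x, ⁅y, z⁆⁆ := fun z => rfl
  have hkill : ∀ v ∈ tangent σ, ∀ i ∈ I, ⁅x, ⁅v, i⁆⁆ = 0 := fun v hv i hi =>
    lie_lie_eq_zero_of_ideal hσ hI hx hv (hI i hi) (hI _ (lie_mem_right ℝ 𝔤 I v i hi))
  have hNI : ∀ z, N z ∈ I := fun z => lie_mem_left ℝ 𝔤 I _ _ hx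
  have hNi : ∀ i ∈ I, N i = ⁅x, ⁅isotropyPart σ y, i⁆⁆ := by
    intro i hi
    rw [hNa]
    conv_lhs => rw [← isotropyPart_add_tangentPart (σ := σ) y]
    rw [add_lie, lie_add, hkill _ (tangentPart_mem σ hσ y) i hi, add_zero]
  -- On `I` only the 𝔥-part F of y contributes to N. Moving F past the inner x leaves terms [x, [v,
  -- i]] with v in 𝕍 and i in `I`, and these vanish by `hkill`.
  have h3 : N ^ 3 = 0 := by
    ext z
    rw [pow_succ, pow_two]
    change N (N (N z)) = 0
    rw [hNi (N (N z)) (hNI _), hNi (N z) (hNI _), leibniz_lie (isotropyPart σ y), lie_add]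
    have hi : ⁅isotropyPart σ y, N z⁆ ∈ I := lie_mem_right ℝ 𝔤 I _ _ (hNI z)
    rw [hkill _ (hI _ (lie_mem_right ℝ 𝔤 I _ _ hx)) _ hi,
      hkill _ (hI _ hx) _ (lie_mem_right ℝ 𝔤 I _ _ hi), add_zero]
  exact (LinearMap.isNilpotent_trace_of_isNilpotent ⟨3, h3⟩).eq_zero

end Identities

/-! ### Trace forms of skew endomorphisms. -/

section Killing

variable {𝔤 : Type*} [LieRing 𝔤] [LieAlgebra ℝ 𝔤] [Module.Finite ℝ 𝔤]

theorem trace_eq_sum_of_orthonormal {M : Type*} [AddCommGroup M] [Module ℝ M] {n : ℕ}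
    {G : LinearMap.BilinForm ℝ M} (b : Module.Basis (Fin n) ℝ M)
    (hb : ∀ i j, G (b i) (b j) = if i = j then 1 else 0) (X : Module.End ℝ M) :
    LinearMap.trace ℝ M X = ∑ i, G (b i) (X (b i)) := by
  rw [LinearMap.trace_eq_matrix_trace ℝ b, Matrix.trace]
  refine Finset.sum_congr rfl fun i _ => ?_
  rw [Matrix.diag_apply, LinearMap.toMatrix_apply]
  conv_rhs => rw [← b.sum_repr (X (b i))]
  simp only [map_sum, map_smul, hb, smul_eq_mul, mul_ite, mul_one, mul_zero, Finset.sum_ite_eq,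
    Finset.mem_univ, if_true]

/-- In an orthonormal basis the trace of X² is minus the sum of the squared lengths of the vectors X
e_i. -/
theorem eq_zero_of_trace_mul_self_eq_zero {M : Type*} [AddCommGroup M] [Module ℝ M]
    [Module.Finite ℝ M] {G : LinearMap.BilinForm ℝ M} (hG : IsInner G) {X : Module.End ℝ M}
    (hX : ∀ v w, G (X v) w + G v (X w) = 0) (h : LinearMap.trace ℝ M (X ∘ₗ X) = 0) : X = 0 := by
  obtain ⟨b, hb⟩ := hG.exists_basis
  rw [trace_eq_sum_of_orthonormal b hb] at h
  have h1 : ∀ i, G (b i) ((X ∘ₗ X) (b i)) = -G (X (b i)) (X (b i)) := fun i =>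
    eq_neg_of_add_eq_zero_right (hX (b i) (X (b i)))
  simp only [h1, Finset.sum_neg_distrib, neg_eq_zero] at h
  rw [Finset.sum_eq_zero_iff_of_nonneg fun i _ => hG.nonneg _] at h
  exact b.ext fun i => hG.eq_zero (h i (Finset.mem_univ i))

theorem trace_mul_self_nonpos {M : Type*} [AddCommGroup M] [Module ℝ M]
    [Module.Finite ℝ M] {G : LinearMap.BilinForm ℝ M} (hG : IsInner G) {X : Module.End ℝ M}
    (hX : ∀ v w, G (X v) w + G v (X w) = 0) : LinearMap.trace ℝ M (X ∘ₗ X) ≤ 0 := by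
  obtain ⟨b, hb⟩ := hG.exists_basis
  rw [trace_eq_sum_of_orthonormal b hb]
  refine Finset.sum_nonpos fun i _ => ?_
  have h1 : G (b i) ((X ∘ₗ X) (b i)) = -G (X (b i)) (X (b i)) :=
    eq_neg_of_add_eq_zero_right (hX (b i) (X (b i)))
  rw [h1, neg_nonpos]
  exact hG.nonneg _

omit [Module.Finite ℝ 𝔤] in
theorem killingForm_sigma (σ : 𝔤 ≃ₗ⁅ℝ⁆ 𝔤) (x y : 𝔤) :
    killingForm ℝ 𝔤 (σ x) (σ y) = killingForm ℝ 𝔤 x y :=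
  LieAlgebra.killingForm_of_equiv_apply σ x y

omit [Module.Finite ℝ 𝔤] in
-- Pairing F with σ²v + σv + v = 0 gives three equal terms, since σ fixes F and preserves B.
theorem form_isotropy_tangent {σ : 𝔤 ≃ₗ⁅ℝ⁆ 𝔤} {B : LinearMap.BilinForm ℝ 𝔤} (hB : ∀ x y, B (σ x) (σ y) = B x y) {F v : 𝔤}
    (hF : F ∈ isotropy σ) (hv : v ∈ tangent σ) : B F v = 0 := by
  have h1 := hB F v
  have h2 := hB F (σ v)
  rw [mem_isotropy.mp hF] at h1 h2
  have h3 := congrArg (B F) (mem_tangent.mp hv)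
  rw [map_add, map_add, map_zero] at h3
  linarith

end Killing

end

end ThreeSymmetric

namespace ThreeSymmetric

noncomputable section

attribute [local instance 100] LieRing.ofAssociativeRing

/-! ## The radical -/

/-! ### Orthogonal projections, and kernel-image splittings of symmetric or skew operators. -/

section InnerLemmas

variable {M : Type*} [AddCommGroup M] [Module ℝ M] [Module.Finite ℝ M]
  {G : LinearMap.BilinForm ℝ M}

/-- Orthogonal projections exist. -/
theorem IsInner.exists_proj (hG : IsInner G) (W : Submodule ℝ M) :
    ∃ P : Module.End ℝ M, (∀ x, P x ∈ W) ∧ ∀ x, ∀ y ∈ W, G (x - P x) y = 0 := by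
  have hrefl : G.IsRefl := fun x y h => by rw [hG.symm, h]
  have hc : IsCompl W (G.orthogonal W) := by
    rw [LinearMap.BilinForm.isCompl_orthogonal_iff_disjoint hrefl, Submodule.disjoint_def]
    exact fun x hx hx' => hG.eq_zero (hx' x hx)
  refine ⟨W.projection _ hc, fun x => Submodule.projection_apply_mem hc x, fun x y hy => ?_⟩
  rw [hG.symm]
  exact Submodule.sub_projection_mem hc x y hy

/-- If `f` is symmetric or skew on an invariant subspace, the subspace is the sum of the kernel and
the image of `f`. -/
theorem IsInner.exists_ker_add_range (hG : IsInner G) {f : Module.End ℝ M} {W : Submodule ℝ M}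
    (hW : ∀ x ∈ W, f x ∈ W) (c : ℝ) (hc : ∀ x ∈ W, ∀ y ∈ W, G (f x) y = c * G x (f y)) {x : M}
    (hx : x ∈ W) : ∃ y ∈ W, ∃ z ∈ W, f y = 0 ∧ x = y + f z := by
  obtain ⟨P, hP, hP'⟩ := hG.exists_proj (W.map f)
  obtain ⟨z, hz, hfz⟩ := hP x
  have hy : x - P x ∈ W := W.sub_mem hx (hfz ▸ hW z hz)
  refine ⟨x - P x, hy, z, hz, ?_, by rw [hfz, sub_add_cancel]⟩
  refine hG.eq_zero ?_
  rw [hc _ hy _ (hW _ hy), hP' x _ ⟨_, hW _ hy, rfl⟩, mul_zero]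

end InnerLemmas

variable {𝔤 : Type*} [LieRing 𝔤] [LieAlgebra ℝ 𝔤]

/-- A 3-symmetric Lie algebra equal to its transvection algebra, with an inner product `G` on it
which is invariant under `σ` and the isotropy algebra. -/
structure IsTransvectionAlgebra (σ : 𝔤 ≃ₗ⁅ℝ⁆ 𝔤) (G : LinearMap.BilinForm ℝ 𝔤) : Prop where
  cube : ∀ x, σ (σ (σ x)) = x
  inner : IsInner G
  sigma : ∀ x y, G (σ x) (σ y) = G x y
  skew : ∀ F ∈ isotropy σ, ∀ x y, G ⁅F, x⁆ y + G x ⁅F, y⁆ = 0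
  faithful : ∀ F ∈ isotropy σ, (∀ v ∈ tangent σ, ⁅F, v⁆ = 0) → F = 0
  transvection_eq : transvection σ = ⊤

/-- The radical of the Killing form. -/
abbrev killingRadical (𝔤 : Type*) [LieRing 𝔤] [LieAlgebra ℝ 𝔤] : LieIdeal ℝ 𝔤 :=
  LieIdeal.killingCompl ℝ 𝔤 ⊤

theorem mem_killingRadical {x : 𝔤} : x ∈ killingRadical 𝔤 ↔ ∀ y, killingForm ℝ 𝔤 x y = 0 := by
  rw [LieIdeal.mem_killingCompl]
  refine ⟨fun h y => ?_, fun h y _ => ?_⟩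
  · rw [LieModule.traceForm_comm]
    exact h y trivial
  · rw [LieModule.traceForm_comm]
    exact h y

theorem killingForm_lie (x y z : 𝔤) : killingForm ℝ 𝔤 ⁅x, y⁆ z = killingForm ℝ 𝔤 x ⁅y, z⁆ :=
  LieModule.traceForm_apply_lie_apply ℝ 𝔤 𝔤 x y z

theorem killingForm_comm (x y : 𝔤) : killingForm ℝ 𝔤 x y = killingForm ℝ 𝔤 y x :=
  LieModule.traceForm_comm ℝ 𝔤 𝔤 x y

theorem killingForm_isotropy_tangent {σ : 𝔤 ≃ₗ⁅ℝ⁆ 𝔤} {F v : 𝔤}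
    (hF : F ∈ isotropy σ) (hv : v ∈ tangent σ) : killingForm ℝ 𝔤 F v = 0 :=
  form_isotropy_tangent (killingForm_sigma σ) hF hv

namespace IsTransvectionAlgebra

variable {σ : 𝔤 ≃ₗ⁅ℝ⁆ 𝔤} {G : LinearMap.BilinForm ℝ 𝔤} (h : IsTransvectionAlgebra σ G)
include h

theorem isotropyPart_mem (x : 𝔤) : isotropyPart σ x ∈ isotropy σ :=
  ThreeSymmetric.isotropyPart_mem h.cube x

theorem tangentPart_mem (x : 𝔤) : tangentPart σ x ∈ tangent σ :=
  ThreeSymmetric.tangentPart_mem σ h.cube x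

theorem isotropy_mem_span {F : 𝔤} (hF : F ∈ isotropy σ) :
    F ∈ Submodule.span ℝ {z | ∃ v ∈ tangent σ, ∃ w ∈ tangent σ, z = isotropyPart σ ⁅v, w⁆} := by
  have h1 : F ∈ transvection σ := by rw [h.transvection_eq]; trivial
  obtain ⟨v, hv, w, hw, rfl⟩ := Submodule.mem_sup.mp h1
  rw [← isotropyPart_of_isotropy hF, map_add, isotropyPart_of_tangent hv, zero_add]
  have h2 : isotropyPart σ w ∈ (Submodule.span ℝ
      {z | ∃ v ∈ tangent σ, ∃ w ∈ tangent σ, z = ⁅v, w⁆}).map (isotropyPart σ) := ⟨w, hw, rfl⟩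
  rw [Submodule.map_span] at h2
  refine Submodule.span_mono ?_ h2
  rintro _ ⟨_, ⟨v, hv, w, hw, rfl⟩, rfl⟩
  exact ⟨v, hv, w, hw, rfl⟩

/-- Induction on the elements of the isotropy algebra. -/
theorem isotropy_le {S : Submodule ℝ 𝔤}
    (hS : ∀ v ∈ tangent σ, ∀ w ∈ tangent σ, isotropyPart σ ⁅v, w⁆ ∈ S) {F : 𝔤}
    (hF : F ∈ isotropy σ) : F ∈ S := by
  refine Submodule.span_le.mpr ?_ (h.isotropy_mem_span hF)
  rintro _ ⟨v, hv, w, hw, rfl⟩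
  exact hS v hv w hw

variable [Module.Finite ℝ 𝔤]

/-- The operator ad F is `G`-skew, so the Killing form is negative definite on the isotropy algebra,
which acts faithfully. -/
theorem eq_zero_of_killingForm_self {F : 𝔤} (hF : F ∈ isotropy σ) (h0 : killingForm ℝ 𝔤 F F = 0) :
    F = 0 := by
  have h1 : LieAlgebra.ad ℝ 𝔤 F = 0 :=
    eq_zero_of_trace_mul_self_eq_zero h.inner (fun v w => h.skew F hF v w) h0
  refine h.faithful F hF fun v _ => ?_
  rw [← LieAlgebra.ad_apply ℝ, h1, LinearMap.zero_apply]

/-- Since 𝔥 and 𝕍 are Killing-orthogonal, the hypothesis says that the 𝔥-part of x is isotropic for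
a definite form. This is the standard way of showing below that ideals lie in 𝕍. -/
theorem mem_tangent_of_killingForm {x : 𝔤} (hx : killingForm ℝ 𝔤 x (isotropyPart σ x) = 0) :
    x ∈ tangent σ := by
  have h1 : isotropyPart σ x = 0 := by
    refine h.eq_zero_of_killingForm_self (h.isotropyPart_mem x) ?_
    have h2 : killingForm ℝ 𝔤 (isotropyPart σ x) (isotropyPart σ x + tangentPart σ x) =
      killingForm ℝ 𝔤 (isotropyPart σ x) (isotropyPart σ x) := by
      rw [map_add, killingForm_isotropy_tangent (h.isotropyPart_mem x) (h.tangentPart_mem x),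
        add_zero]
    rw [← h2, isotropyPart_add_tangentPart, killingForm_comm, hx]
  rw [← isotropyPart_add_tangentPart (σ := σ) x, h1, zero_add]
  exact h.tangentPart_mem x

theorem rad_le_tangent {x : 𝔤} (hx : x ∈ killingRadical 𝔤) : x ∈ tangent σ :=
  h.mem_tangent_of_killingForm (mem_killingRadical.mp hx _)

omit h [Module.Finite ℝ 𝔤] in
theorem sigma_mem_rad (h : IsTransvectionAlgebra σ G) {x : 𝔤} (hx : x ∈ killingRadical 𝔤) :
    σ x ∈ killingRadical 𝔤 := by
  rw [mem_killingRadical] at hx ⊢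
  intro y
  rw [← h.cube y, killingForm_sigma, hx]

/-- With `rad_le_tangent` this identifies the Killing radical as the largest ideal contained in 𝕍.
-/
theorem le_rad {I : LieIdeal ℝ 𝔤} (hI : ∀ x ∈ I, x ∈ tangent σ) {x : 𝔤} (hx : x ∈ I) :
    x ∈ killingRadical 𝔤 :=
  mem_killingRadical.mpr (killingForm_eq_zero_of_ideal h.cube hI hx)

/-- The isotropy algebra acts faithfully modulo the radical. -/
theorem eq_zero_of_lie_mem_rad {F : 𝔤} (hF : F ∈ isotropy σ)
    (h0 : ∀ v ∈ tangent σ, ⁅F, v⁆ ∈ killingRadical 𝔤) : F = 0 := by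
  refine h.eq_zero_of_killingForm_self hF ?_
  have h1 : F ∈ LinearMap.ker (killingForm ℝ 𝔤 F) := by
    refine h.isotropy_le (fun v hv w hw => ?_) hF
    rw [LinearMap.mem_ker, isotropyPart_apply, map_sub,
      killingForm_isotropy_tangent hF (h.tangentPart_mem _), sub_zero, ← killingForm_lie]
    exact mem_killingRadical.mp (h0 v hv) w
  exact h1

/-- A quotient by the radical has nondegenerate Killing form. -/
theorem isKilling_quotient {Q : Type*} [LieRing Q] [LieAlgebra ℝ Q] [Module.Finite ℝ Q]
    {π : 𝔤 →ₗ⁅ℝ⁆ Q} (hπ : Function.Surjective π) (hker : ∀ x, π x = 0 ↔ x ∈ killingRadical 𝔤) :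
    LieAlgebra.IsKilling ℝ Q := by
  obtain ⟨P, hP, hP'⟩ := h.inner.exists_proj (killingRadical 𝔤).toSubmodule
  obtain ⟨s₀, hs₀⟩ := π.toLinearMap.exists_rightInverse_of_surjective
    (LinearMap.range_eq_top.mpr hπ)
  have hs₀' : ∀ q, π (s₀ q) = q := fun q => LinearMap.congr_fun hs₀ q
  have heq : ∀ x y, π x = π y ↔ x - y ∈ killingRadical 𝔤 := fun x y => by
    rw [← hker, map_sub, sub_eq_zero]
  -- a section orthogonal to the radical
  let s : Q →ₗ[ℝ] 𝔤 := (LinearMap.id - P) ∘ₗ s₀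
  have hs : ∀ q, π (s q) = q := by
    intro q
    change π (s₀ q - P (s₀ q)) = q
    rw [map_sub, (hker _).mpr (hP _), sub_zero, hs₀']
  have hsG : ∀ q, ∀ y ∈ killingRadical 𝔤, G (s q) y = 0 := fun q y hy => hP' _ y hy
  have hsG' : ∀ y ∈ killingRadical 𝔤, ∀ q, G y (s q) = 0 := fun y hy q => by
    rw [h.inner.symm, hsG q y hy]
  let GQ : LinearMap.BilinForm ℝ Q := G.compl₁₂ s s
  have hGQ : IsInner GQ := ⟨fun v w => h.inner.symm _ _, fun v hv => h.inner.pos _ fun h0 => hv (by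
    rw [← hs v, h0, map_zero])⟩
  have hskew : ∀ F ∈ isotropy σ, ∀ v w, GQ ⁅π F, v⁆ w + GQ v ⁅π F, w⁆ = 0 := by
    intro F hF v w
    have h1 : ∀ v, s ⁅π F, v⁆ - ⁅F, s v⁆ ∈ killingRadical 𝔤 := by
      intro v
      rw [← heq, hs, LieHom.map_lie, hs]
    have h2 : G (s ⁅π F, v⁆) (s w) = G ⁅F, s v⁆ (s w) := by
      rw [← sub_eq_zero, ← LinearMap.sub_apply, ← map_sub]
      exact hsG' _ (h1 v) w
    have h3 : G (s v) (s ⁅π F, w⁆) = G (s v) ⁅F, s w⁆ := by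
      rw [← sub_eq_zero, ← map_sub]
      exact hsG _ _ (h1 w)
    change G (s ⁅π F, v⁆) (s w) + G (s v) (s ⁅π F, w⁆) = 0
    rw [h2, h3]
    exact h.skew F hF _ _
  -- the automorphism of the quotient
  have hσ' : ∀ x, π (σ (s (π x))) = π (σ x) := by
    intro x
    rw [heq, ← map_sub]
    refine h.sigma_mem_rad ?_
    rw [← heq, hs]
  let σQ : Q ≃ₗ⁅ℝ⁆ Q :=
    { (π.toLinearMap ∘ₗ (σ : 𝔤 →ₗ[ℝ] 𝔤) ∘ₗ s : Q →ₗ[ℝ] Q) with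
      invFun := fun q => π (σ (s (π (σ (s q)))))
      left_inv := fun q => by
        obtain ⟨x, rfl⟩ := hπ q
        change π (σ (s (π (σ (s (π (σ (s (π x))))))))) = π x
        rw [hσ' x, hσ' (σ x), hσ' (σ (σ x)), h.cube]
      right_inv := fun q => by
        obtain ⟨x, rfl⟩ := hπ q
        change π (σ (s (π (σ (s (π (σ (s (π x))))))))) = π x
        rw [hσ' x, hσ' (σ x), hσ' (σ (σ x)), h.cube]
      map_lie' := fun {q q'} => by
        obtain ⟨x, rfl⟩ := hπ q
        obtain ⟨y, rfl⟩ := hπ q'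
        change π (σ (s ⁅π x, π y⁆)) = ⁅π (σ (s (π x))), π (σ (s (π y)))⁆
        rw [← LieHom.map_lie, hσ', hσ', hσ', LieEquiv.map_lie, LieHom.map_lie] }
  have hσQ : ∀ x, σQ (π x) = π (σ x) := hσ'
  have hmix : ∀ F ∈ isotropy σ, ∀ v ∈ tangent σ, killingForm ℝ Q (π F) (π v) = 0 := by
    intro F hF v hv
    refine form_isotropy_tangent (killingForm_sigma σQ) ?_ ?_
    · rw [mem_isotropy, hσQ, mem_isotropy.mp hF]
    · rw [mem_tangent, hσQ, hσQ, ← map_add, ← map_add, mem_tangent.mp hv, map_zero]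
  -- The preimage of the Killing radical of `Q`. Definiteness on 𝔥, transferred to `Q` by the form
  -- `GQ`, shows that it lies in 𝕍; being an ideal, it is then contained in the radical.
  let I : LieIdeal ℝ 𝔤 :=
    { (LieIdeal.killingCompl ℝ Q ⊤).toSubmodule.comap π.toLinearMap with
      lie_mem := fun {x m} hm => by
        change π ⁅x, m⁆ ∈ LieIdeal.killingCompl ℝ Q ⊤
        rw [LieHom.map_lie]
        exact lie_mem_right ℝ Q _ _ _ hm }
  have hI : ∀ x ∈ I, x ∈ tangent σ := by
    intro x hx
    have hx' : π x ∈ killingRadical Q := hx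
    have h1 := mem_killingRadical.mp hx' (π (isotropyPart σ x))
    have hF := h.isotropyPart_mem x
    conv at h1 =>
      lhs
      rw [← isotropyPart_add_tangentPart (σ := σ) x]
    rw [map_add, map_add, LinearMap.add_apply, killingForm_comm (π (tangentPart σ x))] at h1
    simp only [map_add, isotropyPart_of_isotropy hF,
      isotropyPart_of_tangent (h.tangentPart_mem x), add_zero] at h1
    rw [hmix _ hF _ (h.tangentPart_mem x), add_zero] at h1
    have h2 : LieAlgebra.ad ℝ Q (π (isotropyPart σ x)) = 0 :=
      eq_zero_of_trace_mul_self_eq_zero hGQ (hskew _ hF) h1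
    have h3 : isotropyPart σ x = 0 := by
      refine h.eq_zero_of_lie_mem_rad hF fun y _ => ?_
      rw [← hker, LieHom.map_lie, ← LieAlgebra.ad_apply ℝ, h2, LinearMap.zero_apply]
    rw [← isotropyPart_add_tangentPart (σ := σ) x, h3, zero_add]
    exact h.tangentPart_mem x
  constructor
  rw [eq_bot_iff]
  intro q hq
  obtain ⟨x, rfl⟩ := hπ q
  rw [LieSubmodule.mem_bot, hker]
  exact h.le_rad hI hq

/-- Derivations modulo the radical are inner modulo the radical. -/
theorem exists_lie_sub_mem_rad {D : Module.End ℝ 𝔤}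
    (hD : ∀ x ∈ killingRadical 𝔤, D x ∈ killingRadical 𝔤)
    (hD' : ∀ x y, D ⁅x, y⁆ - ⁅D x, y⁆ - ⁅x, D y⁆ ∈ killingRadical 𝔤) :
    ∃ z : 𝔤, ∀ x, D x - ⁅z, x⁆ ∈ killingRadical 𝔤 := by
  let Q := 𝔤 ⧸ killingRadical 𝔤
  have : Module.Finite ℝ Q := inferInstanceAs (Module.Finite ℝ (𝔤 ⧸ (killingRadical 𝔤).toSubmodule))
  let π : 𝔤 →ₗ⁅ℝ⁆ Q :=
    { (LieSubmodule.Quotient.mk' (killingRadical 𝔤) : 𝔤 →ₗ[ℝ] Q) with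
      map_lie' := rfl }
  have hπ : Function.Surjective π := LieSubmodule.Quotient.surjective_mk' _
  have hker : ∀ x, π x = 0 ↔ x ∈ killingRadical 𝔤 := fun x => LieSubmodule.Quotient.mk_eq_zero _
  have : LieAlgebra.IsKilling ℝ Q := h.isKilling_quotient hπ hker
  let D₁ : Module.End ℝ Q := Submodule.mapQ _ _ D hD
  have hD₁ : ∀ x, D₁ (π x) = π (D x) := fun x => rfl
  let D₂ : LieDerivation ℝ Q Q :=
    { D₁ with
      leibniz' := fun p q => by
        obtain ⟨x, rfl⟩ := hπ p
        obtain ⟨y, rfl⟩ := hπ q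
        change D₁ ⁅π x, π y⁆ = ⁅π x, D₁ (π y)⁆ - ⁅π y, D₁ (π x)⁆
        rw [← LieHom.map_lie, hD₁, hD₁, hD₁, ← LieHom.map_lie, ← LieHom.map_lie, ← map_sub,
          ← sub_eq_zero, ← map_sub, hker]
        have h1 := hD' x y
        rw [← lie_skew (D x) y] at h1
        convert h1 using 1
        abel }
  obtain ⟨q, hq⟩ := LieDerivation.IsKilling.exists_eq_ad D₂
  obtain ⟨z, rfl⟩ := hπ q
  refine ⟨z, fun x => ?_⟩
  rw [← hker, map_sub, ← hD₁, LieHom.map_lie, show D₁ (π x) = D₂ (π x) from rfl, ← hq]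
  simp

end IsTransvectionAlgebra

end

end ThreeSymmetric

namespace ThreeSymmetric

noncomputable section

attribute [local instance 100] LieRing.ofAssociativeRing

/-! ## The centralizer of the radical -/

variable {𝔤 : Type*} [LieRing 𝔤] [LieAlgebra ℝ 𝔤]

/-- The centralizer of the radical of the Killing form. -/
abbrev radCentralizer (𝔤 : Type*) [LieRing 𝔤] [LieAlgebra ℝ 𝔤] : LieIdeal ℝ 𝔤 :=
  LieModule.ker ℝ 𝔤 (killingRadical 𝔤)

/-- The orthogonal complement of the centralizer of the radical. -/
abbrev radCocentralizer (𝔤 : Type*) [LieRing 𝔤] [LieAlgebra ℝ 𝔤] : LieIdeal ℝ 𝔤 :=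
  LieIdeal.killingCompl ℝ 𝔤 (radCentralizer 𝔤)

theorem mem_radCentralizer {x : 𝔤} :
    x ∈ radCentralizer 𝔤 ↔ ∀ y ∈ killingRadical 𝔤, ⁅x, y⁆ = 0 := by
  rw [LieModule.mem_ker]
  exact ⟨fun h y hy => congrArg Subtype.val (h ⟨y, hy⟩), fun h y => Subtype.ext (h y y.2)⟩

theorem mem_radCocentralizer {x : 𝔤} :
    x ∈ radCocentralizer 𝔤 ↔ ∀ y ∈ radCentralizer 𝔤, killingForm ℝ 𝔤 y x = 0 :=
  LieIdeal.mem_killingCompl ..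

theorem rad_le_radCocentralizer {x : 𝔤} (hx : x ∈ killingRadical 𝔤) : x ∈ radCocentralizer 𝔤 :=
  mem_radCocentralizer.mpr fun y _ => by
    rw [killingForm_comm]
    exact mem_killingRadical.mp hx y

theorem lie_eq_zero_of_mem_radCentralizer {x y : 𝔤} (hx : x ∈ radCentralizer 𝔤)
    (hy : y ∈ killingRadical 𝔤) : ⁅x, y⁆ = 0 := mem_radCentralizer.mp hx y hy

theorem lie_eq_zero_of_mem_radCentralizer' {x y : 𝔤} (hx : x ∈ radCentralizer 𝔤)
    (hy : y ∈ killingRadical 𝔤) : ⁅y, x⁆ = 0 := by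
  rw [← lie_skew, mem_radCentralizer.mp hx y hy, neg_zero]

variable [Module.Finite ℝ 𝔤]

/-- In finite dimension the range of a symmetric form is the annihilator of its kernel. -/
theorem exists_killingForm_eq {ψ : Module.Dual ℝ 𝔤} (hψ : ∀ x ∈ killingRadical 𝔤, ψ x = 0) :
    ∃ d, killingForm ℝ 𝔤 d = ψ := by
  have h1 : ψ ∈ LinearMap.range (killingForm ℝ 𝔤).dualMap := by
    rw [LinearMap.range_dualMap_eq_dualAnnihilator_ker, Submodule.mem_dualAnnihilator]
    intro x hx
    exact hψ x (mem_killingRadical.mpr fun y => by rw [LinearMap.mem_ker.mp hx]; rfl)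
  obtain ⟨e, rfl⟩ := h1
  obtain ⟨d, rfl⟩ := (Module.evalEquiv ℝ 𝔤).surjective e
  refine ⟨d, LinearMap.ext fun y => ?_⟩
  rw [killingForm_comm]
  rfl

theorem exists_endomorphism_killingForm {φ : 𝔤 →ₗ[ℝ] Module.Dual ℝ 𝔤}
    (hφ : ∀ x, ∀ y ∈ killingRadical 𝔤, φ x y = 0) :
    ∃ D : Module.End ℝ 𝔤, ∀ x y, killingForm ℝ 𝔤 (D x) y = φ x y := by
  choose d hd using fun x => exists_killingForm_eq (hφ x)
  let b := Module.finBasis ℝ 𝔤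
  refine ⟨b.constr ℝ fun i => d (b i), fun x y => ?_⟩
  have h1 : (killingForm ℝ 𝔤 : 𝔤 →ₗ[ℝ] Module.Dual ℝ 𝔤) ∘ₗ b.constr ℝ (fun i => d (b i)) = φ :=
    b.ext fun i => by
      rw [LinearMap.comp_apply, b.constr_basis]
      exact hd _
  exact LinearMap.congr_fun (LinearMap.congr_fun h1 x) y

namespace IsTransvectionAlgebra

variable {σ : 𝔤 ≃ₗ⁅ℝ⁆ 𝔤} {G : LinearMap.BilinForm ℝ 𝔤} (h : IsTransvectionAlgebra σ G)
include h

/-- The radical is an ideal inside 𝕍, so `lie_tangentPart_lie_eq_zero` applies to each of its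
elements. -/
theorem tangentPart_lie_mem_radCentralizer {v w : 𝔤} (hv : v ∈ tangent σ) (hw : w ∈ tangent σ) :
    tangentPart σ ⁅v, w⁆ ∈ radCentralizer 𝔤 := by
  rw [mem_radCentralizer]
  intro x hx
  rw [← lie_skew, lie_tangentPart_lie_eq_zero h.cube (h.rad_le_tangent hx)
    (fun y _ => h.rad_le_tangent (lie_mem_left ℝ 𝔤 _ x y hx)) hv hw, neg_zero]

omit h [Module.Finite ℝ 𝔤] in
theorem sigma_mem_radCentralizer (h : IsTransvectionAlgebra σ G) {x : 𝔤} (hx : x ∈ radCentralizer 𝔤) :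
    σ x ∈ radCentralizer 𝔤 := by
  rw [mem_radCentralizer] at hx ⊢
  intro y hy
  rw [← h.cube y, ← LieEquiv.map_lie, hx _ (h.sigma_mem_rad (h.sigma_mem_rad hy)), map_zero]

omit h [Module.Finite ℝ 𝔤] in
theorem sigma_mem_radCocentralizer (h : IsTransvectionAlgebra σ G) {x : 𝔤} (hx : x ∈ radCocentralizer 𝔤) :
    σ x ∈ radCocentralizer 𝔤 := by
  rw [mem_radCocentralizer] at hx ⊢
  intro y hy
  rw [← h.cube y, killingForm_sigma, hx _ (h.sigma_mem_radCentralizer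
    (h.sigma_mem_radCentralizer hy))]

/-- The intersection is a σ-stable ideal, so the 𝔥-part of any of its elements lies in the
centralizer and is orthogonal to that element. The intersection is therefore an ideal inside 𝕍. -/
theorem mem_rad_of_mem_of_mem {x : 𝔤} (h1 : x ∈ radCentralizer 𝔤) (h2 : x ∈ radCocentralizer 𝔤) :
    x ∈ killingRadical 𝔤 := by
  refine h.le_rad (I := radCentralizer 𝔤 ⊓ radCocentralizer 𝔤) (fun y hy => ?_) ⟨h1, h2⟩
  refine h.mem_tangent_of_killingForm ?_
  rw [killingForm_comm]
  exact mem_radCocentralizer.mp hy.2 _ (isotropyPart_mem_of_sigma_mem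
    (S := (radCentralizer 𝔤).toSubmodule) (fun _ => h.sigma_mem_radCentralizer) hy.1)

theorem lie_mem_rad {x y : 𝔤} (hx : x ∈ radCentralizer 𝔤) (hy : y ∈ radCocentralizer 𝔤) :
    ⁅x, y⁆ ∈ killingRadical 𝔤 :=
  h.mem_rad_of_mem_of_mem (lie_mem_left ℝ 𝔤 _ _ _ hx) (lie_mem_right ℝ 𝔤 _ _ _ hy)

theorem lie_mem_rad' {x y : 𝔤} (hx : x ∈ radCocentralizer 𝔤) (hy : y ∈ radCentralizer 𝔤) :
    ⁅x, y⁆ ∈ killingRadical 𝔤 :=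
  h.mem_rad_of_mem_of_mem (lie_mem_right ℝ 𝔤 _ _ _ hy) (lie_mem_left ℝ 𝔤 _ _ _ hx)

/-- Dimension count: orthogonal complements for a form with radical r satisfy dim C + dim M = dim 𝔤
+ dim(C ∩ r), and C ∩ M lies in C ∩ r. -/
theorem radCentralizer_sup_radCocentralizer :
    (radCentralizer 𝔤).toSubmodule ⊔ (radCocentralizer 𝔤).toSubmodule = ⊤ := by
  have h1 : Module.finrank ℝ (radCentralizer 𝔤).toSubmodule +
      Module.finrank ℝ (radCocentralizer 𝔤).toSubmodule = Module.finrank ℝ 𝔤 + Module.finrank ℝ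
        ((radCentralizer 𝔤).toSubmodule ⊓ (killingForm ℝ 𝔤).orthogonal ⊤ : Submodule ℝ 𝔤) := by
    rw [LieIdeal.toSubmodule_killingCompl]
    exact LinearMap.BilinForm.finrank_add_finrank_orthogonal
      (LieModule.traceForm_isSymm ℝ 𝔤 𝔤).isRefl _
  have h2 := Submodule.finrank_sup_add_finrank_inf_eq (radCentralizer 𝔤).toSubmodule
    (radCocentralizer 𝔤).toSubmodule
  have h3 : (radCentralizer 𝔤).toSubmodule ⊓ (radCocentralizer 𝔤).toSubmodule ≤
      (radCentralizer 𝔤).toSubmodule ⊓ (killingForm ℝ 𝔤).orthogonal ⊤ := by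
    rintro x ⟨hx, hx'⟩
    refine ⟨hx, fun y _ => ?_⟩
    change killingForm ℝ 𝔤 y x = 0
    rw [killingForm_comm]
    exact mem_killingRadical.mp (h.mem_rad_of_mem_of_mem hx hx') y
  have h4 := Submodule.finrank_mono h3
  apply Submodule.eq_top_of_finrank_eq
  have h5 := Submodule.finrank_le ((radCentralizer 𝔤).toSubmodule ⊔
    (radCocentralizer 𝔤).toSubmodule)
  omega

/-- A linear projection to the centralizer of the radical along its orthogonal complement. -/
theorem exists_centralizer_proj : ∃ p : Module.End ℝ 𝔤,
    (∀ x, p x ∈ radCentralizer 𝔤) ∧ ∀ x, x - p x ∈ radCocentralizer 𝔤 := by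
  let f : (radCentralizer 𝔤).toSubmodule × (radCocentralizer 𝔤).toSubmodule →ₗ[ℝ] 𝔤 :=
    (Submodule.subtype _).coprod (Submodule.subtype _)
  have hf : LinearMap.range f = ⊤ := by
    rw [LinearMap.range_coprod, Submodule.range_subtype, Submodule.range_subtype,
      h.radCentralizer_sup_radCocentralizer]
  obtain ⟨g, hg⟩ := f.exists_rightInverse_of_surjective hf
  refine ⟨Submodule.subtype _ ∘ₗ LinearMap.fst ℝ _ _ ∘ₗ g, fun x => (g x).1.2, fun x => ?_⟩
  have h1 : ((g x).1 : 𝔤) + (g x).2 = x := LinearMap.congr_fun hg x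
  change x - ((g x).1 : 𝔤) ∈ radCocentralizer 𝔤
  rw [sub_eq_iff_eq_add'.mpr h1.symm]
  exact (g x).2.2

/-- The isotropy elements centralizing the radical have no fixed vectors in the centralizer of the
radical, outside of the radical. -/
theorem mem_rad_of_fixed {u : 𝔤} (hu : u ∈ tangent σ) (huC : u ∈ radCentralizer 𝔤)
    (hfix : ∀ F ∈ isotropy σ, F ∈ radCentralizer 𝔤 → ⁅F, u⁆ = 0) : u ∈ killingRadical 𝔤 := by
  have hC : ∀ {x}, x ∈ radCentralizer 𝔤 → isotropyPart σ x ∈ radCentralizer 𝔤 := fun hx =>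
    isotropyPart_mem_of_sigma_mem (S := (radCentralizer 𝔤).toSubmodule)
      (fun _ => h.sigma_mem_radCentralizer) hx
  have hC' : ∀ {x}, x ∈ radCentralizer 𝔤 → tangentPart σ x ∈ radCentralizer 𝔤 := fun hx =>
    tangentPart_mem_of_sigma_mem (S := (radCentralizer 𝔤).toSubmodule)
      (fun _ => h.sigma_mem_radCentralizer) hx
  -- The 𝔥-part F of [u, y] lies in the centralizer, hence fixes u, and invariance gives B(F, [u,
  -- y]) = B([F, u], y) = 0.
  have h1 : ∀ y ∈ tangent σ, ⁅u, y⁆ ∈ tangent σ := by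
    intro y hy
    refine h.mem_tangent_of_killingForm ?_
    rw [killingForm_comm, ← killingForm_lie, hfix _ (h.isotropyPart_mem _)
      (hC (lie_mem_left ℝ 𝔤 _ _ _ huC)), map_zero, LinearMap.zero_apply]
  have h2 : ∀ z ∈ tangent σ, z ∈ radCentralizer 𝔤 → killingForm ℝ 𝔤 u z = 0 := by
    intro z hz hzC
    rw [killingForm_apply_apply]
    set N : Module.End ℝ 𝔤 := LieAlgebra.ad ℝ 𝔤 u ∘ₗ LieAlgebra.ad ℝ 𝔤 z with hN
    have hNa : ∀ x, N x = ⁅u, ⁅z, x⁆⁆ := fun x => rfl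
    have hNv : ∀ v ∈ tangent σ, N v = 0 := by
      intro v hv
      rw [hNa, ← isotropyPart_add_tangentPart (σ := σ) ⁅z, v⁆, lie_add,
        lie_tangentPart_lie_eq_zero h.cube hu h1 hz hv, add_zero, ← lie_skew,
        hfix _ (h.isotropyPart_mem _) (hC (lie_mem_left ℝ 𝔤 _ _ _ hzC)), neg_zero]
    -- N vanishes on 𝕍 and maps 𝔥 into 𝕍.
    have hNN : N ^ 2 = 0 := by
      ext x
      rw [pow_two]
      change N (N x) = 0
      refine hNv _ ?_
      rw [← isotropyPart_add_tangentPart (σ := σ) x, map_add, hNv _ (h.tangentPart_mem x),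
        add_zero, hNa]
      refine h1 _ ?_
      rw [← lie_skew]
      exact neg_mem (lie_isotropy_tangent σ _ (h.isotropyPart_mem x) _ hz)
    exact (LinearMap.isNilpotent_trace_of_isNilpotent ⟨2, hNN⟩).eq_zero
  refine h.mem_rad_of_mem_of_mem huC (mem_radCocentralizer.mpr fun c hc => ?_)
  rw [← isotropyPart_add_tangentPart (σ := σ) c, map_add, LinearMap.add_apply,
    killingForm_isotropy_tangent (h.isotropyPart_mem c) hu, zero_add, killingForm_comm]
  exact h2 _ (h.tangentPart_mem c) (hC' hc)

/-- The derived algebra of the centralizer of the radical meets the radical trivially. -/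
theorem eq_zero_of_mem_derived_of_mem_rad {z : 𝔤}
    (hz : z ∈ ⁅radCentralizer 𝔤, radCentralizer 𝔤⁆) (hzr : z ∈ killingRadical 𝔤) : z = 0 := by
  obtain ⟨p, hp, hp'⟩ := h.exists_centralizer_proj
  have hpr : ∀ x ∈ radCocentralizer 𝔤, p x ∈ killingRadical 𝔤 := by
    intro x hx
    refine h.mem_rad_of_mem_of_mem (hp x) ?_
    have := sub_mem hx (hp' x)
    rwa [sub_sub_cancel] at this
  rw [← Module.forall_dual_apply_eq_zero_iff ℝ]
  intro f
  -- Whitehead's second lemma by hand: φ is a 2-cocycle modulo the radical, represented by an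
  -- operator D through the Killing form. The cocycle identity makes D a derivation modulo the
  -- radical, hence inner, so φ is a coboundary. Thus f agrees on [C, C] with a Killing functional,
  -- which vanishes on the radical.
  let φ : 𝔤 →ₗ[ℝ] Module.Dual ℝ 𝔤 :=
    ((LieModule.toEnd ℝ 𝔤 𝔤).toLinearMap.compl₁₂ p p).compr₂ f
  have hφ : ∀ x y, φ x y = f ⁅p x, p y⁆ := fun x y => rfl
  obtain ⟨D, hD⟩ := exists_endomorphism_killingForm (φ := φ) fun x y hy => by
    rw [hφ, lie_eq_zero_of_mem_radCentralizer (hp x) (hpr y (rad_le_radCocentralizer hy)), map_zero]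
  have hDr : ∀ x ∈ killingRadical 𝔤, D x ∈ killingRadical 𝔤 := by
    intro x hx
    rw [mem_killingRadical]
    intro y
    rw [hD, hφ, lie_eq_zero_of_mem_radCentralizer' (hp y) (hpr x (rad_le_radCocentralizer hx)),
      map_zero]
  have hplie : ∀ x y, p ⁅x, y⁆ - ⁅p x, p y⁆ ∈ killingRadical 𝔤 := by
    intro x y
    refine h.mem_rad_of_mem_of_mem (sub_mem (hp _) (lie_mem_left ℝ 𝔤 _ _ _ (hp x))) ?_
    have h1 : p ⁅x, y⁆ - ⁅p x, p y⁆ = ⁅x - p x, y⁆ + ⁅p x, y - p y⁆ - (⁅x, y⁆ - p ⁅x, y⁆) := by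
      rw [sub_lie, lie_sub]
      abel
    rw [h1]
    exact sub_mem (add_mem (lie_mem_left ℝ 𝔤 _ _ _ (hp' x)) (lie_mem_right ℝ 𝔤 _ _ _ (hp' y)))
      (hp' _)
  have hplie' : ∀ x y w, ⁅p ⁅x, y⁆, p w⁆ = ⁅⁅p x, p y⁆, p w⁆ := by
    intro x y w
    rw [← sub_eq_zero, ← sub_lie, lie_eq_zero_of_mem_radCentralizer' (hp w) (hplie x y)]
  have hplie'' : ∀ w x y, ⁅p w, p ⁅x, y⁆⁆ = ⁅p w, ⁅p x, p y⁆⁆ := by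
    intro w x y
    rw [← sub_eq_zero, ← lie_sub, lie_eq_zero_of_mem_radCentralizer (hp w) (hplie x y)]
  obtain ⟨d, hd⟩ := h.exists_lie_sub_mem_rad hDr fun x y => by
    rw [mem_killingRadical]
    intro w
    rw [map_sub, map_sub, LinearMap.sub_apply, LinearMap.sub_apply, ← lie_skew x (D y), map_neg,
      LinearMap.neg_apply, killingForm_lie (D x), killingForm_lie (D y), hD, hD, hD, hφ, hφ, hφ,
      hplie', hplie'', hplie'', lie_lie, map_sub]
    ring
  have hfd : ∀ x y, f ⁅p x, p y⁆ = killingForm ℝ 𝔤 d ⁅x, y⁆ := by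
    intro x y
    have h1 := mem_killingRadical.mp (hd x) y
    rw [map_sub, LinearMap.sub_apply, hD, hφ, killingForm_lie, sub_eq_zero] at h1
    exact h1
  have hfC : ∀ w ∈ ⁅radCentralizer 𝔤, radCentralizer 𝔤⁆, f w = killingForm ℝ 𝔤 d w := by
    intro w hw
    rw [← LieSubmodule.mem_toSubmodule, LieSubmodule.lieIdeal_oper_eq_linear_span'] at hw
    refine LinearMap.eqOn_span (f := f) (g := killingForm ℝ 𝔤 d) ?_ hw
    rintro _ ⟨x, hx, y, hy, rfl⟩
    have hpC : ∀ x ∈ radCentralizer 𝔤, x - p x ∈ killingRadical 𝔤 := fun x hx =>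
      h.mem_rad_of_mem_of_mem (sub_mem hx (hp x)) (hp' x)
    have h1 : ⁅x, y⁆ = ⁅p x, p y⁆ := by
      have h2 : ⁅x, y⁆ = ⁅x - p x, y⁆ + ⁅p x, y - p y⁆ + ⁅p x, p y⁆ := by
        rw [sub_lie, lie_sub]
        abel
      rw [h2, lie_eq_zero_of_mem_radCentralizer' hy (hpC x hx),
        lie_eq_zero_of_mem_radCentralizer (hp x) (hpC y hy), zero_add, zero_add]
    change f ⁅x, y⁆ = killingForm ℝ 𝔤 d ⁅x, y⁆
    rw [← hfd, h1]
  rw [hfC z hz, killingForm_comm]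
  exact mem_killingRadical.mp hzr d

end IsTransvectionAlgebra

end

end ThreeSymmetric

namespace ThreeSymmetric

noncomputable section

attribute [local instance 100] LieRing.ofAssociativeRing

/-! ## The isotropy element inducing the complex structure -/

section LinearAlgebra

variable {M : Type*} [AddCommGroup M] [Module ℝ M] [Module.Finite ℝ M]

/-- An endomorphism with eigenvalues among `s` and `-s - 1`, where `s ≥ 0`, and with trace
`2 s (s + 1) dim M` is a multiple of the identity, and the space is zero unless `s` is. -/
theorem eq_smul_of_trace_eq {E : Module.End ℝ M} {s : ℝ} (hs : 0 ≤ s)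
    (hE : ∀ x, E (E x) = -E x + (s * (s + 1)) • x)
    (htr : LinearMap.trace ℝ M E = 2 * s * (s + 1) * Module.finrank ℝ M) :
    (∀ x, E x = s • x) ∧ (s ≠ 0 → ∀ x : M, x = 0) := by
  have hs' : 2 * s + 1 ≠ 0 := by positivity
  -- The projection to the eigenspace of -s - 1. Its trace equals its rank and also comes out as -s
  -- dim M, so both vanish.
  set P : Module.End ℝ M := (2 * s + 1)⁻¹ • (s • 1 - E) with hP
  have hPx : ∀ x, P x = (2 * s + 1)⁻¹ • (s • x - E x) := fun x => rfl
  have hPP : IsIdempotentElem P := by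
    ext x
    change P (P x) = P x
    simp only [hPx, map_smul, map_sub, hE, smul_sub, smul_add, smul_smul, smul_neg]
    match_scalars <;> field_simp <;> ring
  have h1 : LinearMap.trace ℝ M P = (2 * s + 1)⁻¹ * (s * Module.finrank ℝ M -
      2 * s * (s + 1) * Module.finrank ℝ M) := by
    rw [hP, map_smul, map_sub, map_smul, LinearMap.trace_one, htr, smul_eq_mul, smul_eq_mul]
  have h2 : LinearMap.trace ℝ M P = Module.finrank ℝ (LinearMap.range P) :=
    (LinearMap.IsIdempotentElem.isProj_range P hPP).trace
  have h3 : (Module.finrank ℝ (LinearMap.range P) : ℝ) + s * Module.finrank ℝ M = 0 := by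
    rw [← h2, h1]
    field_simp
    ring
  have h4 : (0 : ℝ) ≤ Module.finrank ℝ (LinearMap.range P) := Nat.cast_nonneg _
  have h5 : 0 ≤ s * Module.finrank ℝ M := mul_nonneg hs (Nat.cast_nonneg _)
  have h6 : Module.finrank ℝ (LinearMap.range P) = 0 := by
    have : (Module.finrank ℝ (LinearMap.range P) : ℝ) = 0 := by linarith
    exact_mod_cast this
  have h7 : s * Module.finrank ℝ M = 0 := by linarith
  refine ⟨fun x => ?_, fun hs0 x => ?_⟩
  · have h8 : P x ∈ LinearMap.range P := ⟨x, rfl⟩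
    rw [Submodule.finrank_eq_zero.mp h6, Submodule.mem_bot, hPx, smul_eq_zero] at h8
    exact (sub_eq_zero.mp (h8.resolve_left (inv_ne_zero hs'))).symm
  · have h8 : Module.finrank ℝ M = 0 := by
      exact_mod_cast (mul_eq_zero.mp h7).resolve_left hs0
    have := Module.finrank_zero_iff.mp h8
    exact Subsingleton.elim _ _

end LinearAlgebra

variable {𝔤 : Type*} [LieRing 𝔤] [LieAlgebra ℝ 𝔤]

/-- The central element of the isotropy algebra which induces the complex structure modulo the
radical, on the orthogonal complement of the centralizer of the radical. -/
structure IsComplexCenter (σ : 𝔤 ≃ₗ⁅ℝ⁆ 𝔤) (Z : 𝔤) : Prop where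
  mem : Z ∈ isotropy σ
  lie_isotropy : ∀ F ∈ isotropy σ, ⁅Z, F⁆ = 0
  lie_sub_mem : ∀ v ∈ tangent σ, v ∈ radCocentralizer 𝔤 → ⁅Z, v⁆ - sigmaJ σ v ∈ killingRadical 𝔤
  lie_mem : ∀ v ∈ tangent σ, v ∈ radCentralizer 𝔤 → ⁅Z, v⁆ ∈ killingRadical 𝔤

namespace IsTransvectionAlgebra

variable {σ : 𝔤 ≃ₗ⁅ℝ⁆ 𝔤} {G : LinearMap.BilinForm ℝ 𝔤} (h : IsTransvectionAlgebra σ G)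
include h

theorem sigmaJ_mem_rad {x : 𝔤} (hx : x ∈ killingRadical 𝔤) : sigmaJ σ x ∈ killingRadical 𝔤 :=
  sigmaJ_mem_of_sigma_mem (S := (killingRadical 𝔤).toSubmodule) (fun _ => h.sigma_mem_rad) hx

theorem sigmaJ_mem_radCentralizer {x : 𝔤} (hx : x ∈ radCentralizer 𝔤) :
    sigmaJ σ x ∈ radCentralizer 𝔤 :=
  sigmaJ_mem_of_sigma_mem (S := (radCentralizer 𝔤).toSubmodule)
    (fun _ => h.sigma_mem_radCentralizer) hx

theorem sigmaJ_mem_radCocentralizer {x : 𝔤} (hx : x ∈ radCocentralizer 𝔤) :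
    sigmaJ σ x ∈ radCocentralizer 𝔤 :=
  sigmaJ_mem_of_sigma_mem (S := (radCocentralizer 𝔤).toSubmodule)
    (fun _ => h.sigma_mem_radCocentralizer) hx

theorem tangentPart_mem_radCentralizer {x : 𝔤} (hx : x ∈ radCentralizer 𝔤) :
    tangentPart σ x ∈ radCentralizer 𝔤 :=
  tangentPart_mem_of_sigma_mem (S := (radCentralizer 𝔤).toSubmodule)
    (fun _ => h.sigma_mem_radCentralizer) hx

theorem tangentPart_mem_radCocentralizer {x : 𝔤} (hx : x ∈ radCocentralizer 𝔤) :
    tangentPart σ x ∈ radCocentralizer 𝔤 :=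
  tangentPart_mem_of_sigma_mem (S := (radCocentralizer 𝔤).toSubmodule)
    (fun _ => h.sigma_mem_radCocentralizer) hx

theorem tangentPart_mem_rad {x : 𝔤} (hx : x ∈ killingRadical 𝔤) :
    tangentPart σ x ∈ killingRadical 𝔤 :=
  tangentPart_mem_of_sigma_mem (S := (killingRadical 𝔤).toSubmodule)
    (fun _ => h.sigma_mem_rad) hx

variable [Module.Finite ℝ 𝔤]

theorem exists_tangent_decomposition {v : 𝔤} (hv : v ∈ tangent σ) : ∃ c ∈ tangent σ,
    ∃ d ∈ tangent σ, c ∈ radCentralizer 𝔤 ∧ d ∈ radCocentralizer 𝔤 ∧ v = c + d := by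
  obtain ⟨p, hp, hp'⟩ := h.exists_centralizer_proj
  refine ⟨_, h.tangentPart_mem (p v), _, h.tangentPart_mem (v - p v),
    h.tangentPart_mem_radCentralizer (hp v), h.tangentPart_mem_radCocentralizer (hp' v), ?_⟩
  rw [← map_add, add_sub_cancel, tangentPart_of_tangent σ v hv]

omit [Module.Finite ℝ 𝔤] in
-- The 𝔥-part of z acts J-linearly and the torsion with its 𝕍-part acts antilinearly. Half the
-- difference between the relation at v and J applied to the relation at Jv isolates the linear
-- part.
theorem lie_isotropyPart_sub_mem_rad {z v : 𝔤} (hv : v ∈ tangent σ) (a : ℝ)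
    (h1 : ⁅z, v⁆ - a • sigmaJ σ v ∈ killingRadical 𝔤)
    (h2 : ⁅z, sigmaJ σ v⁆ - a • sigmaJ σ (sigmaJ σ v) ∈ killingRadical 𝔤) :
    ⁅isotropyPart σ z, v⁆ - a • sigmaJ σ v ∈ killingRadical 𝔤 := by
  have hF := h.isotropyPart_mem z
  have hu := h.tangentPart_mem z
  have hjv := sigmaJ_mem σ v hv
  have key : ∀ w ∈ tangent σ, tangentPart σ ⁅z, w⁆ =
      ⁅isotropyPart σ z, w⁆ + tangentPart σ ⁅tangentPart σ z, w⁆ := by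
    intro w hw
    conv_lhs => rw [← isotropyPart_add_tangentPart (σ := σ) z]
    rw [add_lie, map_add, tangentPart_lie_isotropy hF, tangentPart_of_tangent σ w hw]
  have e1 := h.tangentPart_mem_rad h1
  have e2 := h.sigmaJ_mem_rad (h.tangentPart_mem_rad h2)
  have hlv := lie_isotropy_tangent σ _ hF _ hv
  have hT := h.tangentPart_mem ⁅tangentPart σ z, v⁆
  rw [map_sub, key _ hv, map_smul, tangentPart_of_tangent σ _ hjv] at e1
  rw [map_sub, key _ hjv, map_smul, tangentPart_of_tangent σ _ (sigmaJ_mem σ _ hjv),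
    ← sigmaJ_lie_isotropy hF, tangentPart_lie_sigmaJ_right hu hv, sigmaJ_sigmaJ hv, map_sub,
    map_add, map_neg, sigmaJ_sigmaJ hlv, sigmaJ_sigmaJ hT, map_smul, map_neg] at e2
  change _ ∈ (killingRadical 𝔤).toSubmodule
  convert (killingRadical 𝔤).toSubmodule.smul_mem (1 / 2 : ℝ) (sub_mem e1 e2) using 1
  module

/-- The map that is J on the 𝕍-part of the M-component and 0 on the C-component is a derivation
modulo the radical, hence inner modulo the radical. The 𝔥-part of the resulting element is the
required Z. -/
theorem exists_isComplexCenter : ∃ Z, IsComplexCenter σ Z := by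
  obtain ⟨p, hp, hp'⟩ := h.exists_centralizer_proj
  let D : Module.End ℝ 𝔤 := sigmaJ σ ∘ₗ tangentPart σ ∘ₗ (LinearMap.id - p)
  have hD : ∀ x, D x = sigmaJ σ (tangentPart σ (x - p x)) := fun x => rfl
  have hDC : ∀ c ∈ radCentralizer 𝔤, D c ∈ killingRadical 𝔤 := fun c hc =>
    h.sigmaJ_mem_rad (h.tangentPart_mem_rad (h.mem_rad_of_mem_of_mem (sub_mem hc (hp c)) (hp' c)))
  have hDC' : ∀ d ∈ radCocentralizer 𝔤, D d - sigmaJ σ (tangentPart σ d) ∈ killingRadical 𝔤 := by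
    intro d hd
    rw [hD, map_sub, map_sub, sub_sub_cancel_left]
    refine neg_mem (h.sigmaJ_mem_rad (h.tangentPart_mem_rad (h.mem_rad_of_mem_of_mem (hp d) ?_)))
    have h1 := sub_mem hd (hp' d)
    rwa [sub_sub_cancel] at h1
  have hDr : ∀ x ∈ killingRadical 𝔤, D x ∈ killingRadical 𝔤 := by
    intro x hx
    have h1 := add_mem (hDC' x (rad_le_radCocentralizer hx))
      (h.sigmaJ_mem_rad (h.tangentPart_mem_rad hx))
    rwa [sub_add_cancel] at h1
  have hDm : ∀ x, D x ∈ radCocentralizer 𝔤 := fun x =>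
    h.sigmaJ_mem_radCocentralizer (h.tangentPart_mem_radCocentralizer (hp' x))
  let E : 𝔤 → 𝔤 → 𝔤 := fun x y => D ⁅x, y⁆ - ⁅D x, y⁆ - ⁅x, D y⁆
  have hE : ∀ x y, E x y = D ⁅x, y⁆ - ⁅D x, y⁆ - ⁅x, D y⁆ := fun x y => rfl
  have e1 : ∀ c ∈ radCentralizer 𝔤, ∀ y, E c y ∈ killingRadical 𝔤 := fun c hc y =>
    sub_mem (sub_mem (hDC _ (lie_mem_left ℝ 𝔤 _ _ _ hc))
      (lie_mem_left ℝ 𝔤 _ _ _ (hDC c hc))) (h.lie_mem_rad hc (hDm y))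
  have e2 : ∀ c ∈ radCentralizer 𝔤, ∀ x, E x c ∈ killingRadical 𝔤 := fun c hc x =>
    sub_mem (sub_mem (hDC _ (lie_mem_right ℝ 𝔤 _ _ _ hc)) (h.lie_mem_rad' (hDm x) hc))
      (lie_mem_right ℝ 𝔤 _ _ _ (hDC c hc))
  have e3 : ∀ d ∈ radCocentralizer 𝔤, ∀ d' ∈ radCocentralizer 𝔤, E d d' ∈ killingRadical 𝔤 := by
    intro d hd d' hd'
    have hF := h.isotropyPart_mem d
    have hF' := h.isotropyPart_mem d'
    have hv := h.tangentPart_mem d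
    have hv' := h.tangentPart_mem d'
    -- On M the defect from a derivation is exactly 3Jτ(v, v'), each of the three terms contributing
    -- one copy by antilinearity. This torsion lies in C ∩ M, hence in the radical.
    have h1 : sigmaJ σ (tangentPart σ ⁅d, d'⁆) - ⁅sigmaJ σ (tangentPart σ d), d'⁆ -
        ⁅d, sigmaJ σ (tangentPart σ d')⁆ =
        (3 : ℝ) • sigmaJ σ (tangentPart σ ⁅tangentPart σ d, tangentPart σ d'⁆) := by
      set F := isotropyPart σ d with hFd
      set F' := isotropyPart σ d' with hFd'
      set v := tangentPart σ d with hvd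
      set v' := tangentPart σ d' with hvd'
      have hdd : d = F + v := (isotropyPart_add_tangentPart d).symm
      have hdd' : d' = F' + v' := (isotropyPart_add_tangentPart d').symm
      have t1 : tangentPart σ ⁅d, d'⁆ = ⁅F, v'⁆ - ⁅F', v⁆ + tangentPart σ ⁅v, v'⁆ := by
        rw [hdd, hdd', add_lie, lie_add, lie_add, map_add, map_add, map_add,
          tangentPart_lie_isotropy hF, tangentPart_of_isotropy σ F' hF', lie_zero,
          tangentPart_lie_isotropy hF, tangentPart_of_tangent σ v' hv', ← lie_skew v F', map_neg,
          tangentPart_lie_isotropy hF', tangentPart_of_tangent σ v hv]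
        abel
      have t2 : ⁅sigmaJ σ v, d'⁆ = -⁅F', sigmaJ σ v⁆ - isotropyPart σ ⁅v, sigmaJ σ v'⁆ -
          sigmaJ σ (tangentPart σ ⁅v, v'⁆) := by
        rw [hdd', lie_add, ← lie_skew, ← isotropyPart_add_tangentPart (σ := σ) ⁅sigmaJ σ v, v'⁆,
          isotropyPart_lie_sigmaJ_left hv hv', tangentPart_lie_sigmaJ_left hv hv']
        abel
      have t3 : ⁅d, sigmaJ σ v'⁆ = ⁅F, sigmaJ σ v'⁆ + isotropyPart σ ⁅v, sigmaJ σ v'⁆ -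
          sigmaJ σ (tangentPart σ ⁅v, v'⁆) := by
        conv_lhs => rw [hdd, add_lie, ← isotropyPart_add_tangentPart (σ := σ) ⁅v, sigmaJ σ v'⁆,
          tangentPart_lie_sigmaJ_right hv hv']
        abel
      rw [t1, t2, t3, map_add, map_sub, sigmaJ_lie_isotropy hF, sigmaJ_lie_isotropy hF']
      module
    have h2 : E d d' = (D ⁅d, d'⁆ - sigmaJ σ (tangentPart σ ⁅d, d'⁆)) -
        ⁅D d - sigmaJ σ (tangentPart σ d), d'⁆ - ⁅d, D d' - sigmaJ σ (tangentPart σ d')⁆ +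
        (3 : ℝ) • sigmaJ σ (tangentPart σ ⁅tangentPart σ d, tangentPart σ d'⁆) := by
      rw [← h1, hE, sub_lie, lie_sub]
      abel
    rw [h2]
    refine add_mem (sub_mem (sub_mem (hDC' _ (lie_mem_left ℝ 𝔤 _ _ _ hd))
      (lie_mem_left ℝ 𝔤 _ _ _ (hDC' d hd))) (lie_mem_right ℝ 𝔤 _ _ _ (hDC' d' hd')))
      ((killingRadical 𝔤).smul_mem _ (h.sigmaJ_mem_rad (h.mem_rad_of_mem_of_mem
        (h.tangentPart_lie_mem_radCentralizer hv hv') (h.tangentPart_mem_radCocentralizer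
          (lie_mem_left ℝ 𝔤 _ _ _ (h.tangentPart_mem_radCocentralizer hd))))))
  obtain ⟨z, hz⟩ := h.exists_lie_sub_mem_rad hDr fun x y => by
    change E x y ∈ killingRadical 𝔤
    have h1 : E x y = E (p x) y + E (x - p x) (p y) + E (x - p x) (y - p y) := by
      simp only [hE, map_sub, lie_sub, sub_lie]
      abel
    rw [h1]
    exact add_mem (add_mem (e1 _ (hp x) y) (e2 _ (hp y) _)) (e3 _ (hp' x) _ (hp' y))
  have f1 : ∀ v ∈ tangent σ, v ∈ radCocentralizer 𝔤 → ⁅z, v⁆ - (1 : ℝ) • sigmaJ σ v ∈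
      killingRadical 𝔤 := by
    intro v hv hvC
    have h1 := sub_mem (hDC' v hvC) (hz v)
    rwa [sub_sub_sub_cancel_left, tangentPart_of_tangent σ v hv, ← one_smul ℝ (sigmaJ σ v)] at h1
  have f2 : ∀ v ∈ radCentralizer 𝔤, ⁅z, v⁆ - (0 : ℝ) • sigmaJ σ v ∈ killingRadical 𝔤 := by
    intro v hvC
    have h1 := sub_mem (hDC v hvC) (hz v)
    rwa [sub_sub_cancel, ← sub_zero ⁅z, v⁆, ← zero_smul ℝ (sigmaJ σ v)] at h1
  have g1 : ∀ v ∈ tangent σ, v ∈ radCocentralizer 𝔤 → ⁅isotropyPart σ z, v⁆ - sigmaJ σ v ∈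
      killingRadical 𝔤 := by
    intro v hv hvC
    have h1 := h.lie_isotropyPart_sub_mem_rad hv 1 (f1 v hv hvC)
      (f1 _ (sigmaJ_mem σ v hv) (h.sigmaJ_mem_radCocentralizer hvC))
    rwa [one_smul] at h1
  have g2 : ∀ v ∈ tangent σ, v ∈ radCentralizer 𝔤 → ⁅isotropyPart σ z, v⁆ ∈
      killingRadical 𝔤 := by
    intro v hv hvC
    have h1 := h.lie_isotropyPart_sub_mem_rad hv 0 (f2 v hvC)
      (f2 _ (h.sigmaJ_mem_radCentralizer hvC))
    rwa [zero_smul, sub_zero] at h1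
  have hZ := h.isotropyPart_mem z
  refine ⟨isotropyPart σ z, hZ, fun F hF => ?_, g1, g2⟩
  -- [Z, F] acts trivially modulo the radical because F commutes with J and preserves both C and M.
  refine h.eq_zero_of_lie_mem_rad ((isotropy σ).lie_mem hZ hF) fun v hv => ?_
  obtain ⟨c, hc, d, hd, hcC, hdC, rfl⟩ := h.exists_tangent_decomposition hv
  rw [lie_add]
  refine add_mem ?_ ?_
  · rw [lie_lie]
    exact sub_mem (g2 _ (lie_isotropy_tangent σ F hF c hc) (lie_mem_right ℝ 𝔤 _ _ _ hcC))
      (lie_mem_right ℝ 𝔤 _ _ _ (g2 c hc hcC))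
  · have h1 := sub_mem (g1 _ (lie_isotropy_tangent σ F hF d hd) (lie_mem_right ℝ 𝔤 _ _ _ hdC))
      (lie_mem_right ℝ 𝔤 _ F _ (g1 d hd hdC))
    rwa [lie_sub, ← sigmaJ_lie_isotropy hF, sub_sub_sub_cancel_right, ← lie_lie] at h1

end IsTransvectionAlgebra

end

end ThreeSymmetric

namespace ThreeSymmetric

noncomputable section

attribute [local instance 100] LieRing.ofAssociativeRing

/-! ## The action of the complex center on the center of the radical -/

variable {𝔤 : Type*} [LieRing 𝔤] [LieAlgebra ℝ 𝔤]

theorem IsComplexCenter.lie_lie_isotropy {σ : 𝔤 ≃ₗ⁅ℝ⁆ 𝔤} {Z : 𝔤} (hZ : IsComplexCenter σ Z)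
    {F : 𝔤} (hF : F ∈ isotropy σ) (x : 𝔤) : ⁅Z, ⁅F, x⁆⁆ = ⁅F, ⁅Z, x⁆⁆ := by
  rw [leibniz_lie, hZ.lie_isotropy F hF, zero_lie, zero_add]

/-- The operator `Z (Z + j)`. -/
def centerOp (σ : 𝔤 ≃ₗ⁅ℝ⁆ 𝔤) (Z : 𝔤) : Module.End ℝ 𝔤 :=
  LieAlgebra.ad ℝ 𝔤 Z ∘ₗ LieAlgebra.ad ℝ 𝔤 Z + sigmaJ σ ∘ₗ LieAlgebra.ad ℝ 𝔤 Z

theorem centerOp_apply {σ : 𝔤 ≃ₗ⁅ℝ⁆ 𝔤} {Z : 𝔤} (x : 𝔤) :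
    centerOp σ Z x = ⁅Z, ⁅Z, x⁆⁆ + sigmaJ σ ⁅Z, x⁆ := rfl

theorem centerOp_sigmaJ {σ : 𝔤 ≃ₗ⁅ℝ⁆ 𝔤} {Z : 𝔤} (hZ : Z ∈ isotropy σ) (x : 𝔤) :
    centerOp σ Z (sigmaJ σ x) = sigmaJ σ (centerOp σ Z x) := by
  simp only [centerOp_apply, map_add, sigmaJ_lie_isotropy hZ]

namespace IsTransvectionAlgebra

variable {σ : 𝔤 ≃ₗ⁅ℝ⁆ 𝔤} {G : LinearMap.BilinForm ℝ 𝔤} (h : IsTransvectionAlgebra σ G)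
  {Z : 𝔤} (hZ : IsComplexCenter σ Z)
include h hZ

variable [Module.Finite ℝ 𝔤]

omit hZ in
-- A bracket with the radical stays in 𝕍, so it equals the torsion and inherits its antilinearity.
theorem lie_sigmaJ_of_mem_rad {v x : 𝔤} (hv : v ∈ tangent σ) (hx : x ∈ killingRadical 𝔤) :
    ⁅v, sigmaJ σ x⁆ = -sigmaJ σ ⁅v, x⁆ := by
  rw [← tangentPart_of_tangent σ ⁅v, sigmaJ σ x⁆
    (h.rad_le_tangent (lie_mem_right ℝ 𝔤 _ _ _ (h.sigmaJ_mem_rad hx))),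
    tangentPart_lie_sigmaJ_right hv (h.rad_le_tangent hx),
    tangentPart_of_tangent σ _ (h.rad_le_tangent (lie_mem_right ℝ 𝔤 _ _ _ hx))]

omit hZ in
theorem sigmaJ_lie_of_mem_rad {v x : 𝔤} (hv : v ∈ tangent σ) (hx : x ∈ killingRadical 𝔤) :
    ⁅sigmaJ σ v, x⁆ = -sigmaJ σ ⁅v, x⁆ := by
  rw [← tangentPart_of_tangent σ ⁅sigmaJ σ v, x⁆
    (h.rad_le_tangent (lie_mem_right ℝ 𝔤 _ _ _ hx)),
    tangentPart_lie_sigmaJ_left hv (h.rad_le_tangent hx),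
    tangentPart_of_tangent σ _ (h.rad_le_tangent (lie_mem_right ℝ 𝔤 _ _ _ hx))]

/-- On the center of the radical, `Z + j / 2` commutes with the adjoint action. -/
theorem lie_center_lie {v a : 𝔤} (hv : v ∈ tangent σ) (haC : a ∈ radCentralizer 𝔤)
    (har : a ∈ killingRadical 𝔤) : ⁅Z, ⁅v, a⁆⁆ = ⁅v, ⁅Z, a⁆⁆ - sigmaJ σ ⁅v, a⁆ := by
  obtain ⟨c, hc, d, hd, hcC, hdC, rfl⟩ := h.exists_tangent_decomposition hv
  have har' : ⁅Z, a⁆ ∈ killingRadical 𝔤 := lie_mem_right ℝ 𝔤 _ _ _ har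
  rw [add_lie, add_lie, lie_eq_zero_of_mem_radCentralizer hcC har,
    lie_eq_zero_of_mem_radCentralizer hcC har', zero_add, zero_add, leibniz_lie]
  have h1 := lie_eq_zero_of_mem_radCentralizer' haC (hZ.lie_sub_mem d hd hdC)
  rw [sub_lie, sub_eq_zero] at h1
  rw [h1, h.sigmaJ_lie_of_mem_rad hd har]
  abel

/-- The operator `Z (Z + j)` commutes with the adjoint action on the center of the radical. -/
theorem centerOp_lie (x : 𝔤) {a : 𝔤} (haC : a ∈ radCentralizer 𝔤) (har : a ∈ killingRadical 𝔤) :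
    centerOp σ Z ⁅x, a⁆ = ⁅x, centerOp σ Z a⁆ := by
  have haC' : ⁅Z, a⁆ ∈ radCentralizer 𝔤 := lie_mem_right ℝ 𝔤 _ _ _ haC
  have har' : ⁅Z, a⁆ ∈ killingRadical 𝔤 := lie_mem_right ℝ 𝔤 _ _ _ har
  have hF := h.isotropyPart_mem x
  have hv := h.tangentPart_mem x
  rw [← isotropyPart_add_tangentPart (σ := σ) x]
  simp only [centerOp_apply, add_lie, lie_add, map_add]
  rw [hZ.lie_lie_isotropy hF, hZ.lie_lie_isotropy hF, sigmaJ_lie_isotropy hF,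
    h.lie_center_lie hZ hv haC har, lie_sub, h.lie_center_lie hZ hv haC' har',
    h.lie_sigmaJ_of_mem_rad hv har', ← sigmaJ_lie_isotropy hZ.mem,
    h.lie_center_lie hZ hv haC har, map_sub]
  abel

/-- The eigenspaces of `Z (Z + j)` on the center of the radical. -/
def centerEigenspace (s : ℝ) : LieIdeal ℝ 𝔤 where
  carrier := {a | a ∈ radCentralizer 𝔤 ∧ a ∈ killingRadical 𝔤 ∧
    centerOp σ Z a = (-(s * (s + 1))) • a}
  zero_mem' := ⟨zero_mem _, zero_mem _, by simp⟩
  add_mem' := by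
    rintro a b ⟨h1, h2, h3⟩ ⟨h1', h2', h3'⟩
    exact ⟨add_mem h1 h1', add_mem h2 h2', by rw [map_add, h3, h3', smul_add]⟩
  smul_mem' := by
    rintro c a ⟨h1, h2, h3⟩
    refine ⟨(radCentralizer 𝔤).smul_mem c h1, (killingRadical 𝔤).smul_mem c h2, ?_⟩
    rw [map_smul, h3, smul_comm]
  lie_mem := by
    rintro x a ⟨h1, h2, h3⟩
    refine ⟨lie_mem_right ℝ 𝔤 _ _ _ h1, lie_mem_right ℝ 𝔤 _ _ _ h2, ?_⟩
    rw [h.centerOp_lie hZ x h1 h2, h3, lie_smul]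

theorem sigmaJ_mem_centerEigenspace {s : ℝ} {a : 𝔤} (ha : a ∈ h.centerEigenspace hZ s) :
    sigmaJ σ a ∈ h.centerEigenspace hZ s := by
  obtain ⟨h1, h2, h3⟩ := ha
  refine ⟨h.sigmaJ_mem_radCentralizer h1, h.sigmaJ_mem_rad h2, ?_⟩
  rw [centerOp_sigmaJ hZ.mem, h3, map_smul]

/-- On the eigenspace, E = -JZ has eigenvalues among s and -s - 1. The vanishing trace of (Z + J/2)Z
prescribes tr E = 2s(s + 1) dim, too large unless s = 0 or the space is zero; for s = 0 it forces E
= 0. -/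
theorem lie_eq_smul_of_mem_centerEigenspace {s : ℝ} (hs : 0 ≤ s) :
    (∀ a ∈ h.centerEigenspace hZ s, sigmaJ σ ⁅Z, a⁆ = -s • a) ∧
      (s ≠ 0 → ∀ a ∈ h.centerEigenspace hZ s, a = 0) := by
  set M := h.centerEigenspace hZ s with hM
  let jM : Module.End ℝ M := (sigmaJ σ).restrict fun a ha => h.sigmaJ_mem_centerEigenspace hZ ha
  let ρ := LieModule.toEnd ℝ 𝔤 M
  have hρ : ∀ x (a : M), ((ρ x a : M) : 𝔤) = ⁅x, (a : 𝔤)⁆ := fun x a => rfl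
  have hjM : ∀ a : M, ((jM a : M) : 𝔤) = sigmaJ σ (a : 𝔤) := fun a => rfl
  have hjj : ∀ a : M, jM (jM a) = -a := fun a => Subtype.ext (by
    rw [hjM, hjM, sigmaJ_sigmaJ (h.rad_le_tangent a.2.2.1)]
    rfl)
  have hjZ : ∀ a : M, jM (ρ Z a) = ρ Z (jM a) := fun a =>
    Subtype.ext (sigmaJ_lie_isotropy hZ.mem _)
  have hZZ : ∀ a : M, ρ Z (ρ Z a) = -jM (ρ Z a) - (s * (s + 1)) • a := by
    intro a
    have h1 : ρ Z (ρ Z a) + jM (ρ Z a) = (-(s * (s + 1))) • a := Subtype.ext a.2.2.2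
    rw [eq_sub_of_add_eq h1]
    module
  let T : Module.End ℝ M := ρ Z + (1 / 2 : ℝ) • jM
  have hT : ∀ a, T a = ρ Z a + (1 / 2 : ℝ) • jM a := fun a => rfl
  have hTv : ∀ v ∈ tangent σ, ∀ a, T (ρ v a) = ρ v (T a) := by
    intro v hv a
    have e1 : ρ Z (ρ v a) = ρ v (ρ Z a) - jM (ρ v a) :=
      Subtype.ext (h.lie_center_lie hZ hv a.2.1 a.2.2.1)
    have e2 : ρ v (jM a) = -jM (ρ v a) := Subtype.ext (h.lie_sigmaJ_of_mem_rad hv a.2.2.1)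
    rw [hT, hT, e1, map_add, map_smul, e2]
    module
  -- F is a sum of brackets [v, w] modulo torsion, which acts by zero on the center of the radical.
  -- Since T commutes with ρ(v), cyclicity makes tr(T[ρ v, ρ w]) vanish.
  have htr : ∀ F ∈ isotropy σ, LinearMap.trace ℝ M (T * ρ F) = 0 := by
    intro F hF
    have h1 : F ∈ LinearMap.ker ((LinearMap.trace ℝ M ∘ₗ LinearMap.mulLeft ℝ T) ∘ₗ
        (ρ : 𝔤 →ₗ[ℝ] Module.End ℝ M)) := by
      refine h.isotropy_le (fun v hv w hw => ?_) hF
      rw [LinearMap.mem_ker]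
      change LinearMap.trace ℝ M (T * ρ (isotropyPart σ ⁅v, w⁆)) = 0
      have e1 : ρ (tangentPart σ ⁅v, w⁆) = 0 := LinearMap.ext fun a => Subtype.ext
        (lie_eq_zero_of_mem_radCentralizer (h.tangentPart_lie_mem_radCentralizer hv hw) a.2.2.1)
      have e2 : T * ρ v = ρ v * T := LinearMap.ext fun a => hTv v hv a
      rw [isotropyPart_apply, map_sub, e1, sub_zero, LieHom.map_lie, LieRing.of_associative_ring_bracket,
        mul_sub, map_sub, ← mul_assoc, e2, mul_assoc, LinearMap.trace_mul_comm, mul_assoc, sub_self]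
    exact h1
  have hE : ∀ a, (-(jM * ρ Z)) ((-(jM * ρ Z)) a) =
      -(-(jM * ρ Z)) a + (s * (s + 1)) • a := by
    intro a
    change -jM (ρ Z (-jM (ρ Z a))) = - -jM (ρ Z a) + _
    rw [map_neg, map_neg, ← hjZ, hjj, hZZ]
    module
  have hE' : LinearMap.trace ℝ M (-(jM * ρ Z)) = 2 * s * (s + 1) * Module.finrank ℝ M := by
    have e1 := htr Z hZ.mem
    have e2 : T * ρ Z = (1 / 2 : ℝ) • (-(jM * ρ Z)) - (s * (s + 1)) • 1 := by
      ext1 a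
      change ρ Z (ρ Z a) + (1 / 2 : ℝ) • jM (ρ Z a) = (1 / 2 : ℝ) • -jM (ρ Z a) -
        (s * (s + 1)) • a
      rw [hZZ]
      module
    rw [e2, map_sub, map_smul, map_smul, LinearMap.trace_one, smul_eq_mul, smul_eq_mul] at e1
    linarith
  obtain ⟨h1, h2⟩ := eq_smul_of_trace_eq hs hE hE'
  refine ⟨fun a ha => ?_, fun hs0 a ha => congrArg Subtype.val (h2 hs0 ⟨a, ha⟩)⟩
  have h3 := congrArg Subtype.val (h1 ⟨a, ha⟩)
  change -sigmaJ σ ⁅Z, a⁆ = s • a at h3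
  rw [neg_smul, ← h3, neg_neg]

/-- A vector in the center of the radical which is annihilated by `Z (Z + j)` is annihilated by
`Z`. -/
theorem lie_center_eq_zero {a : 𝔤} (haC : a ∈ radCentralizer 𝔤) (har : a ∈ killingRadical 𝔤)
    (ha : centerOp σ Z a = 0) : ⁅Z, a⁆ = 0 := by
  have h1 := (h.lie_eq_smul_of_mem_centerEigenspace hZ le_rfl).1 a ⟨haC, har, by simpa using ha⟩
  rw [neg_zero, zero_smul] at h1
  have h2 := sigmaJ_sigmaJ (h.rad_le_tangent (lie_mem_right ℝ 𝔤 (killingRadical 𝔤) Z a har))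
  rw [h1, map_zero, eq_comm, neg_eq_zero] at h2
  exact h2

/-- There are no vectors in the center of the radical annihilated by `Z + 2 j`. -/
theorem eq_zero_of_lie_center {a : 𝔤} (haC : a ∈ radCentralizer 𝔤) (har : a ∈ killingRadical 𝔤)
    (ha : ⁅Z, a⁆ = (-2 : ℝ) • sigmaJ σ a) : a = 0 := by
  -- The case s = 1: from Za = -2Ja follows Z(Z + J)a = -2a.
  refine (h.lie_eq_smul_of_mem_centerEigenspace hZ zero_le_one).2 one_ne_zero a ⟨haC, har, ?_⟩
  have hj := sigmaJ_sigmaJ (h.rad_le_tangent har)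
  rw [centerOp_apply, ha, lie_smul, ← sigmaJ_lie_isotropy hZ.mem, ha, map_smul, hj]
  module

end IsTransvectionAlgebra

end

end ThreeSymmetric

namespace ThreeSymmetric

noncomputable section

attribute [local instance 100] LieRing.ofAssociativeRing

/-! ## The Levi factor -/

variable {𝔤 : Type*} [LieRing 𝔤] [LieAlgebra ℝ 𝔤]

/-- The orthogonal complement of the radical in `𝕍`. -/
def leviTangent (σ : 𝔤 ≃ₗ⁅ℝ⁆ 𝔤) (G : LinearMap.BilinForm ℝ 𝔤) : Submodule ℝ 𝔤 :=
  tangent σ ⊓ G.orthogonal (killingRadical 𝔤).toSubmodule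

namespace IsTransvectionAlgebra

variable {σ : 𝔤 ≃ₗ⁅ℝ⁆ 𝔤} {G : LinearMap.BilinForm ℝ 𝔤} (h : IsTransvectionAlgebra σ G)
include h

theorem mem_leviTangent {x : 𝔤} :
    x ∈ leviTangent σ G ↔ x ∈ tangent σ ∧ ∀ y ∈ killingRadical 𝔤, G x y = 0 :=
  and_congr_right fun _ => forall₂_congr fun y _ => by
    change G y x = 0 ↔ _
    rw [h.inner.symm]

theorem sigma_mem_leviTangent {x : 𝔤} (hx : x ∈ leviTangent σ G) : σ x ∈ leviTangent σ G := by
  rw [h.mem_leviTangent] at hx ⊢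
  refine ⟨sigma_mem_tangent hx.1, fun y hy => ?_⟩
  rw [← h.cube y, h.sigma, hx.2 _ (h.sigma_mem_rad (h.sigma_mem_rad hy))]

theorem sigmaJ_mem_leviTangent {x : 𝔤} (hx : x ∈ leviTangent σ G) :
    sigmaJ σ x ∈ leviTangent σ G :=
  sigmaJ_mem_of_sigma_mem (fun _ => h.sigma_mem_leviTangent) hx

theorem lie_mem_leviTangent {F x : 𝔤} (hF : F ∈ isotropy σ) (hx : x ∈ leviTangent σ G) :
    ⁅F, x⁆ ∈ leviTangent σ G := by
  rw [h.mem_leviTangent] at hx ⊢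
  refine ⟨lie_isotropy_tangent σ F hF x hx.1, fun y hy => ?_⟩
  rw [eq_neg_of_add_eq_zero_left (h.skew F hF x y), hx.2 _ (lie_mem_right ℝ 𝔤 _ _ _ hy), neg_zero]

theorem eq_zero_of_mem_leviTangent {x : 𝔤} (hx : x ∈ leviTangent σ G)
    (hr : x ∈ killingRadical 𝔤) : x = 0 :=
  h.inner.eq_zero ((h.mem_leviTangent.mp hx).2 x hr)

variable [Module.Finite ℝ 𝔤]

theorem exists_leviTangent_add_rad {v : 𝔤} (hv : v ∈ tangent σ) :
    ∃ x ∈ leviTangent σ G, ∃ a ∈ killingRadical 𝔤, v = x + a := by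
  obtain ⟨P, hP, hP'⟩ := h.inner.exists_proj (killingRadical 𝔤).toSubmodule
  exact ⟨v - P v, h.mem_leviTangent.mpr ⟨sub_mem hv (h.rad_le_tangent (hP v)), hP' v⟩, P v, hP v,
    (sub_add_cancel _ _).symm⟩

omit [Module.Finite ℝ 𝔤] in
theorem lie_mem_leviTangent_of_mem_radCentralizer {F v : 𝔤} (hF : F ∈ isotropy σ)
    (hFC : F ∈ radCentralizer 𝔤) (hv : v ∈ tangent σ) : ⁅F, v⁆ ∈ leviTangent σ G := by
  refine h.mem_leviTangent.mpr ⟨lie_isotropy_tangent σ F hF v hv, fun y hy => ?_⟩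
  rw [eq_neg_of_add_eq_zero_left (h.skew F hF v y), lie_eq_zero_of_mem_radCentralizer hFC hy,
    map_zero, neg_zero]

/-- Modulo the radical, a tangent vector in the centralizer `C` of the radical is a sum of brackets
of elements of `C ∩ 𝔥` with elements of `C ∩ 𝕍` orthogonal to the radical. -/
theorem exists_span_add_rad {c : 𝔤} (hc : c ∈ tangent σ) (hcC : c ∈ radCentralizer 𝔤) :
    ∃ x ∈ Submodule.span ℝ {z | ∃ F ∈ isotropy σ, ∃ y ∈ leviTangent σ G, F ∈ radCentralizer 𝔤 ∧
      y ∈ radCentralizer 𝔤 ∧ z = ⁅F, y⁆}, ∃ a ∈ killingRadical 𝔤, c = x + a := by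
  set W := Submodule.span ℝ {z | ∃ F ∈ isotropy σ, ∃ y ∈ leviTangent σ G, F ∈ radCentralizer 𝔤 ∧
      y ∈ radCentralizer 𝔤 ∧ z = ⁅F, y⁆} with hW
  have hW1 : ∀ x ∈ W, x ∈ leviTangent σ G := fun x hx => by
    refine Submodule.span_le.mpr ?_ hx
    rintro _ ⟨F, hF, y, hy, _, _, rfl⟩
    exact h.lie_mem_leviTangent hF hy
  have hW2 : ∀ x ∈ W, x ∈ radCentralizer 𝔤 := fun x hx => by
    refine Submodule.span_le (p := (radCentralizer 𝔤).toSubmodule).mpr ?_ hx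
    rintro _ ⟨F, hF, y, hy, hFC, _, rfl⟩
    exact lie_mem_left ℝ 𝔤 _ _ _ hFC
  obtain ⟨P, hP, hP'⟩ := h.inner.exists_proj W
  have hu : c - P c ∈ tangent σ := sub_mem hc (hW1 _ (hP c)).1
  have huC : c - P c ∈ radCentralizer 𝔤 := sub_mem hcC (hW2 _ (hP c))
  refine ⟨P c, hP c, c - P c, h.mem_rad_of_fixed hu huC fun F hF hFC => ?_, by abel⟩
  -- With u = c - P c one has |[F, u]|² = -G(u, [F, [F, u]]), and [F, [F, u]] is one of the
  -- generators of W, to which u is orthogonal.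
  have h1 := h.lie_mem_leviTangent_of_mem_radCentralizer hF hFC hu
  refine h.inner.eq_zero ?_
  rw [eq_neg_of_add_eq_zero_left (h.skew F hF _ _), neg_eq_zero]
  exact hP' _ _ (Submodule.subset_span ⟨F, hF, _, h1, hFC, lie_mem_left ℝ 𝔤 _ _ _ hFC, rfl⟩)

theorem mem_span_of_mem_leviTangent {x : 𝔤} (hx : x ∈ leviTangent σ G)
    (hxC : x ∈ radCentralizer 𝔤) :
    x ∈ Submodule.span ℝ {z | ∃ F ∈ isotropy σ, ∃ y ∈ leviTangent σ G, F ∈ radCentralizer 𝔤 ∧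
      y ∈ radCentralizer 𝔤 ∧ z = ⁅F, y⁆} := by
  obtain ⟨y, hy, a, ha, rfl⟩ := h.exists_span_add_rad hx.1 hxC
  have hyH : y ∈ leviTangent σ G := by
    refine Submodule.span_le.mpr ?_ hy
    rintro _ ⟨F, hF, y, hy, _, _, rfl⟩
    exact h.lie_mem_leviTangent hF hy
  have h1 := sub_mem hx hyH
  rw [add_sub_cancel_left] at h1
  rwa [h.eq_zero_of_mem_leviTangent h1 ha, add_zero]

omit [Module.Finite ℝ 𝔤] h in
theorem span_le_derived : Submodule.span ℝ {z | ∃ F ∈ isotropy σ, ∃ y ∈ leviTangent σ G,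
    F ∈ radCentralizer 𝔤 ∧ y ∈ radCentralizer 𝔤 ∧ z = ⁅F, y⁆} ≤
      (⁅radCentralizer 𝔤, radCentralizer 𝔤⁆ : LieIdeal ℝ 𝔤).toSubmodule := by
  rw [Submodule.span_le]
  rintro _ ⟨F, hF, y, hy, hFC, hyC, rfl⟩
  exact LieSubmodule.lie_mem_lie hFC hyC

/-- The radical part of the C-component is moved to the other summand, which contains the radical.
-/
theorem exists_leviTangent_decomposition {x : 𝔤} (hx : x ∈ leviTangent σ G) :
    ∃ c ∈ leviTangent σ G, ∃ d ∈ leviTangent σ G, c ∈ radCentralizer 𝔤 ∧ d ∈ radCocentralizer 𝔤 ∧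
      x = c + d := by
  obtain ⟨c, hc, d, hd, hcC, hdC, rfl⟩ := h.exists_tangent_decomposition hx.1
  obtain ⟨y, hy, a, ha, rfl⟩ := h.exists_span_add_rad hc hcC
  have hyH : y ∈ leviTangent σ G := by
    refine Submodule.span_le.mpr ?_ hy
    rintro _ ⟨F, hF, y, hy, _, _, rfl⟩
    exact h.lie_mem_leviTangent hF hy
  have h1 := sub_mem hx hyH
  rw [add_assoc, add_sub_cancel_left] at h1
  exact ⟨y, hyH, a + d, h1, LieSubmodule.lie_le_left _ _ (span_le_derived hy),
    add_mem (rad_le_radCocentralizer ha) hdC, add_assoc _ _ _⟩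

/-- The two parts of the Levi factor commute. -/
theorem lie_eq_zero_of_mem_leviTangent {x y : 𝔤} (hx : x ∈ leviTangent σ G)
    (hxC : x ∈ radCentralizer 𝔤) (hy : y ∈ radCocentralizer 𝔤) : ⁅x, y⁆ = 0 :=
  h.eq_zero_of_mem_derived_of_mem_rad
    (lie_mem_left ℝ 𝔤 _ _ _ (span_le_derived (h.mem_span_of_mem_leviTangent hx hxC)))
    (h.lie_mem_rad hxC hy)

section Center

variable {Z : 𝔤} (hZ : IsComplexCenter σ Z)
include hZ

omit [Module.Finite ℝ 𝔤] in
theorem lie_center_of_mem_radCocentralizer {x : 𝔤} (hx : x ∈ leviTangent σ G)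
    (hxC : x ∈ radCocentralizer 𝔤) : ⁅Z, x⁆ = sigmaJ σ x :=
  sub_eq_zero.mp (h.eq_zero_of_mem_leviTangent (sub_mem (h.lie_mem_leviTangent hZ.mem hx)
    (h.sigmaJ_mem_leviTangent hx)) (hZ.lie_sub_mem x hx.1 hxC))

/-- The torsion a lies in C ∩ M, hence in the center of the radical, and Za = τ(Jx, y) + τ(x, Jy) =
-2Ja. The trace argument excludes this eigenvector. -/
theorem tangentPart_lie_eq_zero_of_mem_radCocentralizer {x y : 𝔤} (hx : x ∈ leviTangent σ G)
    (hy : y ∈ leviTangent σ G) (hxC : x ∈ radCocentralizer 𝔤) (hyC : y ∈ radCocentralizer 𝔤) :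
    tangentPart σ ⁅x, y⁆ = 0 := by
  have h1 := h.tangentPart_lie_mem_radCentralizer hx.1 hy.1
  refine h.eq_zero_of_lie_center hZ h1 (h.mem_rad_of_mem_of_mem h1
    (h.tangentPart_mem_radCocentralizer (lie_mem_left ℝ 𝔤 _ _ _ hxC))) ?_
  rw [← tangentPart_lie_isotropy hZ.mem, leibniz_lie, h.lie_center_of_mem_radCocentralizer hZ hx hxC,
    h.lie_center_of_mem_radCocentralizer hZ hy hyC, map_add, tangentPart_lie_sigmaJ_left hx.1 hy.1,
    tangentPart_lie_sigmaJ_right hx.1 hy.1]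
  module

end Center

/-- Only the torsion of the two C-components survives. It lies in [C, C], which is σ-stable, and
agrees modulo the radical with an element of H ∩ [C, C]; the error lies in [C, C] ∩ r = 0. -/
theorem tangentPart_lie_mem_leviTangent {x y : 𝔤} (hx : x ∈ leviTangent σ G)
    (hy : y ∈ leviTangent σ G) : tangentPart σ ⁅x, y⁆ ∈ leviTangent σ G := by
  obtain ⟨Z, hZ⟩ := h.exists_isComplexCenter
  obtain ⟨c, hc, d, hd, hcC, hdC, rfl⟩ := h.exists_leviTangent_decomposition hx
  obtain ⟨c', hc', d', hd', hcC', hdC', rfl⟩ := h.exists_leviTangent_decomposition hy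
  have h1 : tangentPart σ ⁅c + d, c' + d'⁆ = tangentPart σ ⁅c, c'⁆ := by
    rw [add_lie, lie_add, lie_add, h.lie_eq_zero_of_mem_leviTangent hc hcC hdC', ← lie_skew d c',
      h.lie_eq_zero_of_mem_leviTangent hc' hcC' hdC, neg_zero, add_zero, zero_add, map_add,
      h.tangentPart_lie_eq_zero_of_mem_radCocentralizer hZ hd hd' hdC hdC', add_zero]
  rw [h1]
  obtain ⟨y, hy, a, ha, h2⟩ := h.exists_span_add_rad (h.tangentPart_mem ⁅c, c'⁆)
    (h.tangentPart_lie_mem_radCentralizer hc.1 hc'.1)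
  have hyH : y ∈ leviTangent σ G := by
    refine Submodule.span_le.mpr ?_ hy
    rintro _ ⟨F, hF, y, hy, _, _, rfl⟩
    exact h.lie_mem_leviTangent hF hy
  have hσ : ∀ z ∈ (⁅radCentralizer 𝔤, radCentralizer 𝔤⁆ : LieIdeal ℝ 𝔤).toSubmodule,
      σ z ∈ (⁅radCentralizer 𝔤, radCentralizer 𝔤⁆ : LieIdeal ℝ 𝔤).toSubmodule := by
    intro z hz
    have h3 : ∀ z ∈ (⁅radCentralizer 𝔤, radCentralizer 𝔤⁆ : LieIdeal ℝ 𝔤).toSubmodule,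
        z ∈ ((⁅radCentralizer 𝔤, radCentralizer 𝔤⁆ : LieIdeal ℝ 𝔤).toSubmodule).comap
          (σ : 𝔤 →ₗ[ℝ] 𝔤) := by
      intro z hz
      rw [LieSubmodule.lieIdeal_oper_eq_linear_span'] at hz
      refine Submodule.span_le.mpr ?_ hz
      rintro _ ⟨u, hu, w, hw, rfl⟩
      change σ ⁅u, w⁆ ∈ ⁅radCentralizer 𝔤, radCentralizer 𝔤⁆
      rw [LieEquiv.map_lie]
      exact LieSubmodule.lie_mem_lie (h.sigma_mem_radCentralizer hu) (h.sigma_mem_radCentralizer hw)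
    exact h3 z hz
  have h4 := sub_mem (tangentPart_mem_of_sigma_mem hσ (LieSubmodule.lie_mem_lie hcC hcC'))
    (span_le_derived hy)
  rw [h2, add_sub_cancel_left] at h4
  rwa [h2, h.eq_zero_of_mem_derived_of_mem_rad h4 ha, add_zero]

/-- The Levi factor `𝔥 ⊕ H`, where `H` is the orthogonal complement of the radical in `𝕍`. -/
def levi : LieSubalgebra ℝ 𝔤 where
  toSubmodule := (leviTangent σ G).comap (tangentPart σ)
  lie_mem' := by
    intro x y hx hy
    have hF := h.isotropyPart_mem x
    have hF' := h.isotropyPart_mem y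
    change tangentPart σ x ∈ leviTangent σ G at hx
    change tangentPart σ y ∈ leviTangent σ G at hy
    change tangentPart σ ⁅x, y⁆ ∈ leviTangent σ G
    rw [← isotropyPart_add_tangentPart (σ := σ) x, ← isotropyPart_add_tangentPart (σ := σ) y,
      add_lie, lie_add, lie_add, map_add, map_add, map_add, tangentPart_lie_isotropy hF,
      tangentPart_lie_isotropy hF, tangentPart_of_isotropy σ _ hF', lie_zero, zero_add,
      tangentPart_of_tangent σ _ hy.1, ← lie_skew (tangentPart σ x) (isotropyPart σ y), map_neg,
      tangentPart_lie_isotropy hF', tangentPart_of_tangent σ _ hx.1]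
    exact add_mem (h.lie_mem_leviTangent hF hy) (add_mem (neg_mem (h.lie_mem_leviTangent hF' hx))
      (h.tangentPart_lie_mem_leviTangent hx hy))

theorem mem_levi {x : 𝔤} : x ∈ h.levi ↔ tangentPart σ x ∈ leviTangent σ G := Iff.rfl

theorem isotropy_le_levi {F : 𝔤} (hF : F ∈ isotropy σ) : F ∈ h.levi := by
  rw [mem_levi, tangentPart_of_isotropy σ F hF]
  exact zero_mem _

theorem leviTangent_le_levi {x : 𝔤} (hx : x ∈ leviTangent σ G) : x ∈ h.levi := by
  rwa [mem_levi, tangentPart_of_tangent σ x hx.1]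

theorem mem_leviTangent_of_mem_levi {x : 𝔤} (hx : x ∈ h.levi) (hxV : x ∈ tangent σ) :
    x ∈ leviTangent σ G := by
  rwa [mem_levi, tangentPart_of_tangent σ x hxV] at hx

theorem sigma_mem_levi {x : 𝔤} (hx : x ∈ h.levi) : σ x ∈ h.levi := by
  rw [mem_levi] at hx ⊢
  have h1 : tangentPart σ (σ x) = σ (tangentPart σ x) := by
    simp only [tangentPart_apply, map_smul, map_sub]
  rw [h1]
  exact h.sigma_mem_leviTangent hx

theorem eq_zero_of_mem_levi {x : 𝔤} (hx : x ∈ h.levi) (hr : x ∈ killingRadical 𝔤) : x = 0 :=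
  h.eq_zero_of_mem_leviTangent (h.mem_leviTangent_of_mem_levi hx (h.rad_le_tangent hr)) hr

/-- The Levi factor is the `G`-orthogonal complement of the radical, and projecting along the
radical is a homomorphism onto it, so it is a model of the quotient. -/
theorem isKilling_levi : LieAlgebra.IsKilling ℝ h.levi := by
  obtain ⟨P, hP, hP'⟩ := h.inner.exists_proj (killingRadical 𝔤).toSubmodule
  have hPL : ∀ x, x - P x ∈ h.levi := by
    intro x
    have h1 := h.tangentPart_mem (x - P x)
    refine h.mem_levi.mpr (h.mem_leviTangent.mpr ⟨h1, fun y hy => ?_⟩)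
    rw [← hP' x y hy]
    conv_rhs => rw [← isotropyPart_add_tangentPart (σ := σ) (x - P x)]
    rw [map_add, LinearMap.add_apply,
      form_isotropy_tangent h.sigma (h.isotropyPart_mem _) (h.rad_le_tangent hy), zero_add]
  let π : 𝔤 →ₗ⁅ℝ⁆ h.levi :=
    { (LinearMap.id - P).codRestrict h.levi.toSubmodule hPL with
      map_lie' := fun {x y} => Subtype.ext (by
        change ⁅x, y⁆ - P ⁅x, y⁆ = ⁅x - P x, y - P y⁆
        rw [← sub_eq_zero]
        refine h.eq_zero_of_mem_levi (sub_mem (hPL _) (h.levi.lie_mem (hPL x) (hPL y))) ?_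
        have h1 : ⁅x, y⁆ - P ⁅x, y⁆ - ⁅x - P x, y - P y⁆ =
            ⁅P x, y⁆ + ⁅x - P x, P y⁆ - P ⁅x, y⁆ := by
          rw [lie_sub, sub_lie, sub_lie]
          abel
        rw [h1]
        exact sub_mem (add_mem (lie_mem_left ℝ 𝔤 _ _ _ (hP x)) (lie_mem_right ℝ 𝔤 _ _ _ (hP y)))
          (hP _)) }
  have hπ : ∀ x, (π x : 𝔤) = x - P x := fun x => rfl
  refine h.isKilling_quotient (π := π) (fun x => ⟨x, Subtype.ext ?_⟩) fun x => ?_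
  · rw [hπ, sub_eq_self]
    refine h.eq_zero_of_mem_levi ?_ (hP x)
    have := sub_mem x.2 (hPL x)
    rwa [sub_sub_cancel] at this
  · rw [← ZeroMemClass.coe_eq_zero, hπ, sub_eq_zero]
    refine ⟨fun h1 => h1 ▸ hP x, fun h1 => sub_eq_zero.mp (h.eq_zero_of_mem_levi (hPL x)
      (sub_mem h1 (hP x)))⟩

end IsTransvectionAlgebra

end

end ThreeSymmetric

namespace ThreeSymmetric

noncomputable section

attribute [local instance 100] LieRing.ofAssociativeRing

/-! ## The decomposition of the radical -/

variable {𝔤 : Type*} [LieRing 𝔤] [LieAlgebra ℝ 𝔤]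

/-- The elements of the radical commuting with `Z`. -/
def flatPart (Z : 𝔤) : LieSubalgebra ℝ 𝔤 where
  toSubmodule := (killingRadical 𝔤).toSubmodule ⊓ LinearMap.ker (LieAlgebra.ad ℝ 𝔤 Z)
  lie_mem' := by
    rintro x y ⟨h1, h2⟩ ⟨h1', h2'⟩
    refine ⟨lie_mem_left ℝ 𝔤 (killingRadical 𝔤) _ _ h1, ?_⟩
    change ⁅Z, x⁆ = 0 at h2
    change ⁅Z, y⁆ = 0 at h2'
    change ⁅Z, ⁅x, y⁆⁆ = 0
    rw [leibniz_lie, h2, h2', zero_lie, lie_zero, add_zero]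

theorem mem_flatPart {Z x : 𝔤} : x ∈ flatPart Z ↔ x ∈ killingRadical 𝔤 ∧ ⁅Z, x⁆ = 0 := Iff.rfl

namespace IsTransvectionAlgebra

variable {σ : 𝔤 ≃ₗ⁅ℝ⁆ 𝔤} {G : LinearMap.BilinForm ℝ 𝔤} (h : IsTransvectionAlgebra σ G)
  {Z : 𝔤} (hZ : IsComplexCenter σ Z)
include h

/-- Invariance of `G` under σ gives G(Jx, Jw) = G(x, w) for tangent w; with w = Jy and J² = -1 this
becomes skewness. -/
theorem sigmaJ_skew (x : 𝔤) {y : 𝔤} (hy : y ∈ tangent σ) :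
    G (sigmaJ σ x) y + G x (sigmaJ σ y) = 0 := by
  have h1 : G (sigmaJ σ x) (sigmaJ σ (sigmaJ σ y)) = G x (sigmaJ σ y) := by
    have h2 : ∀ w ∈ tangent σ, G (sigmaJ σ x) (sigmaJ σ w) = G x w := by
      intro w hw
      have e1 := h.sigma x w
      have e2 := h.sigma x (σ w)
      rw [sigma_sigma_of_tangent hw, map_sub, map_neg, e1] at e2
      simp only [sigmaJ_apply, map_smul, map_add, LinearMap.smul_apply, LinearMap.add_apply,
        smul_eq_mul]
      rw [e1]
      have h3 : (1 / √3 : ℝ) * (1 / √3) = 1 / 3 := by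
        rw [div_mul_div_comm, Real.mul_self_sqrt (by norm_num)]
        norm_num
      linear_combination (5 * G x w + 2 * G (σ x) w + 2 * G x (σ w)) * h3 -
        2 / 3 * e2
    exact h2 _ (sigmaJ_mem σ y hy)
  rw [sigmaJ_sigmaJ hy, map_neg] at h1
  rw [← h1, add_neg_cancel]

variable [Module.Finite ℝ 𝔤]

/-- For v in 𝕍 the bracket is a torsion value, and 𝔥 is spanned by brackets of 𝕍 modulo torsion,
which annihilates the radical. In particular the radical is nilpotent of step at most two. -/
theorem lie_mem_radCentralizer (x : 𝔤) {y : 𝔤} (hy : y ∈ killingRadical 𝔤) :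
    ⁅x, y⁆ ∈ radCentralizer 𝔤 := by
  have hV : ∀ v ∈ tangent σ, ∀ y ∈ killingRadical 𝔤, ⁅v, y⁆ ∈ radCentralizer 𝔤 := by
    intro v hv y hy
    rw [← tangentPart_of_tangent σ _ (h.rad_le_tangent (lie_mem_right ℝ 𝔤 _ v _ hy))]
    exact h.tangentPart_lie_mem_radCentralizer hv (h.rad_le_tangent hy)
  rw [← isotropyPart_add_tangentPart (σ := σ) x, add_lie]
  refine add_mem ?_ (hV _ (h.tangentPart_mem x) y hy)
  refine h.isotropy_le (S := (radCentralizer 𝔤).toSubmodule.comap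
    ((LieModule.toEnd ℝ 𝔤 𝔤).toLinearMap.flip y)) (fun v hv w hw => ?_) (h.isotropyPart_mem x)
  change ⁅isotropyPart σ ⁅v, w⁆, y⁆ ∈ radCentralizer 𝔤
  rw [isotropyPart_apply, sub_lie, lie_eq_zero_of_mem_radCentralizer
    (h.tangentPart_lie_mem_radCentralizer hv hw) hy, sub_zero, lie_lie]
  exact sub_mem (hV v hv _ (lie_mem_right ℝ 𝔤 _ _ _ hy)) (hV w hw _ (lie_mem_right ℝ 𝔤 _ _ _ hy))

/-- The Levi factor is generated, up to brackets, by its tangent part. -/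
theorem levi_le {S : Submodule ℝ 𝔤} (hS : ∀ x ∈ leviTangent σ G, x ∈ S)
    (hS' : ∀ x ∈ leviTangent σ G, ∀ y ∈ leviTangent σ G, ⁅x, y⁆ ∈ S) {x : 𝔤} (hx : x ∈ h.levi) :
    x ∈ S := by
  rw [← isotropyPart_add_tangentPart (σ := σ) x]
  refine add_mem (h.isotropy_le (fun v hv w hw => ?_) (h.isotropyPart_mem x)) (hS _ hx)
  obtain ⟨v, hv', a, ha, rfl⟩ := h.exists_leviTangent_add_rad hv
  obtain ⟨w, hw', b, hb, rfl⟩ := h.exists_leviTangent_add_rad hw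
  rw [add_lie, lie_add, map_add, map_add,
    isotropyPart_of_tangent (h.rad_le_tangent (lie_mem_right ℝ 𝔤 _ _ _ hb)),
    isotropyPart_of_tangent (h.rad_le_tangent (lie_mem_left ℝ 𝔤 _ _ _ ha)), add_zero, add_zero,
    isotropyPart_apply]
  exact sub_mem (hS' v hv' w hw') (hS _ (h.tangentPart_lie_mem_leviTangent hv' hw'))

include hZ

/-- The image of the center of the radical under `Z (Z + j)`. -/
def movedPart : LieIdeal ℝ 𝔤 where
  toSubmodule := (((radCentralizer 𝔤).toSubmodule ⊓ (killingRadical 𝔤).toSubmodule).map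
    (centerOp σ Z))
  lie_mem := by
    rintro x _ ⟨a, ⟨haC, har⟩, rfl⟩
    exact ⟨⁅x, a⁆, ⟨lie_mem_right ℝ 𝔤 (radCentralizer 𝔤) _ _ haC,
      lie_mem_right ℝ 𝔤 (killingRadical 𝔤) _ _ har⟩, h.centerOp_lie hZ x haC har⟩

theorem movedPart_le {x : 𝔤} (hx : x ∈ h.movedPart hZ) :
    x ∈ radCentralizer 𝔤 ∧ x ∈ killingRadical 𝔤 := by
  obtain ⟨a, ⟨haC, har⟩, rfl⟩ := hx
  exact ⟨add_mem (lie_mem_right ℝ 𝔤 _ _ _ (lie_mem_right ℝ 𝔤 _ _ _ haC))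
      (h.sigmaJ_mem_radCentralizer (lie_mem_right ℝ 𝔤 _ _ _ haC)),
    add_mem (lie_mem_right ℝ 𝔤 _ _ _ (lie_mem_right ℝ 𝔤 _ _ _ har))
      (h.sigmaJ_mem_rad (lie_mem_right ℝ 𝔤 _ _ _ har))⟩

omit h [Module.Finite ℝ 𝔤] in
theorem sigmaJ_mem_flatPart (h : IsTransvectionAlgebra σ G) {x : 𝔤} (hx : x ∈ flatPart Z) :
    sigmaJ σ x ∈ flatPart Z := by
  rw [mem_flatPart] at hx ⊢
  exact ⟨h.sigmaJ_mem_rad hx.1, by rw [← sigmaJ_lie_isotropy hZ.mem, hx.2, map_zero]⟩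

omit [Module.Finite ℝ 𝔤] in
-- Z and J are commuting skew operators, so Z² and JZ are symmetric.
theorem centerOp_symm {x y : 𝔤} (hy : y ∈ tangent σ) :
    G (centerOp σ Z x) y = G x (centerOp σ Z y) := by
  have hs := h.skew Z hZ.mem
  rw [centerOp_apply, centerOp_apply, map_add, map_add, LinearMap.add_apply,
    eq_neg_of_add_eq_zero_left (hs _ y), eq_neg_of_add_eq_zero_left (hs x _), neg_neg,
    eq_neg_of_add_eq_zero_left (h.sigmaJ_skew _ hy),
    eq_neg_of_add_eq_zero_left (hs x _), neg_neg, sigmaJ_lie_isotropy hZ.mem]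

/-- The moved and the flat part meet trivially. -/
theorem eq_zero_of_lie_center_of_mem_movedPart {x : 𝔤} (hx : x ∈ h.movedPart hZ)
    (h0 : ⁅Z, x⁆ = 0) : x = 0 := by
  have hx' := h.movedPart_le hZ hx
  obtain ⟨a, ⟨haC, har⟩, rfl⟩ := hx
  refine h.inner.eq_zero ?_
  -- With Q = Z(Z + J) and x = Qa, symmetry gives |x|² = G(a, Qx), and Qx = 0 because Zx = 0.
  rw [h.centerOp_symm hZ (h.rad_le_tangent hx'.2), centerOp_apply (σ := σ)
    (centerOp σ Z a), h0, lie_zero, map_zero, add_zero, map_zero]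

/-- Two kernel-image splittings: the skew operator Z splits the radical into ker Z and its image,
which lies in the center of the radical; there the symmetric operator Z(Z + J) splits again, and its
kernel is annihilated by Z. -/
theorem exists_flatPart_add_movedPart {x : 𝔤} (hx : x ∈ killingRadical 𝔤) :
    ∃ y ∈ flatPart Z, ∃ z ∈ h.movedPart hZ, x = y + z := by
  obtain ⟨y, hy, z, hz, hy0, rfl⟩ := h.inner.exists_ker_add_range
    (f := LieAlgebra.ad ℝ 𝔤 Z) (W := (killingRadical 𝔤).toSubmodule)
    (fun x hx => lie_mem_right ℝ 𝔤 (killingRadical 𝔤) _ _ hx) (-1) (fun x _ y _ => by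
      rw [LieAlgebra.ad_apply, LieAlgebra.ad_apply, neg_one_mul]
      exact eq_neg_of_add_eq_zero_left (h.skew Z hZ.mem x y)) hx
  have hA : ∀ a ∈ (radCentralizer 𝔤).toSubmodule ⊓ (killingRadical 𝔤).toSubmodule,
      centerOp σ Z a ∈ (radCentralizer 𝔤).toSubmodule ⊓ (killingRadical 𝔤).toSubmodule :=
    fun a ha => h.movedPart_le hZ ⟨a, ha, rfl⟩
  obtain ⟨b, hb, c, hc, hb0, hbc⟩ := h.inner.exists_ker_add_range hA 1 (fun x _ y hy => by
      rw [one_mul]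
      exact h.centerOp_symm hZ (h.rad_le_tangent hy.2))
    (x := ⁅Z, z⁆) ⟨h.lie_mem_radCentralizer Z hz, lie_mem_right ℝ 𝔤 (killingRadical 𝔤) _ _ hz⟩
  refine ⟨y + b, add_mem ⟨hy, hy0⟩ ⟨hb.2, h.lie_center_eq_zero hZ hb.1 hb.2 hb0⟩,
    centerOp σ Z c, ⟨c, hc, rfl⟩, ?_⟩
  rw [LieAlgebra.ad_apply, hbc, add_assoc]

/-- The Levi factor commutes with the flat part. -/
theorem lie_flatPart {x y : 𝔤} (hx : x ∈ h.levi) (hy : y ∈ flatPart Z) : ⁅x, y⁆ = 0 := by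
  have h1 : ∀ x ∈ leviTangent σ G, ∀ y ∈ flatPart Z, ⁅x, y⁆ = 0 := by
    intro x hx y hy
    obtain ⟨c, hc, d, hd, hcC, hdC, rfl⟩ := h.exists_leviTangent_decomposition hx
    have hb := lie_mem_right ℝ 𝔤 _ d _ hy.1
    have hbV := h.rad_le_tangent hb
    -- As Zy = 0 and Zd = Jd, the vector b = [d, y] satisfies Zb = -Jb. Then Z(Z + J)b = 0 forces Zb
    -- = 0, so Jb = 0 and b = 0.
    have e1 : ⁅Z, ⁅d, y⁆⁆ = -sigmaJ σ ⁅d, y⁆ := by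
      rw [leibniz_lie, h.lie_center_of_mem_radCocentralizer hZ hd hdC, show ⁅Z, y⁆ = 0 from hy.2,
        lie_zero, add_zero, h.sigmaJ_lie_of_mem_rad hd.1 hy.1]
    have e2 : ⁅Z, ⁅d, y⁆⁆ = 0 := by
      refine h.lie_center_eq_zero hZ (h.lie_mem_radCentralizer d hy.1) hb ?_
      rw [centerOp_apply, e1, lie_neg, ← sigmaJ_lie_isotropy hZ.mem, e1, neg_add_cancel]
    have e3 := sigmaJ_sigmaJ hbV
    rw [add_lie, lie_eq_zero_of_mem_radCentralizer hcC hy.1, zero_add, ← neg_eq_zero, ← e3,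
      ← neg_eq_zero, ← map_neg, ← e1, e2, map_zero]
  have h2 : x ∈ LinearMap.ker ((LieModule.toEnd ℝ 𝔤 𝔤).toLinearMap.flip y) := by
    refine h.levi_le (fun x hx => h1 x hx y hy) (fun x hx x' hx' => ?_) hx
    change ⁅⁅x, x'⁆, y⁆ = 0
    rw [lie_lie, h1 x hx y hy, h1 x' hx' y hy, lie_zero, lie_zero, sub_zero]
  exact h2

theorem lie_mem_movedPart {x y : 𝔤} (hx : x ∈ h.levi) (hy : y ∈ killingRadical 𝔤) :
    ⁅x, y⁆ ∈ h.movedPart hZ := by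
  obtain ⟨y, hy', z, hz, rfl⟩ := h.exists_flatPart_add_movedPart hZ hy
  rw [lie_add, h.lie_flatPart hZ hx hy', zero_add]
  exact lie_mem_right ℝ 𝔤 _ _ _ hz

theorem exists_lie_center_of_mem_movedPart {x : 𝔤} (hx : x ∈ h.movedPart hZ) :
    ∃ y ∈ killingRadical 𝔤, x = ⁅Z, y⁆ := by
  obtain ⟨a, ⟨haC, har⟩, rfl⟩ := hx
  refine ⟨⁅Z, a⁆ + sigmaJ σ a, add_mem (lie_mem_right ℝ 𝔤 _ _ _ har) (h.sigmaJ_mem_rad har), ?_⟩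
  rw [lie_add, ← sigmaJ_lie_isotropy hZ.mem, centerOp_apply]

end IsTransvectionAlgebra

end

end ThreeSymmetric

namespace ThreeSymmetric

noncomputable section

attribute [local instance 100] LieRing.ofAssociativeRing

/-! ## The simple ideals of the Levi factor -/

section KillingIdeals

variable {L : Type*} [LieRing L] [LieAlgebra ℝ L] [Module.Finite ℝ L] [LieAlgebra.IsKilling ℝ L]

theorem exists_add_of_isKilling (I : LieIdeal ℝ L) (x : L) :
    ∃ y ∈ I, ∃ z, x = y + z ∧ (∀ w ∈ I, ⁅z, w⁆ = 0) ∧ ∀ w ∈ I, killingForm ℝ L z w = 0 := by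
  have hc := I.isCompl_killingCompl
  have hx : x ∈ (I ⊔ LieIdeal.killingCompl ℝ L I).toSubmodule := by
    rw [hc.sup_eq_top]
    trivial
  rw [LieSubmodule.sup_toSubmodule] at hx
  obtain ⟨y, hy, z, hz, rfl⟩ := Submodule.mem_sup.mp hx
  refine ⟨y, hy, z, rfl, fun w hw => ?_, fun w hw => ?_⟩
  · have h1 : ⁅z, w⁆ ∈ I ⊓ LieIdeal.killingCompl ℝ L I :=
      ⟨lie_mem_right ℝ L _ _ _ hw, lie_mem_left ℝ L _ _ _ hz⟩
    rwa [hc.inf_eq_bot, LieSubmodule.mem_bot] at h1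
  · rw [killingForm_comm]
    exact (LieIdeal.mem_killingCompl ..).mp hz w hw

theorem isKilling_lieIdeal (I : LieIdeal ℝ L) : LieAlgebra.IsKilling ℝ I := by
  constructor
  rw [eq_bot_iff]
  rintro x hx
  rw [LieIdeal.mem_killingCompl] at hx
  rw [LieSubmodule.mem_bot]
  have h1 : (x : L) ∈ LinearMap.ker (killingForm ℝ L) := by
    rw [LinearMap.mem_ker]
    ext w
    obtain ⟨y, hy, z, rfl, -, hz⟩ := exists_add_of_isKilling I w
    have h2 : killingForm ℝ I ⟨y, hy⟩ x = 0 := hx ⟨y, hy⟩ trivial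
    rw [LieIdeal.killingForm_eq] at h2
    have h3 : killingForm ℝ L y x = 0 := h2
    rw [killingForm_comm, map_add, LinearMap.add_apply, h3, hz x x.2, add_zero,
      LinearMap.zero_apply]
  rw [LieAlgebra.IsKilling.ker_killingForm_eq_bot] at h1
  exact Subtype.ext h1

/-- Every ideal is a finite sum of minimal ideals. -/
theorem exists_iSup_atoms (M : LieIdeal ℝ L) : ∃ (r : ℕ) (I : Fin r → LieIdeal ℝ L),
    (∀ i, IsAtom (I i)) ∧ Function.Injective I ∧ ⨆ i, I i = M := by
  have hfin : {J : LieIdeal ℝ L | IsAtom J}.Finite :=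
    WellFoundedGT.finite_of_sSupIndep LieAlgebra.IsSemisimple.sSupIndep_isAtom
  have hfin' : {J : LieIdeal ℝ L | IsAtom J ∧ J ≤ M}.Finite := hfin.subset fun J hJ => hJ.1
  have hsup := LieAlgebra.InvariantForm.atomistic (killingForm ℝ L)
    (LieAlgebra.IsKilling.killingForm_nondegenerate _ _) (LieModule.traceForm_lieInvariant _ _ _)
    (LieModule.traceForm_isSymm ℝ L L).isRefl
    (fun I h1 h2 => h1.1 (LieAlgebra.IsKilling.ideal_eq_bot_of_isLieAbelian I)) M
  have := hfin'.to_subtype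
  obtain ⟨r, ⟨e⟩⟩ := Finite.exists_equiv_fin {J : LieIdeal ℝ L | IsAtom J ∧ J ≤ M}
  refine ⟨r, fun i => (e.symm i : LieIdeal ℝ L), fun i => (e.symm i).2.1,
    Subtype.val_injective.comp e.symm.injective, ?_⟩
  refine Eq.trans ?_ hsup
  rw [sSup_eq_iSup']
  exact e.symm.iSup_comp (g := fun J : {J : LieIdeal ℝ L | IsAtom J ∧ J ≤ M} => (J : LieIdeal ℝ L))

omit [Module.Finite ℝ L] [LieAlgebra.IsKilling ℝ L] in
theorem lie_eq_zero_of_isAtom {I J : LieIdeal ℝ L} (hI : IsAtom I) (hJ : IsAtom J) (hne : I ≠ J)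
    {x y : L} (hx : x ∈ I) (hy : y ∈ J) : ⁅x, y⁆ = 0 := by
  have h1 : ⁅x, y⁆ ∈ I ⊓ J := ⟨lie_mem_left ℝ L _ _ _ hx, lie_mem_right ℝ L _ _ _ hy⟩
  rwa [(hI.disjoint_of_ne hJ hne).eq_bot, LieSubmodule.mem_bot] at h1

theorem eq_zero_of_forall_lie_eq_zero {x : L} (hx : ∀ y : L, ⁅y, x⁆ = 0) : x = 0 := by
  have h1 : x ∈ LieAlgebra.center ℝ L := fun y => hx y
  rwa [LieAlgebra.center_eq_bot, LieSubmodule.mem_bot] at h1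

end KillingIdeals

section Transfer

variable {L L' : Type*} [LieRing L] [LieAlgebra ℝ L] [LieRing L'] [LieAlgebra ℝ L']

theorem isSimple_of_equiv (e : L ≃ₗ⁅ℝ⁆ L') [LieAlgebra.IsSimple ℝ L] : LieAlgebra.IsSimple ℝ L' where
  eq_bot_or_eq_top I := by
    refine (LieAlgebra.IsSimple.eq_bot_or_eq_top (R := ℝ) (I.comap e.toLieHom)).imp
      (fun h => ?_) fun h => ?_
    · rw [eq_bot_iff]
      intro x hx
      have h1 : e.symm x ∈ I.comap e.toLieHom := by
        rw [LieIdeal.mem_comap]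
        change e (e.symm x) ∈ I
        rwa [LieEquiv.apply_symm_apply]
      rw [h, LieSubmodule.mem_bot] at h1
      rw [LieSubmodule.mem_bot, ← e.apply_symm_apply x, h1, map_zero]
    · rw [eq_top_iff]
      intro x _
      have h1 : e.symm x ∈ I.comap e.toLieHom := by
        rw [h]
        trivial
      rw [LieIdeal.mem_comap] at h1
      change e (e.symm x) ∈ I at h1
      rwa [LieEquiv.apply_symm_apply] at h1
  non_abelian h := LieAlgebra.IsSimple.non_abelian ℝ (L := L)
    ((lie_abelian_iff_equiv_lie_abelian e).mpr h)

theorem isSimple_map {f : L →ₗ⁅ℝ⁆ L'} (hf : Function.Injective f) {S : LieSubalgebra ℝ L}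
    (hS : LieAlgebra.IsSimple ℝ S) : LieAlgebra.IsSimple ℝ (S.map f) :=
  isSimple_of_equiv (S.equivMapOfInjective f hf)

theorem isKilling_map {f : L →ₗ⁅ℝ⁆ L'} (hf : Function.Injective f) {S : LieSubalgebra ℝ L}
    (hS : LieAlgebra.IsKilling ℝ S) : LieAlgebra.IsKilling ℝ (S.map f) :=
  LieAlgebra.isKilling_of_equiv (S.equivMapOfInjective f hf)

end Transfer

variable {𝔤 : Type*} [LieRing 𝔤] [LieAlgebra ℝ 𝔤] [Module.Finite ℝ 𝔤]

namespace IsTransvectionAlgebra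

variable {σ : 𝔤 ≃ₗ⁅ℝ⁆ 𝔤} {G : LinearMap.BilinForm ℝ 𝔤} (h : IsTransvectionAlgebra σ G)

/-- `I` is a simple ideal of the Levi factor, orthogonal to the centralizer of the radical. -/
structure IsSimpleFactor (I : LieSubalgebra ℝ 𝔤) : Prop where
  mem_levi : ∀ {x}, x ∈ I → x ∈ h.levi
  lie_mem : ∀ {x y}, x ∈ h.levi → y ∈ I → ⁅x, y⁆ ∈ I
  mem_radCocentralizer : ∀ {x}, x ∈ I → x ∈ radCocentralizer 𝔤
  simple : LieAlgebra.IsSimple ℝ I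
  exists_add : ∀ {x}, x ∈ h.levi → ∃ y ∈ I, ∃ z ∈ h.levi, x = y + z ∧ ∀ w ∈ I, ⁅z, w⁆ = 0

theorem exists_simpleFactors : ∃ (r : ℕ) (I : Fin r → LieSubalgebra ℝ 𝔤),
    (∀ i, h.IsSimpleFactor (I i)) ∧ (∀ i j, i ≠ j → ∀ x ∈ I i, ∀ y ∈ I j, ⁅x, y⁆ = 0) ∧
      ∀ x ∈ h.levi, x ∈ radCocentralizer 𝔤 → x ∈ ⨆ i, (I i).toSubmodule := by
  have := h.isKilling_levi
  obtain ⟨r, I, hI, hinj, hsup⟩ := exists_iSup_atoms ((radCocentralizer 𝔤).comap h.levi.incl)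
  refine ⟨r, fun i => (I i).toLieSubalgebra.map h.levi.incl, fun i => ⟨?_, ?_, ?_, ?_, ?_⟩, ?_, ?_⟩
  · rintro _ ⟨x, -, rfl⟩
    exact x.2
  · rintro x _ hx ⟨y, hy, rfl⟩
    exact ⟨⁅⟨x, hx⟩, y⁆, lie_mem_right ℝ _ (I i) _ _ hy, rfl⟩
  · rintro _ ⟨x, hx, rfl⟩
    have h1 : I i ≤ (radCocentralizer 𝔤).comap h.levi.incl := hsup ▸ le_iSup I i
    exact LieIdeal.mem_comap.mp (h1 hx)
  · exact isSimple_map (f := h.levi.incl) Subtype.val_injective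
      (LieAlgebra.IsSemisimple.isSimple_of_isAtom (I i) (hI i))
  · intro x hx
    obtain ⟨y, hy, z, hyz, hz, -⟩ := exists_add_of_isKilling (I i) ⟨x, hx⟩
    refine ⟨y, ⟨y, hy, rfl⟩, z, z.2, congrArg Subtype.val hyz, ?_⟩
    rintro _ ⟨w, hw, rfl⟩
    exact congrArg Subtype.val (hz w hw)
  · rintro i j hij _ ⟨x, hx, rfl⟩ _ ⟨y, hy, rfl⟩
    exact congrArg Subtype.val (lie_eq_zero_of_isAtom (hI i) (hI j) (hinj.ne hij) hx hy)
  · intro x hx hxC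
    have h1 : (⟨x, hx⟩ : h.levi) ∈ ⨆ i, I i := by
      rw [hsup, LieIdeal.mem_comap]
      exact hxC
    rw [← LieSubmodule.mem_toSubmodule, LieSubmodule.iSup_toSubmodule] at h1
    have h2 : x ∈ (⨆ i, (I i).toSubmodule).map h.levi.toSubmodule.subtype := ⟨_, h1, rfl⟩
    rw [Submodule.map_iSup] at h2
    exact h2

namespace IsSimpleFactor

variable {h} {I : LieSubalgebra ℝ 𝔤} (hI : h.IsSimpleFactor I) {Z : 𝔤} (hZ : IsComplexCenter σ Z)
include hI

theorem eq_zero_or_mem {S : Submodule ℝ 𝔤} (hS : ∀ x ∈ I, ∀ y ∈ I, y ∈ S → ⁅x, y⁆ ∈ S) :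
    (∀ x ∈ I, x ∈ S → x = 0) ∨ ∀ x ∈ I, x ∈ S := by
  have := hI.simple
  let K : LieIdeal ℝ I :=
    { S.comap I.toSubmodule.subtype with
      lie_mem := fun {x y} hy => hS x x.2 y y.2 hy }
  refine (LieAlgebra.IsSimple.eq_bot_or_eq_top (R := ℝ) K).imp
    (fun hK x hx hxS => ?_) fun hK x hx => ?_
  · have h1 : (⟨x, hx⟩ : I) ∈ K := hxS
    rw [hK, LieSubmodule.mem_bot] at h1
    exact congrArg Subtype.val h1
  · have h1 : (⟨x, hx⟩ : I) ∈ K := by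
      rw [hK]
      trivial
    exact h1

theorem exists_ne_zero : ∃ x ∈ I, x ≠ 0 := by
  by_contra! h0
  have := hI.simple
  have : Subsingleton I := ⟨fun x y => Subtype.ext ((h0 x x.2).trans (h0 y y.2).symm)⟩
  exact LieAlgebra.IsSimple.non_abelian ℝ (L := I) inferInstance

theorem tangentPart_mem_leviTangent {x : 𝔤} (hx : x ∈ I) : tangentPart σ x ∈ leviTangent σ G :=
  hI.mem_levi hx

theorem mem_leviTangent {x : 𝔤} (hx : x ∈ I) (hxV : x ∈ tangent σ) : x ∈ leviTangent σ G :=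
  h.mem_leviTangent_of_mem_levi (hI.mem_levi hx) hxV

section

include hZ

theorem lie_center {x : 𝔤} (hx : x ∈ I) : ⁅Z, x⁆ = sigmaJ σ (tangentPart σ x) := by
  conv_lhs => rw [← isotropyPart_add_tangentPart (σ := σ) x]
  rw [lie_add, hZ.lie_isotropy _ (h.isotropyPart_mem x), zero_add,
    h.lie_center_of_mem_radCocentralizer hZ (hI.tangentPart_mem_leviTangent hx)
      (h.tangentPart_mem_radCocentralizer (hI.mem_radCocentralizer hx))]

end

/-- ad Z preserves the ideal and acts on it as J on 𝕍-parts. This is the source of its stability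
under J, both projections and σ. -/
theorem sigmaJ_tangentPart_mem {x : 𝔤} (hx : x ∈ I) : sigmaJ σ (tangentPart σ x) ∈ I := by
  obtain ⟨Z, hZ⟩ := h.exists_isComplexCenter
  rw [← hI.lie_center hZ hx]
  exact hI.lie_mem (h.isotropy_le_levi hZ.mem) hx

theorem tangentPart_mem {x : 𝔤} (hx : x ∈ I) : tangentPart σ x ∈ I := by
  have h1 := hI.sigmaJ_tangentPart_mem (hI.sigmaJ_tangentPart_mem hx)
  rw [tangentPart_of_tangent σ _ (sigmaJ_mem σ _ (h.tangentPart_mem x)),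
    sigmaJ_sigmaJ (h.tangentPart_mem x)] at h1
  exact neg_mem_iff.mp h1

theorem sigmaJ_mem {x : 𝔤} (hx : x ∈ I) (hxV : x ∈ tangent σ) : sigmaJ σ x ∈ I := by
  have h1 := hI.sigmaJ_tangentPart_mem hx
  rwa [tangentPart_of_tangent σ x hxV] at h1

theorem isotropyPart_mem {x : 𝔤} (hx : x ∈ I) : isotropyPart σ x ∈ I := by
  rw [isotropyPart_apply]
  exact sub_mem hx (hI.tangentPart_mem hx)

theorem sigma_mem {x : 𝔤} (hx : x ∈ I) : σ x ∈ I := by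
  have hv := hI.tangentPart_mem hx
  rw [← isotropyPart_add_tangentPart (σ := σ) x, map_add,
    mem_isotropy.mp (h.isotropyPart_mem x)]
  exact add_mem (hI.isotropyPart_mem hx) (sigma_mem_of_sigmaJ_mem (S := I.toSubmodule) hv
    (hI.sigmaJ_mem hv (h.tangentPart_mem x)))

theorem lie_mem_isotropy {x y : 𝔤} (hx : x ∈ I) (hxV : x ∈ tangent σ) (hy : y ∈ I)
    (hyV : y ∈ tangent σ) : ⁅x, y⁆ ∈ isotropy σ := by
  obtain ⟨Z, hZ⟩ := h.exists_isComplexCenter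
  have h1 := h.tangentPart_lie_eq_zero_of_mem_radCocentralizer hZ (hI.mem_leviTangent hx hxV)
    (hI.mem_leviTangent hy hyV) (hI.mem_radCocentralizer hx) (hI.mem_radCocentralizer hy)
  rw [← isotropyPart_add_tangentPart (σ := σ) ⁅x, y⁆, h1, add_zero]
  exact h.isotropyPart_mem _

/-- Elements of the isotropy algebra in `I` commuting with the tangent part of `I` vanish. -/
theorem eq_zero_of_forall_lie {F : 𝔤} (hF : F ∈ I) (hF' : F ∈ isotropy σ)
    (h0 : ∀ x ∈ I, x ∈ tangent σ → ⁅F, x⁆ = 0) : F = 0 := by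
  refine h.eq_zero_of_lie_mem_rad hF' fun v hv => ?_
  obtain ⟨x, hx, a, ha, rfl⟩ := h.exists_leviTangent_add_rad hv
  rw [lie_add]
  refine add_mem ?_ (lie_mem_right ℝ 𝔤 _ _ _ ha)
  obtain ⟨y, hy, z, -, rfl, hz⟩ := hI.exists_add (h.leviTangent_le_levi hx)
  have h1 : ⁅F, y + z⁆ = ⁅F, isotropyPart σ y⁆ := by
    rw [lie_add, ← lie_skew F z, hz F hF, neg_zero, add_zero]
    conv_lhs => rw [← isotropyPart_add_tangentPart (σ := σ) y]
    rw [lie_add, h0 _ (hI.tangentPart_mem hy) (h.tangentPart_mem y), add_zero]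
  rw [h1, disjoint_isotropy_tangent ((isotropy σ).lie_mem hF' (h.isotropyPart_mem y)) (h1 ▸
    lie_isotropy_tangent σ F hF' _ hx.1)]
  exact zero_mem _

theorem exists_tangent_ne_zero : ∃ x ∈ I, x ∈ tangent σ ∧ x ≠ 0 := by
  by_contra! h0
  obtain ⟨x, hx, hx0⟩ := hI.exists_ne_zero
  refine hx0 (hI.eq_zero_of_forall_lie hx ?_ fun y hy hyV => by rw [h0 y hy hyV, lie_zero])
  rw [← isotropyPart_add_tangentPart (σ := σ) x, h0 _ (hI.tangentPart_mem hx) (h.tangentPart_mem x),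
    add_zero]
  exact h.isotropyPart_mem x

/-- The tangent part of `I` together with its brackets spans a nonzero ideal of the simple algebra
`I`, hence everything; this serves as an induction principle. -/
theorem le {S : Submodule ℝ 𝔤} (hS : ∀ x ∈ I, x ∈ tangent σ → x ∈ S)
    (hS' : ∀ x ∈ I, x ∈ tangent σ → ∀ y ∈ I, y ∈ tangent σ → ⁅x, y⁆ ∈ S) {x : 𝔤} (hx : x ∈ I) :
    x ∈ S := by
  set A := I.toSubmodule ⊓ tangent σ with hA
  set B := Submodule.span ℝ {z | ∃ x ∈ A, ∃ y ∈ A, z = ⁅x, y⁆} with hB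
  have hle : A ⊔ B ≤ S := by
    refine sup_le (fun x hx => hS x hx.1 hx.2) (Submodule.span_le.mpr ?_)
    rintro _ ⟨x, hx, y, hy, rfl⟩
    exact hS' x hx.1 hx.2 y hy.1 hy.2
  have hFA : ∀ F ∈ I, F ∈ isotropy σ → ∀ a ∈ A, ⁅F, a⁆ ∈ A := fun F hF hF' a ha =>
    ⟨I.lie_mem hF ha.1, lie_isotropy_tangent σ F hF' a ha.2⟩
  have hBA : ∀ x ∈ I, ∀ b ∈ B, ⁅x, b⁆ ∈ A ⊔ B := by
    intro x hx b hb
    have h1 : b ∈ (A ⊔ B).comap (LieAlgebra.ad ℝ 𝔤 x) := by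
      refine Submodule.span_le.mpr ?_ hb
      rintro _ ⟨a, ha, a', ha', rfl⟩
      change ⁅x, ⁅a, a'⁆⁆ ∈ A ⊔ B
      rw [← isotropyPart_add_tangentPart (σ := σ) x, add_lie]
      refine add_mem ?_ ?_
      · have hF := hFA _ (hI.isotropyPart_mem hx) (h.isotropyPart_mem x)
        rw [leibniz_lie]
        exact Submodule.mem_sup_right (add_mem (Submodule.subset_span ⟨_, hF a ha, _, ha', rfl⟩)
          (Submodule.subset_span ⟨_, ha, _, hF a' ha', rfl⟩))
      · rw [← lie_skew]
        exact Submodule.mem_sup_left (neg_mem (hFA _ (I.lie_mem ha.1 ha'.1)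
          (hI.lie_mem_isotropy ha.1 ha.2 ha'.1 ha'.2) _
          ⟨hI.tangentPart_mem hx, h.tangentPart_mem x⟩))
    exact h1
  have hcl : ∀ x ∈ I, ∀ y ∈ I, y ∈ A ⊔ B → ⁅x, y⁆ ∈ A ⊔ B := by
    intro x hx y _ hy
    obtain ⟨a, ha, b, hb, rfl⟩ := Submodule.mem_sup.mp hy
    rw [lie_add]
    refine add_mem ?_ (hBA x hx b hb)
    rw [← isotropyPart_add_tangentPart (σ := σ) x, add_lie]
    exact add_mem (Submodule.mem_sup_left (hFA _ (hI.isotropyPart_mem hx) (h.isotropyPart_mem x) a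
      ha)) (Submodule.mem_sup_right (Submodule.subset_span
        ⟨_, ⟨hI.tangentPart_mem hx, h.tangentPart_mem x⟩, _, ha, rfl⟩))
  obtain ⟨y, hy, hyV, hy0⟩ := hI.exists_tangent_ne_zero
  exact hle (((hI.eq_zero_or_mem hcl).resolve_left fun h0 =>
    hy0 (h0 y hy (Submodule.mem_sup_left ⟨hy, hyV⟩))) x hx)

end IsSimpleFactor

end IsTransvectionAlgebra

end

end ThreeSymmetric

namespace ThreeSymmetric

noncomputable section

attribute [local instance 100] LieRing.ofAssociativeRing

/-! ## The splitting of a transvection algebra -/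

variable {𝔤 : Type*} [LieRing 𝔤] [LieAlgebra ℝ 𝔤]

/-- The algebraic properties of the semisimple factor. -/
structure IsSemisimplePiece (σ : 𝔤 ≃ₗ⁅ℝ⁆ 𝔤) (L : LieSubalgebra ℝ 𝔤) : Prop where
  killing : LieAlgebra.IsKilling ℝ L
  sigma_mem : ∀ x ∈ L, σ x ∈ L
  eq_zero_of_isotropy : ∀ F ∈ L, F ∈ isotropy σ → (∀ x ∈ L, x ∈ tangent σ → ⁅F, x⁆ = 0) → F = 0
  eq_zero_of_tangent : ∀ x ∈ L, x ∈ tangent σ → (∀ F ∈ L, F ∈ isotropy σ → ⁅F, x⁆ = 0) → x = 0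

/-- The algebraic properties of the factors `V ⋊ L`. -/
structure IsMixedPiece (σ : 𝔤 ≃ₗ⁅ℝ⁆ 𝔤) (S : LieSubalgebra ℝ 𝔤) (V : Submodule ℝ 𝔤)
    (L : LieSubalgebra ℝ 𝔤) : Prop where
  semidirect : IsSemidirect S V L
  le_tangent : ∀ x ∈ V, x ∈ tangent σ
  simple : LieAlgebra.IsSimple ℝ L
  sigma_mem : ∀ x ∈ L, σ x ∈ L
  sigmaJ_mem : ∀ v ∈ V, sigmaJ σ v ∈ V
  lie_mem_isotropy : ∀ x ∈ L, x ∈ tangent σ → ∀ y ∈ L, y ∈ tangent σ → ⁅x, y⁆ ∈ isotropy σ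
  eq_zero_of_isotropy : ∀ F ∈ L, F ∈ isotropy σ → (∀ x ∈ L, x ∈ tangent σ → ⁅F, x⁆ = 0) → F = 0
  faithful : ∀ x ∈ L, (∀ v ∈ V, ⁅x, v⁆ = 0) → x = 0
  exists_center : ∃ z ∈ L, z ∈ isotropy σ ∧ (∀ x ∈ L, x ∈ tangent σ → ⁅z, x⁆ = sigmaJ σ x) ∧
    ∀ v ∈ V, ⁅z, v⁆ = 0 → v = 0

theorem mem_of_mem_iSup {ι : Type*} {A : ι → Submodule ℝ 𝔤} {S : Submodule ℝ 𝔤}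
    (hS : ∀ i, ∀ x ∈ A i, x ∈ S) {x : 𝔤} (hx : x ∈ ⨆ i, A i) : x ∈ S :=
  iSup_le (f := A) hS hx

/-- The elements annihilated by all elements of a set. -/
def annihilator (V : Set 𝔤) : Submodule ℝ 𝔤 where
  carrier := {x | ∀ v ∈ V, ⁅x, v⁆ = 0}
  zero_mem' v _ := zero_lie v
  add_mem' hx hy v hv := by rw [add_lie, hx v hv, hy v hv, add_zero]
  smul_mem' c x hx v hv := by rw [smul_lie, hx v hv, smul_zero]

theorem mem_annihilator {V : Set 𝔤} {x : 𝔤} : x ∈ annihilator V ↔ ∀ v ∈ V, ⁅x, v⁆ = 0 := Iff.rfl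

/-- A family of commuting subalgebras with sum the whole algebra is a direct product as soon as
no nonzero element of the center lies both in a factor and in the sum of the others. -/
theorem isDirectProduct_of_center {ι : Type*} {A : ι → LieSubalgebra ℝ 𝔤}
    (hsup : ⨆ j, (A j).toSubmodule = ⊤) (hlie : ∀ i j, i ≠ j → ∀ x ∈ A i, ∀ y ∈ A j, ⁅x, y⁆ = 0)
    (hc : ∀ i, ∀ x ∈ A i, x ∈ ⨆ j, ⨆ _ : j ≠ i, (A j).toSubmodule → (∀ y : 𝔤, ⁅y, x⁆ = 0) → x = 0) :
    IsDirectProduct ⊤ A where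
  independent i := by
    rw [Submodule.disjoint_def]
    intro x hx hx'
    refine hc i x hx hx' fun y => ?_
    have hy : y ∈ ⨆ j, (A j).toSubmodule := by
      rw [hsup]
      trivial
    refine mem_of_mem_iSup (S := annihilator {x}) (fun j y hy => ?_) hy x rfl
    refine mem_annihilator.mpr fun v hv => ?_
    rw [Set.mem_singleton_iff.mp hv]
    by_cases hj : j = i
    · subst hj
      -- For y in the same factor as x, the other description of x, as a sum over the remaining
      -- factors, is used.
      have h1 : x ∈ LinearMap.ker (LieAlgebra.ad ℝ 𝔤 y) :=
        iSup₂_le (f := fun k (_ : k ≠ j) => (A k).toSubmodule)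
          (fun k hk z hz => hlie j k hk.symm y hy z hz) hx'
      exact h1
    · exact hlie j i hj y hy x hx
  iSup_eq := hsup
  lie_eq_zero := hlie

/-- The subspace of the radical moved by the simple factor `I`. -/
def movedFactor (I : LieSubalgebra ℝ 𝔤) : Submodule ℝ 𝔤 :=
  Submodule.span ℝ {z | ∃ x ∈ I, ∃ y ∈ killingRadical 𝔤, z = ⁅x, y⁆}

theorem lie_mem_movedFactor {I : LieSubalgebra ℝ 𝔤} {x y : 𝔤} (hx : x ∈ I)
    (hy : y ∈ killingRadical 𝔤) : ⁅x, y⁆ ∈ movedFactor I :=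
  Submodule.subset_span ⟨x, hx, y, hy, rfl⟩

theorem mem_of_mem_movedFactor {I : LieSubalgebra ℝ 𝔤} {S : Submodule ℝ 𝔤}
    (hS : ∀ x ∈ I, ∀ y ∈ killingRadical 𝔤, ⁅x, y⁆ ∈ S) {v : 𝔤} (hv : v ∈ movedFactor I) : v ∈ S := by
  refine Submodule.span_le.mpr ?_ hv
  rintro _ ⟨x, hx, y, hy, rfl⟩
  exact hS x hx y hy

theorem movedFactor_le_rad {I : LieSubalgebra ℝ 𝔤} {v : 𝔤} (hv : v ∈ movedFactor I) :
    v ∈ killingRadical 𝔤 :=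
  mem_of_mem_movedFactor (S := (killingRadical 𝔤).toSubmodule)
    (fun x _ _ hy => lie_mem_right ℝ 𝔤 _ x _ hy) hv

variable [Module.Finite ℝ 𝔤]

namespace IsTransvectionAlgebra

variable {σ : 𝔤 ≃ₗ⁅ℝ⁆ 𝔤} {G : LinearMap.BilinForm ℝ 𝔤} (h : IsTransvectionAlgebra σ G)

section

include h

theorem movedFactor_le_radCentralizer {I : LieSubalgebra ℝ 𝔤} {v : 𝔤} (hv : v ∈ movedFactor I) :
    v ∈ radCentralizer 𝔤 :=
  mem_of_mem_movedFactor (S := (radCentralizer 𝔤).toSubmodule)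
    (fun x _ _ hy => h.lie_mem_radCentralizer x hy) hv

theorem exists_levi_add {x : 𝔤} (hx : x ∈ h.levi) : ∃ c ∈ h.levi, ∃ d ∈ h.levi,
    c ∈ radCentralizer 𝔤 ∧ d ∈ radCocentralizer 𝔤 ∧ x = c + d := by
  obtain ⟨p, hp, hp'⟩ := h.exists_centralizer_proj
  have hV := h.tangentPart_mem_radCentralizer (hp x)
  obtain ⟨y, hy, a, ha, hya⟩ := h.exists_span_add_rad (h.tangentPart_mem (p x)) hV
  have hyH : y ∈ leviTangent σ G := by
    refine Submodule.span_le.mpr ?_ hy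
    rintro _ ⟨F, hF, y, hy, _, _, rfl⟩
    exact h.lie_mem_leviTangent hF hy
  have haC : a ∈ radCentralizer 𝔤 := by
    have h1 := sub_mem hV (LieSubmodule.lie_le_left _ _ (span_le_derived hy))
    rwa [hya, add_sub_cancel_left] at h1
  have hc : p x - a ∈ h.levi := by
    rw [mem_levi, map_sub, hya, tangentPart_of_tangent σ a (h.rad_le_tangent ha),
      add_sub_cancel_right]
    exact hyH
  refine ⟨p x - a, hc, x - p x + a, ?_, sub_mem (hp x) haC,
    add_mem (hp' x) (rad_le_radCocentralizer ha), by abel⟩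
  have h1 := sub_mem hx hc
  rwa [sub_sub_eq_add_sub, add_sub_right_comm] at h1

end

namespace IsSimpleFactor

variable {h} {I : LieSubalgebra ℝ 𝔤} (hI : h.IsSimpleFactor I) {Z : 𝔤} (hZ : IsComplexCenter σ Z)
include hI

theorem lie_movedFactor_mem {x v : 𝔤} (hx : x ∈ h.levi) (hv : v ∈ movedFactor I) :
    ⁅x, v⁆ ∈ movedFactor I := by
  refine mem_of_mem_movedFactor (S := (movedFactor I).comap (LieAlgebra.ad ℝ 𝔤 x))
    (fun w hw y hy => ?_) hv
  change ⁅x, ⁅w, y⁆⁆ ∈ movedFactor I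
  rw [leibniz_lie]
  exact add_mem (lie_mem_movedFactor (hI.lie_mem hx hw) hy)
    (lie_mem_movedFactor hw (lie_mem_right ℝ 𝔤 _ _ _ hy))

theorem movedFactor_le {v : 𝔤} (hv : v ∈ movedFactor I) : v ∈ h.movedPart hZ :=
  mem_of_mem_movedFactor (S := (h.movedPart hZ).toSubmodule)
    (fun _ hx _ hy => h.lie_mem_movedPart hZ (hI.mem_levi hx) hy) hv

theorem sigmaJ_mem_movedFactor {v : 𝔤} (hv : v ∈ movedFactor I) : sigmaJ σ v ∈ movedFactor I := by
  refine mem_of_mem_movedFactor (S := (movedFactor I).comap (sigmaJ σ)) (fun x hx y hy => ?_) hv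
  change sigmaJ σ ⁅x, y⁆ ∈ movedFactor I
  rw [← isotropyPart_add_tangentPart (σ := σ) x, add_lie, map_add,
    sigmaJ_lie_isotropy (h.isotropyPart_mem x), ← neg_neg (sigmaJ σ ⁅tangentPart σ x, y⁆),
    ← h.sigmaJ_lie_of_mem_rad (h.tangentPart_mem x) hy]
  exact add_mem (lie_mem_movedFactor (hI.isotropyPart_mem hx) (h.sigmaJ_mem_rad hy))
    (neg_mem (lie_mem_movedFactor (hI.sigmaJ_tangentPart_mem hx) hy))

/-- Commuting simple factors act trivially on the subspaces moved by each other. -/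
theorem lie_movedFactor_eq_zero {I' : LieSubalgebra ℝ 𝔤} (hI' : h.IsSimpleFactor I')
    (hcomm : ∀ x ∈ I, ∀ y ∈ I', ⁅x, y⁆ = 0) {x v : 𝔤} (hx : x ∈ I) (hv : v ∈ movedFactor I') :
    ⁅x, v⁆ = 0 := by
  have h1 : ∀ x ∈ I, x ∈ tangent σ → ∀ w ∈ I', w ∈ tangent σ → ∀ y ∈ killingRadical 𝔤,
      ⁅x, ⁅w, y⁆⁆ = 0 := by
    intro x hx hxV w hw hwV y hy
    -- Replacing x by Jx in this exchange, the left side acquires -J and the right side +J, since J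
    -- passes two antilinear operators; so both sides vanish.
    have e1 : ⁅x, ⁅w, y⁆⁆ = ⁅w, ⁅x, y⁆⁆ := by rw [leibniz_lie, hcomm x hx w hw, zero_lie, zero_add]
    have e2 : ⁅sigmaJ σ x, ⁅w, y⁆⁆ = ⁅w, ⁅sigmaJ σ x, y⁆⁆ := by
      rw [leibniz_lie, hcomm _ (hI.sigmaJ_mem hx hxV) w hw, zero_lie, zero_add]
    have hwy := lie_mem_right ℝ 𝔤 _ w _ hy
    have hxy := lie_mem_right ℝ 𝔤 _ x _ hy
    have hm := h.rad_le_tangent (lie_mem_right ℝ 𝔤 _ x _ hwy)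
    rw [h.sigmaJ_lie_of_mem_rad hxV hwy, h.sigmaJ_lie_of_mem_rad hxV hy, lie_neg,
      h.lie_sigmaJ_of_mem_rad hwV hxy, neg_neg, ← e1, neg_eq_iff_add_eq_zero, ← map_add] at e2
    have e3 := congrArg (sigmaJ σ) e2
    rw [sigmaJ_sigmaJ (add_mem hm hm), map_zero, neg_eq_zero, ← two_smul ℝ] at e3
    exact (smul_eq_zero.mp e3).resolve_left two_ne_zero
  have h2 : ∀ x ∈ I, x ∈ tangent σ → ∀ v ∈ movedFactor I', ⁅x, v⁆ = 0 := by
    intro x hx hxV v hv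
    have h3 : v ∈ LinearMap.ker (LieAlgebra.ad ℝ 𝔤 x) := by
      refine mem_of_mem_movedFactor (fun w hw y hy => ?_) hv
      have h4 : w ∈ LinearMap.ker (LieAlgebra.ad ℝ 𝔤 x ∘ₗ
          (LieModule.toEnd ℝ 𝔤 𝔤).toLinearMap.flip y) := by
        refine hI'.le (fun w hw hwV => h1 x hx hxV w hw hwV y hy)
          (fun w hw hwV w' hw' hwV' => ?_) hw
        change ⁅x, ⁅⁅w, w'⁆, y⁆⁆ = 0
        rw [lie_lie, lie_sub, h1 x hx hxV w hw hwV _ (lie_mem_right ℝ 𝔤 _ _ _ hy),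
          h1 x hx hxV w' hw' hwV' _ (lie_mem_right ℝ 𝔤 _ _ _ hy), sub_zero]
      exact h4
    exact h3
  have h3 : x ∈ annihilator (movedFactor I' : Set 𝔤) := by
    refine hI.le (fun x hx hxV => mem_annihilator.mpr (h2 x hx hxV)) (fun x hx hxV y hy hyV => mem_annihilator.mpr fun v hv => ?_) hx
    rw [lie_lie, h2 y hy hyV v hv, h2 x hx hxV v hv, lie_zero, lie_zero, sub_zero]
  exact h3 v hv

/-- The semidirect product of a simple factor and the subspace moved by it. -/
def mixedFactor : LieSubalgebra ℝ 𝔤 where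
  toSubmodule := movedFactor I ⊔ I.toSubmodule
  lie_mem' := by
    intro a b ha hb
    obtain ⟨v, hv, x, hx, rfl⟩ := Submodule.mem_sup.mp ha
    obtain ⟨w, hw, y, hy, rfl⟩ := Submodule.mem_sup.mp hb
    rw [add_lie, lie_add, lie_add, lie_eq_zero_of_mem_radCentralizer
      (h.movedFactor_le_radCentralizer hv) (movedFactor_le_rad hw), zero_add, ← lie_skew v y]
    exact add_mem (Submodule.mem_sup_left (neg_mem (hI.lie_movedFactor_mem (hI.mem_levi hy) hv)))
      (add_mem (Submodule.mem_sup_left (hI.lie_movedFactor_mem (hI.mem_levi hx) hw))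
        (Submodule.mem_sup_right (I.lie_mem hx hy)))

theorem mem_mixedFactor {x : 𝔤} :
    x ∈ hI.mixedFactor ↔ ∃ v ∈ movedFactor I, ∃ y ∈ I, v + y = x := Submodule.mem_sup

/-- By `hadd`, Z and its `I`-component act identically on `I` and on the moved subspace. So that
component acts as J on tangent vectors and without kernel on V; the latter also prevents `I` from
acting trivially on V, and simplicity gives faithfulness. -/
theorem isMixedPiece (hadd : ∀ x ∈ h.levi, ∃ y ∈ I, ∃ z, x = y + z ∧ (∀ w ∈ I, ⁅z, w⁆ = 0) ∧
    ∀ v ∈ movedFactor I, ⁅z, v⁆ = 0) : IsMixedPiece σ hI.mixedFactor (movedFactor I) I where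
  semidirect :=
    { sup_eq := rfl
      disjoint := Submodule.disjoint_def.mpr fun x hx hx' =>
        h.eq_zero_of_mem_levi (hI.mem_levi hx') (movedFactor_le_rad hx)
      abelian := fun v hv w hw => lie_eq_zero_of_mem_radCentralizer
        (h.movedFactor_le_radCentralizer hv) (movedFactor_le_rad hw)
      lie_mem := fun x hx v hv => hI.lie_movedFactor_mem (hI.mem_levi hx) hv }
  le_tangent x hx := h.rad_le_tangent (movedFactor_le_rad hx)
  simple := hI.simple
  sigma_mem _ := hI.sigma_mem
  sigmaJ_mem _ := hI.sigmaJ_mem_movedFactor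
  lie_mem_isotropy _ hx hxV _ hy hyV := hI.lie_mem_isotropy hx hxV hy hyV
  eq_zero_of_isotropy _ hF hF' := hI.eq_zero_of_forall_lie hF hF'
  faithful := by
    obtain ⟨Z, hZ⟩ := h.exists_isComplexCenter
    refine (hI.eq_zero_or_mem (S := annihilator (movedFactor I : Set 𝔤))
      fun x hx y _ hy v hv => ?_).resolve_right fun h0 => ?_
    · rw [lie_lie, hy v hv, hy _ (hI.lie_movedFactor_mem (hI.mem_levi hx) hv), lie_zero, sub_zero]
    · have h1 : ∀ v ∈ movedFactor I, v = 0 := by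
        intro v hv
        refine h.eq_zero_of_lie_center_of_mem_movedPart hZ (hI.movedFactor_le hZ hv) ?_
        obtain ⟨y, hy, z, hyz, -, hz⟩ := hadd Z (h.isotropy_le_levi hZ.mem)
        rw [hyz, add_lie, hz v hv, h0 y hy v hv, add_zero]
      obtain ⟨x, hx, hx0⟩ := hI.exists_ne_zero
      refine hx0 (h.eq_zero_of_mem_levi (hI.mem_levi hx) (h.mem_rad_of_mem_of_mem
        (mem_radCentralizer.mpr fun y hy => h1 _ (lie_mem_movedFactor hx hy))
        (hI.mem_radCocentralizer hx)))
  exists_center := by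
    obtain ⟨Z, hZ⟩ := h.exists_isComplexCenter
    obtain ⟨y, hy, z, hyz, hz, hz'⟩ := hadd Z (h.isotropy_le_levi hZ.mem)
    refine ⟨y, hy, ?_, fun x hx hxV => ?_, fun v hv h0 => ?_⟩
    · have h1 := hI.lie_center hZ hy
      rw [hyz, add_lie, lie_self, hz y hy, add_zero] at h1
      have h2 := sigmaJ_sigmaJ (h.tangentPart_mem y)
      rw [← h1, map_zero, eq_comm, neg_eq_zero] at h2
      rw [← isotropyPart_add_tangentPart (σ := σ) y, h2, add_zero]
      exact h.isotropyPart_mem y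
    · have h1 := hI.lie_center hZ hx
      rwa [hyz, add_lie, hz x hx, add_zero, tangentPart_of_tangent σ x hxV] at h1
    · refine h.eq_zero_of_lie_center_of_mem_movedPart hZ (hI.movedFactor_le hZ hv) ?_
      rw [hyz, add_lie, h0, hz' v hv, add_zero]

end IsSimpleFactor

/-- The part of the Levi factor which centralizes the radical. -/
def semisimpleFactor : LieSubalgebra ℝ 𝔤 :=
  ((radCentralizer 𝔤).comap h.levi.incl).toLieSubalgebra.map h.levi.incl

theorem mem_semisimpleFactor {x : 𝔤} :
    x ∈ h.semisimpleFactor ↔ x ∈ h.levi ∧ x ∈ radCentralizer 𝔤 := by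
  constructor
  · rintro ⟨y, hy, rfl⟩
    exact ⟨y.2, LieIdeal.mem_comap.mp hy⟩
  · rintro ⟨h1, h2⟩
    exact ⟨⟨x, h1⟩, LieIdeal.mem_comap.mpr h2, rfl⟩

theorem isSemisimplePiece_semisimpleFactor : IsSemisimplePiece σ h.semisimpleFactor where
  killing := by
    have := h.isKilling_levi
    exact isKilling_map (f := h.levi.incl) Subtype.val_injective (isKilling_lieIdeal _)
  sigma_mem x hx := by
    rw [h.mem_semisimpleFactor] at hx ⊢
    exact ⟨h.sigma_mem_levi hx.1, h.sigma_mem_radCentralizer hx.2⟩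
  eq_zero_of_isotropy F hF hF' h0 := by
    have hFC := (h.mem_semisimpleFactor.mp hF).2
    refine h.faithful F hF' fun v hv => ?_
    obtain ⟨x, hx, a, ha, rfl⟩ := h.exists_leviTangent_add_rad hv
    obtain ⟨c, hc, d, hd, hcC, hdC, rfl⟩ := h.exists_leviTangent_decomposition hx
    rw [lie_add, lie_add, lie_eq_zero_of_mem_radCentralizer hFC ha,
      h0 c (h.mem_semisimpleFactor.mpr ⟨h.leviTangent_le_levi hc, hcC⟩) hc.1,
      h.eq_zero_of_mem_leviTangent (h.lie_mem_leviTangent hF' hd) (h.lie_mem_rad hFC hdC),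
      add_zero, add_zero]
  eq_zero_of_tangent x hx hxV h0 := by
    obtain ⟨hxL, hxC⟩ := h.mem_semisimpleFactor.mp hx
    exact h.eq_zero_of_mem_levi hxL (h.mem_rad_of_fixed hxV hxC fun F hF hFC =>
      h0 F (h.mem_semisimpleFactor.mpr ⟨h.isotropy_le_levi hF, hFC⟩) hF)

include h

theorem isNilpotentFactor_flatPart {Z : 𝔤} (hZ : IsComplexCenter σ Z) :
    IsNilpotentFactor σ (flatPart Z) where
  le_tangent _ hx := h.rad_le_tangent hx.1
  map_mem _ hx := sigma_mem_of_sigmaJ_mem (S := (flatPart Z).toSubmodule) hx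
    (h.sigmaJ_mem_flatPart hZ hx)
  two_step _ hx y _ _ hz := lie_eq_zero_of_mem_radCentralizer'
    (h.lie_mem_radCentralizer y hz.1) hx.1

theorem lie_semisimpleFactor {x y : 𝔤} (hx : x ∈ h.semisimpleFactor) (hy : y ∈ h.levi)
    (hyC : y ∈ radCocentralizer 𝔤) : ⁅x, y⁆ = 0 := by
  obtain ⟨hxL, hxC⟩ := h.mem_semisimpleFactor.mp hx
  exact h.eq_zero_of_mem_levi (h.levi.lie_mem hxL hy) (h.lie_mem_rad hxC hyC)

/-- The factors are the part of the Levi factor centralizing the radical, the kernel of Z in the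
radical, and [I, r] ⋊ I for the simple ideals I inside M. -/
theorem exists_splitting : ∃ (r : ℕ) (L₀ N : LieSubalgebra ℝ 𝔤) (S : Fin r → LieSubalgebra ℝ 𝔤)
    (V : Fin r → Submodule ℝ 𝔤) (L : Fin r → LieSubalgebra ℝ 𝔤),
    IsDirectProduct ⊤ (factors L₀ N S) ∧ IsSemisimplePiece σ L₀ ∧ IsNilpotentFactor σ N ∧
      ∀ i, IsMixedPiece σ (S i) (V i) (L i) := by
  obtain ⟨Z, hZ⟩ := h.exists_isComplexCenter
  obtain ⟨r, I, hI, hcomm, hcov⟩ := h.exists_simpleFactors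
  have hmoved : ∀ i j, i ≠ j → ∀ x ∈ I i, ∀ v ∈ movedFactor (I j), ⁅x, v⁆ = 0 :=
    fun i j hij x hx v hv => (hI i).lie_movedFactor_eq_zero (hI j) (hcomm i j hij) hx hv
  have hlie : ∀ i j, i ≠ j → ∀ x ∈ factors h.semisimpleFactor (flatPart Z)
      (fun i => (hI i).mixedFactor) i, ∀ y ∈ factors h.semisimpleFactor (flatPart Z)
      (fun i => (hI i).mixedFactor) j, ⁅x, y⁆ = 0 := by
    have h12 : ∀ x ∈ h.semisimpleFactor, ∀ y ∈ flatPart Z, ⁅x, y⁆ = 0 := fun x hx y hy =>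
      h.lie_flatPart hZ (h.mem_semisimpleFactor.mp hx).1 hy
    have h13 : ∀ x ∈ h.semisimpleFactor, ∀ i, ∀ y ∈ (hI i).mixedFactor, ⁅x, y⁆ = 0 := by
      rintro x hx i _ hy'
      obtain ⟨v, hv, y, hy, rfl⟩ := (hI i).mem_mixedFactor.mp hy'
      rw [lie_add, lie_eq_zero_of_mem_radCentralizer (h.mem_semisimpleFactor.mp hx).2
        (movedFactor_le_rad hv), h.lie_semisimpleFactor hx ((hI i).mem_levi hy)
        ((hI i).mem_radCocentralizer hy), add_zero]
    have h23 : ∀ x ∈ flatPart Z, ∀ i, ∀ y ∈ (hI i).mixedFactor, ⁅x, y⁆ = 0 := by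
      rintro x hx i _ hy'
      obtain ⟨v, hv, y, hy, rfl⟩ := (hI i).mem_mixedFactor.mp hy'
      rw [lie_add, lie_eq_zero_of_mem_radCentralizer' (h.movedFactor_le_radCentralizer hv) hx.1,
        ← lie_skew, h.lie_flatPart hZ ((hI i).mem_levi hy) hx, neg_zero, add_zero]
    have hsk : ∀ x y : 𝔤, ⁅x, y⁆ = 0 → ⁅y, x⁆ = 0 := fun x y h0 => by rw [← lie_skew, h0, neg_zero]
    rintro (_ | _ | i) (_ | _ | j) hij x hx y hy
    · exact absurd rfl hij
    · exact h12 x hx y hy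
    · exact h13 x hx j y hy
    · exact hsk _ _ (h12 y hy x hx)
    · exact absurd rfl hij
    · exact h23 x hx j y hy
    · exact hsk _ _ (h13 y hy i x hx)
    · exact hsk _ _ (h23 y hy i x hx)
    · have hij' : i ≠ j := fun h0 => hij (congrArg _ h0)
      obtain ⟨v, hv, x, hx', rfl⟩ := (hI i).mem_mixedFactor.mp hx
      obtain ⟨w, hw, y, hy', rfl⟩ := (hI j).mem_mixedFactor.mp hy
      rw [add_lie, lie_add, lie_add, lie_eq_zero_of_mem_radCentralizer
        (h.movedFactor_le_radCentralizer hv) (movedFactor_le_rad hw),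
        hsk _ _ (hmoved j i hij'.symm y hy' v hv), hmoved i j hij' x hx' w hw,
        hcomm i j hij' x hx' y hy', add_zero, add_zero]
  have hadd : ∀ i, ∀ x ∈ h.levi, ∃ y ∈ I i, ∃ z, x = y + z ∧ (∀ w ∈ I i, ⁅z, w⁆ = 0) ∧
      ∀ v ∈ movedFactor (I i), ⁅z, v⁆ = 0 := by
    intro i x hx
    have h1 : x ∈ (I i).toSubmodule ⊔
        annihilator (I i : Set 𝔤) ⊓ annihilator (movedFactor (I i) : Set 𝔤) := by
      obtain ⟨c, hc, d, hd, hcC, hdC, rfl⟩ := h.exists_levi_add hx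
      refine add_mem (Submodule.mem_sup_right ⟨fun w hw => ?_, fun v hv => ?_⟩)
        (mem_of_mem_iSup (fun j y hy => ?_) (hcov d hd hdC))
      · exact h.lie_semisimpleFactor (h.mem_semisimpleFactor.mpr ⟨hc, hcC⟩) ((hI i).mem_levi hw)
          ((hI i).mem_radCocentralizer hw)
      · exact lie_eq_zero_of_mem_radCentralizer hcC (movedFactor_le_rad hv)
      · by_cases hj : j = i
        · exact Submodule.mem_sup_left (hj ▸ hy)
        · exact Submodule.mem_sup_right ⟨hcomm j i hj y hy, hmoved j i hj y hy⟩
    obtain ⟨y, hy, z, hz, rfl⟩ := Submodule.mem_sup.mp h1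
    exact ⟨y, hy, z, rfl, hz.1, hz.2⟩
  have hcenter : ∀ x ∈ h.levi, (∀ y ∈ h.levi, ⁅y, x⁆ = 0) → x = 0 := by
    intro x hx h0
    have := h.isKilling_levi
    exact congrArg Subtype.val (eq_zero_of_forall_lie_eq_zero (x := (⟨x, hx⟩ : h.levi))
      fun y => Subtype.ext (h0 y y.2))
  have hle : ∀ j, j ≠ FactorIndex.nilpotent →
      (factors h.semisimpleFactor (flatPart Z) (fun i => (hI i).mixedFactor) j).toSubmodule ≤
        h.levi.toSubmodule ⊔ (h.movedPart hZ).toSubmodule := by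
    rintro (_ | _ | i) hj z hz
    · exact Submodule.mem_sup_left (h.mem_semisimpleFactor.mp hz).1
    · exact absurd rfl hj
    · obtain ⟨v, hv, y, hy, rfl⟩ := (hI i).mem_mixedFactor.mp hz
      exact add_mem (Submodule.mem_sup_right ((hI i).movedFactor_le hZ hv))
        (Submodule.mem_sup_left ((hI i).mem_levi hy))
  refine ⟨r, h.semisimpleFactor, flatPart Z, fun i => (hI i).mixedFactor, fun i => movedFactor (I i),
    I, isDirectProduct_of_center ?_ hlie ?_, h.isSemisimplePiece_semisimpleFactor,
    h.isNilpotentFactor_flatPart hZ, fun i => (hI i).isMixedPiece (hadd i)⟩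
  · rw [eq_top_iff]
    rintro x -
    set A := factors h.semisimpleFactor (flatPart Z) (fun i => (hI i).mixedFactor) with hA
    have hle : ∀ j, ∀ x ∈ A j, x ∈ ⨆ j, (A j).toSubmodule := fun j x hx =>
      le_iSup (fun j => (A j).toSubmodule) j hx
    have hIle : ∀ i, ∀ x ∈ I i, x ∈ ⨆ j, (A j).toSubmodule := fun i x hx =>
      hle (.mixed i) x (Submodule.mem_sup_right hx)
    have hVle : ∀ i, ∀ x ∈ movedFactor (I i), x ∈ ⨆ j, (A j).toSubmodule := fun i x hx =>
      hle (.mixed i) x (Submodule.mem_sup_left hx)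
    have hlevi : ∀ x ∈ h.levi, x ∈ ⨆ j, (A j).toSubmodule := by
      intro x hx
      obtain ⟨c, hc, d, hd, hcC, hdC, rfl⟩ := h.exists_levi_add hx
      exact add_mem (hle .semisimple c (h.mem_semisimpleFactor.mpr ⟨hc, hcC⟩))
        (mem_of_mem_iSup hIle (hcov d hd hdC))
    have hrad : ∀ x ∈ killingRadical 𝔤, x ∈ ⨆ j, (A j).toSubmodule := by
      intro x hx
      obtain ⟨y, hy, z, hz, rfl⟩ := h.exists_flatPart_add_movedPart hZ hx
      refine add_mem (hle .nilpotent y hy) ?_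
      -- The moved part consists of brackets [Z, w] with w in the radical. The C-component of Z
      -- drops out, and the rest of Z is a sum of elements of the simple ideals.
      obtain ⟨w, hw, rfl⟩ := h.exists_lie_center_of_mem_movedPart hZ hz
      obtain ⟨c, hc, d, hd, hcC, hdC, hcd⟩ := h.exists_levi_add (h.isotropy_le_levi hZ.mem)
      rw [hcd, add_lie, lie_eq_zero_of_mem_radCentralizer hcC hw, zero_add]
      exact mem_of_mem_iSup (S := (⨆ j, (A j).toSubmodule).comap
        ((LieModule.toEnd ℝ 𝔤 𝔤).toLinearMap.flip w)) (fun i y hy =>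
          hVle i _ (lie_mem_movedFactor hy hw)) (hcov d hd hdC)
    obtain ⟨y, hy, a, ha, hya⟩ := h.exists_leviTangent_add_rad (h.tangentPart_mem x)
    rw [← isotropyPart_add_tangentPart (σ := σ) x, hya]
    exact add_mem (hlevi _ (h.isotropy_le_levi (h.isotropyPart_mem x)))
      (add_mem (hlevi y (h.leviTangent_le_levi hy)) (hrad a ha))
  · rintro (_ | _ | i) x hx hx' h0
    · exact hcenter x (h.mem_semisimpleFactor.mp hx).1 fun y _ => h0 y
    · obtain ⟨l, hl, v, hv, rfl⟩ := Submodule.mem_sup.mp (iSup₂_le hle hx')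
      have hl0 : l = 0 := by
        refine h.eq_zero_of_mem_levi hl ?_
        have h2 := sub_mem hx.1 (h.movedPart_le hZ hv).2
        rwa [add_sub_cancel_right] at h2
      rw [hl0, zero_add] at hx ⊢
      exact h.eq_zero_of_lie_center_of_mem_movedPart hZ hv hx.2
    · obtain ⟨v, hv, l, hl, rfl⟩ := (hI i).mem_mixedFactor.mp hx
      have hl' := (hI i).mem_levi hl
      have hl0 : l = 0 := by
        refine hcenter l hl' fun y hy => h.eq_zero_of_mem_levi (h.levi.lie_mem hy hl') ?_
        have h1 := h0 y
        rw [lie_add] at h1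
        rw [eq_neg_of_add_eq_zero_right h1]
        exact neg_mem (lie_mem_right ℝ 𝔤 _ _ _ (movedFactor_le_rad hv))
      rw [hl0, add_zero] at h0 ⊢
      exact h.eq_zero_of_lie_center_of_mem_movedPart hZ ((hI i).movedFactor_le hZ hv) (h0 Z)

end IsTransvectionAlgebra

end

end ThreeSymmetric

namespace ThreeSymmetric

noncomputable section

attribute [local instance 100] LieRing.ofAssociativeRing

/-! ## The factors of the splitting -/

variable {𝔤 : Type*} [LieRing 𝔤] [LieAlgebra ℝ 𝔤] {σ : 𝔤 ≃ₗ⁅ℝ⁆ 𝔤}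

section Restrict

variable (hσ : ∀ x, σ (σ (σ x)) = x) {L : LieSubalgebra ℝ 𝔤} (hL : ∀ x ∈ L, σ x ∈ L)

/-- The restriction of an automorphism of order three to an invariant subalgebra. -/
def restrictEquiv : L ≃ₗ⁅ℝ⁆ L where
  toFun x := ⟨σ x, hL x x.2⟩
  invFun x := ⟨σ (σ x), hL _ (hL x x.2)⟩
  map_add' x y := Subtype.ext (map_add σ (x : 𝔤) y)
  map_smul' c x := Subtype.ext (map_smul σ c (x : 𝔤))
  map_lie' {x y} := Subtype.ext (LieEquiv.map_lie σ (x : 𝔤) y)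
  left_inv x := Subtype.ext (hσ x)
  right_inv x := Subtype.ext (hσ x)

theorem mem_isotropy_restrictEquiv {x : L} :
    x ∈ isotropy (restrictEquiv hσ hL) ↔ (x : 𝔤) ∈ isotropy σ := Subtype.ext_iff

theorem mem_tangent_restrictEquiv {x : L} :
    x ∈ tangent (restrictEquiv hσ hL) ↔ (x : 𝔤) ∈ tangent σ := Subtype.ext_iff

end Restrict

theorem isCompl_isotropy_tangent (hσ : ∀ x, σ (σ (σ x)) = x) :
    IsCompl (isotropy σ).toSubmodule (tangent σ) := by
  refine ⟨Submodule.disjoint_def.mpr fun x h1 h2 => disjoint_isotropy_tangent h1 h2, ?_⟩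
  rw [codisjoint_iff, eq_top_iff]
  rintro x -
  rw [← isotropyPart_add_tangentPart (σ := σ) x]
  exact Submodule.add_mem_sup (isotropyPart_mem hσ x) (tangentPart_mem σ hσ x)

theorem injective_adRep {k : LieSubalgebra ℝ 𝔤} {H : Submodule ℝ 𝔤} (h : ∀ F ∈ k, ∀ x ∈ H, ⁅F, x⁆ ∈ H)
    (h0 : ∀ F ∈ k, (∀ x ∈ H, ⁅F, x⁆ = 0) → F = 0) : Function.Injective (adRep k H h) := by
  rw [injective_iff_map_eq_zero]
  intro F hF
  exact Subtype.ext (h0 F F.2 fun x hx =>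
    congrArg Subtype.val (LinearMap.congr_fun hF (⟨x, hx⟩ : H)))

/-- The kernel of the trace is an ideal because it contains all brackets; it cannot be zero, as L is
not abelian. -/
theorem trace_eq_zero_of_isSimple {L V : Type*} [LieRing L] [LieAlgebra ℝ L]
    [LieAlgebra.IsSimple ℝ L] [AddCommGroup V] [Module ℝ V] (ρ : L →ₗ⁅ℝ⁆ Module.End ℝ V) (x : L) :
    LinearMap.trace ℝ V (ρ x) = 0 := by
  have hlie : ∀ x y, LinearMap.trace ℝ V (ρ ⁅x, y⁆) = 0 := fun x y => by
    rw [LieHom.map_lie, LieRing.of_associative_ring_bracket, map_sub, LinearMap.trace_mul_comm,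
      sub_self]
  let K : LieIdeal ℝ L :=
    { LinearMap.ker (LinearMap.trace ℝ V ∘ₗ (ρ : L →ₗ[ℝ] Module.End ℝ V)) with
      lie_mem := fun {x y} _ => hlie x y }
  rcases LieAlgebra.IsSimple.eq_bot_or_eq_top (R := ℝ) K with hK | hK
  · refine absurd ⟨fun x y => ?_⟩ (LieAlgebra.IsSimple.non_abelian ℝ (L := L))
    have h1 : ⁅x, y⁆ ∈ K := hlie x y
    rwa [hK, LieSubmodule.mem_bot] at h1
  · have h1 : x ∈ K := by
      rw [hK]
      trivial
    exact h1

theorem IsInner.restrict {G : LinearMap.BilinForm ℝ 𝔤} (hG : IsInner G) (L : LieSubalgebra ℝ 𝔤) :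
    IsInner (G.compl₁₂ L.toSubmodule.subtype L.toSubmodule.subtype) :=
  ⟨fun v w => hG.symm v w, fun v hv => hG.pos v fun h0 => hv (Subtype.ext h0)⟩

variable [Module.Finite ℝ 𝔤] {G : LinearMap.BilinForm ℝ 𝔤}

theorem IsSemisimplePiece.isSemisimpleFactor {L : LieSubalgebra ℝ 𝔤} (hL : IsSemisimplePiece σ L)
    (hσ : ∀ x, σ (σ (σ x)) = x) (hG : IsInner G)
    (hs : ∀ F ∈ isotropy σ, ∀ x y, G ⁅F, x⁆ y + G x ⁅F, y⁆ = 0) : IsSemisimpleFactor σ L := by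
  have := hL.killing
  set σL := restrictEquiv hσ hL.sigma_mem with hσL
  have hI : ∀ {x : L}, x ∈ isotropy σL ↔ (x : 𝔤) ∈ isotropy σ :=
    mem_isotropy_restrictEquiv hσ hL.sigma_mem
  have hT : ∀ {x : L}, x ∈ tangent σL ↔ (x : 𝔤) ∈ tangent σ :=
    mem_tangent_restrictEquiv hσ hL.sigma_mem
  have hσL3 : ∀ x, σL (σL (σL x)) = x := fun x => Subtype.ext (hσ x)
  have hfaith : ∀ F ∈ isotropy σL, (∀ x ∈ tangent σL, ⁅F, x⁆ = 0) → F = 0 := fun F hF h0 =>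
    Subtype.ext (hL.eq_zero_of_isotropy F F.2 (hI.mp hF) fun x hx hxV =>
      congrArg Subtype.val (h0 ⟨x, hx⟩ (hT.mpr hxV)))
  refine ⟨inferInstance, σL, fun x => rfl, or_iff_not_imp_left.mpr fun hne => ⟨hσL3, ?_, ?_⟩⟩
  -- If σ is the identity on L there are no nonzero tangent vectors, so faithfulness gives L = 0,
  -- the excluded alternative.
  · by_contra! h1
    refine hne ⟨fun x y => sub_eq_zero.mp (hfaith _ (h1 _) fun z hz => ?_)⟩
    rw [disjoint_isotropy_tangent (mem_isotropy.mpr (h1 z)) hz, lie_zero]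
  · refine isCompactlyEmbedded_adRep _ _ (isCompl_isotropy_tangent hσL3) _ _ (fun F x => ?_)
      (injective_adRep _ hfaith) (fun y hy h0 => ?_) (hG.restrict L)
      fun F hF x y => hs F (hI.mp hF) x y
    · exact Subtype.ext (sigmaJ_lie_isotropy F.2 (x : L)).symm
    · exact Subtype.ext (hL.eq_zero_of_tangent y y.2 (hT.mp hy) fun F hF hF' =>
        congrArg Subtype.val (h0 ⟨F, hF⟩ (hI.mpr hF')))

theorem IsMixedPiece.isMixedFactor {S L : LieSubalgebra ℝ 𝔤} {V : Submodule ℝ 𝔤}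
    (hM : IsMixedPiece σ S V L) (hσ : ∀ x, σ (σ (σ x)) = x) (hG : IsInner G)
    (hs : ∀ F ∈ isotropy σ, ∀ x y, G ⁅F, x⁆ y + G x ⁅F, y⁆ = 0) : IsMixedFactor σ S V L := by
  have := hM.simple
  have : LieAlgebra.HasTrivialRadical ℝ L := inferInstance
  have : LieAlgebra.IsKilling ℝ L := inferInstance
  obtain ⟨z, hz, hzI, hzj, hzV⟩ := hM.exists_center
  let k : LieSubalgebra ℝ L := (isotropy σ).comap L.incl
  let H : Submodule ℝ L := (tangent σ).comap L.toSubmodule.subtype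
  have hk : ∀ {x : L}, x ∈ k ↔ (x : 𝔤) ∈ isotropy σ := Iff.rfl
  have hH : ∀ {x : L}, x ∈ H ↔ (x : 𝔤) ∈ tangent σ := Iff.rfl
  have hkH : ∀ F ∈ k, ∀ x ∈ H, ⁅F, x⁆ ∈ H := fun F hF x hx =>
    lie_isotropy_tangent σ F hF x hx
  have hjL : ∀ x ∈ L, sigmaJ σ x ∈ L := fun x hx =>
    sigmaJ_mem_of_sigma_mem (S := L.toSubmodule) hM.sigma_mem hx
  have hc : IsCompl k.toSubmodule H := by
    refine ⟨Submodule.disjoint_def.mpr fun x h1 h2 =>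
      Subtype.ext (disjoint_isotropy_tangent (hk.mp h1) (hH.mp h2)), ?_⟩
    rw [codisjoint_iff, eq_top_iff]
    rintro x -
    have h1 : x = (⟨isotropyPart σ x, isotropyPart_mem_of_sigma_mem (S := L.toSubmodule)
        hM.sigma_mem x.2⟩ : L) + ⟨tangentPart σ x, tangentPart_mem_of_sigma_mem
          (S := L.toSubmodule) hM.sigma_mem x.2⟩ :=
      Subtype.ext (isotropyPart_add_tangentPart (x : 𝔤)).symm
    rw [h1]
    exact Submodule.add_mem_sup (isotropyPart_mem hσ _) (tangentPart_mem σ hσ _)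
  let JL : Module.End ℝ L := (sigmaJ σ).restrict hjL
  let JH : Module.End ℝ H := JL.restrict fun x hx => ThreeSymmetric.sigmaJ_mem σ x hx
  let JV : Module.End ℝ V := (sigmaJ σ).restrict hM.sigmaJ_mem
  let ρ : L →ₗ⁅ℝ⁆ Module.End ℝ V :=
    { toFun := fun x => (LieAlgebra.ad ℝ 𝔤 x).restrict fun v hv => hM.semidirect.lie_mem x x.2 v hv
      map_add' := fun x y => LinearMap.ext fun v => Subtype.ext (add_lie (x : 𝔤) y (v : 𝔤))
      map_smul' := fun c x => LinearMap.ext fun v => Subtype.ext (smul_lie c (x : 𝔤) (v : 𝔤))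
      map_lie' := fun {x y} => LinearMap.ext fun v => Subtype.ext (lie_lie (x : 𝔤) y (v : 𝔤)) }
  have hρ : ∀ (x : L) (v : V), ((ρ x v : V) : 𝔤) = ⁅(x : 𝔤), (v : 𝔤)⁆ := fun x v => rfl
  have hlie : ∀ x ∈ H, ∀ v : V, ⁅(x : 𝔤), (v : 𝔤)⁆ ∈ tangent σ := fun x _ v =>
    hM.le_tangent _ (hM.semidirect.lie_mem x x.2 v v.2)
  have hV : ∀ v : V, (v : 𝔤) ∈ tangent σ := fun v => hM.le_tangent v v.2
  have hjH : ∀ x ∈ H, ∀ v : V, ⁅sigmaJ σ (x : 𝔤), (v : 𝔤)⁆ = -sigmaJ σ ⁅(x : 𝔤), (v : 𝔤)⁆ := by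
    intro x hx v
    have hx' : (x : 𝔤) ∈ tangent σ := hx
    rw [← tangentPart_of_tangent σ ⁅sigmaJ σ (x : 𝔤), (v : 𝔤)⁆
      (hlie ⟨_, hjL x x.2⟩ (ThreeSymmetric.sigmaJ_mem σ x hx) v),
      tangentPart_lie_sigmaJ_left hx' (hV v),
      tangentPart_of_tangent σ _ (hlie x hx v)]
  have hjV : ∀ x ∈ H, ∀ v : V, ⁅(x : 𝔤), sigmaJ σ (v : 𝔤)⁆ = -sigmaJ σ ⁅(x : 𝔤), (v : 𝔤)⁆ := by
    intro x hx v
    have hx' : (x : 𝔤) ∈ tangent σ := hx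
    rw [← tangentPart_of_tangent σ ⁅(x : 𝔤), sigmaJ σ (v : 𝔤)⁆ (hlie x hx (JV v)),
      tangentPart_lie_sigmaJ_right hx' (hV v), tangentPart_of_tangent σ _ (hlie x hx v)]
  refine ⟨hM.semidirect, hM.le_tangent, hM.simple, ρ, JH, JV, hρ, fun x => rfl, fun v => rfl, ?_⟩
  refine ⟨⟨inferInstance, hc, hkH, fun x hx y hy => hM.lie_mem_isotropy x x.2 hx y y.2 hy,
    fun x => Subtype.ext (Subtype.ext (sigmaJ_sigmaJ x.2)), fun F x => Subtype.ext (Subtype.ext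
      (sigmaJ_lie_isotropy F.2 _).symm), fun x y => Subtype.ext ?_, ?_⟩,
    fun v => Subtype.ext (sigmaJ_sigmaJ (hV v)), ?_, trace_eq_zero_of_isSimple ρ, fun v hv => ?_,
    fun F hF v => Subtype.ext (sigmaJ_lie_isotropy hF _).symm, fun x hx v => Subtype.ext (hjV x hx v),
    fun x v => Subtype.ext ((hjH x x.2 v).trans (hjV x x.2 v).symm)⟩
  · have h1 := isotropyPart_lie_sigmaJ (σ := σ) x.2 y.2
    have e1 := hM.lie_mem_isotropy _ (hjL _ x.1.2) (ThreeSymmetric.sigmaJ_mem σ _ x.2) _ (hjL _ y.1.2)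
      (ThreeSymmetric.sigmaJ_mem σ _ y.2)
    have e2 := hM.lie_mem_isotropy _ x.1.2 x.2 _ y.1.2 y.2
    exact (isotropyPart_of_isotropy e1).symm.trans (h1.trans (isotropyPart_of_isotropy e2))
  · refine isCompactlyEmbedded_adRep k H hc hkH JH (fun F x => ?_) (injective_adRep _ ?_)
      (fun y hy h0 => ?_) (hG.restrict L) fun F hF x y => hs F hF x y
    · exact Subtype.ext (Subtype.ext (sigmaJ_lie_isotropy F.2 _).symm)
    · exact fun F hF h0 => Subtype.ext (hM.eq_zero_of_isotropy F F.2 hF fun x hx hxV =>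
        congrArg Subtype.val (h0 ⟨x, hx⟩ hxV))
    · have h1 := hzj y y.2 hy
      have h2 : ⁅z, (y : 𝔤)⁆ = 0 := congrArg Subtype.val (h0 ⟨z, hz⟩ hzI)
      have h3 := sigmaJ_sigmaJ (hH.mp hy)
      rw [← h1, h2, map_zero, eq_comm, neg_eq_zero] at h3
      exact Subtype.ext h3
  · rw [injective_iff_map_eq_zero]
    exact fun x hx => Subtype.ext (hM.faithful x x.2 fun v hv =>
      congrArg Subtype.val (LinearMap.congr_fun hx (⟨v, hv⟩ : V)))
  · exact Subtype.ext (hzV v v.2 (congrArg Subtype.val (hv ⟨z, hz⟩)))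

end

end ThreeSymmetric

namespace ThreeSymmetric

noncomputable section

attribute [local instance 100] LieRing.ofAssociativeRing

/-! ## The transvection algebra of a Riemannian 3-symmetric Lie algebra -/

variable {𝔤 : Type*} [LieRing 𝔤] [LieAlgebra ℝ 𝔤] {σ : 𝔤 ≃ₗ⁅ℝ⁆ 𝔤}

theorem tangentPart_sigma (x : 𝔤) :
    tangentPart σ (σ x) = σ (tangentPart σ x) := by
  simp only [tangentPart_apply, map_smul, map_sub]

theorem isotropyPart_sigma (hσ : ∀ x, σ (σ (σ x)) = x) (x : 𝔤) :
    isotropyPart σ (σ x) = isotropyPart σ x := by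
  simp only [isotropyPart_apply, tangentPart_apply, hσ]
  module

theorem J_J (v : tangent σ) : J σ (J σ v) = -v := Subtype.ext (sigmaJ_sigmaJ v.2)

/-- Averaging over j: since j² = -1, adding the pullback by j suffices, and `K` commutes with j. -/
theorem IsInner.exists_hermitian {M : Type*} [AddCommGroup M] [Module ℝ M]
    {g : LinearMap.BilinForm ℝ M} (hg : IsInner g) {K : Subgroup (M ≃ₗ[ℝ] M)} {j : Module.End ℝ M}
    (hj : ∀ v, j (j v) = -v) (hK : ∀ a ∈ K, ∀ v w, g (a v) (a w) = g v w)
    (hKj : ∀ a ∈ K, ∀ v : M, a (j v) = j (a v)) :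
    ∃ g' : LinearMap.BilinForm ℝ M, IsInner g' ∧ (∀ a ∈ K, ∀ v w, g' (a v) (a w) = g' v w) ∧
      ∀ v w, g' (j v) (j w) = g' v w := by
  have happ : ∀ v w, (g + g.compl₁₂ j j) v w = g v w + g (j v) (j w) := fun v w => rfl
  refine ⟨g + g.compl₁₂ j j, ⟨fun v w => ?_, fun v hv => ?_⟩, fun a ha v w => ?_, fun v w => ?_⟩
  · rw [happ, happ, hg.symm v, hg.symm (j v)]
  · rw [happ]
    exact add_pos_of_pos_of_nonneg (hg.pos v hv) (hg.nonneg _)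
  · rw [happ, happ, hK a ha, ← hKj a ha, ← hKj a ha, hK a ha]
  · rw [happ, happ, hj, hj, map_neg, map_neg, LinearMap.neg_apply, neg_neg, add_comm]

variable [Module.Finite ℝ 𝔤]

theorem Integrates.exists_invariantMetric {K : Subgroup (tangent σ ≃ₗ[ℝ] tangent σ)}
    (hK : Integrates (isotropyRep σ) (J σ) K) : ∃ g, IsInvariantMetric σ K g := by
  obtain ⟨g, hg, hgK⟩ := exists_invariant_inner K ((isCompact_matrixSet_iff K).mp hK.isCompact)
  obtain ⟨g', hg', h1, h2⟩ := hg.exists_hermitian J_J hgK hK.complexLinear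
  exact ⟨g', hg'.symm, hg'.pos, h1, h2⟩

/-- A Riemannian 3-symmetric Lie algebra has an inner product invariant under `σ` and the isotropy
algebra. -/
theorem Integrates.exists_form (hσ : ∀ x, σ (σ (σ x)) = x)
    {K : Subgroup (tangent σ ≃ₗ[ℝ] tangent σ)} (hK : Integrates (isotropyRep σ) (J σ) K) :
    ∃ G : LinearMap.BilinForm ℝ 𝔤, IsInner G ∧ (∀ x y, G (σ x) (σ y) = G x y) ∧
      ∀ F ∈ isotropy σ, ∀ x y, G ⁅F, x⁆ y + G x ⁅F, y⁆ = 0 := by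
  obtain ⟨g, hg⟩ := hK.exists_invariantMetric
  have hin : IsInner g := ⟨hg.symm, hg.pos⟩
  let p : 𝔤 →ₗ[ℝ] tangent σ := (tangentPart σ).codRestrict _ (tangentPart_mem σ hσ)
  let q : 𝔤 →ₗ[ℝ] isotropy σ :=
    (isotropyPart σ).codRestrict (isotropy σ).toSubmodule (isotropyPart_mem hσ)
  let R : 𝔤 →ₗ[ℝ] Module.End ℝ (tangent σ) := (isotropyRep σ).toLinearMap ∘ₗ q
  have hR : ∀ x v w, g (R x v) w + g v (R x w) = 0 := fun x => hK.skew hg.invariant (q x)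
  -- The metric on 𝕍 plus minus the trace form of the isotropy representation on 𝔥, which is
  -- positive because the representation is skew and faithful.
  let G : LinearMap.BilinForm ℝ 𝔤 := g.compl₁₂ p p -
    ((LinearMap.mul ℝ (Module.End ℝ (tangent σ))).compr₂ (LinearMap.trace ℝ _)).compl₁₂ R R
  have hG : ∀ x y, G x y = g (p x) (p y) - LinearMap.trace ℝ _ (R x * R y) := fun x y => rfl
  have hcross : ∀ v w, g (J σ v) w = -g v (J σ w) := fun v w => by
    rw [← hg.hermitian, J_J, map_neg, LinearMap.neg_apply]
  refine ⟨G, ⟨fun x y => ?_, fun x hx => ?_⟩, fun x y => ?_, fun F hF x y => ?_⟩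
  · rw [hG, hG, hg.symm, LinearMap.trace_mul_comm]
  · have h1 : LinearMap.trace ℝ _ (R x * R x) ≤ 0 := trace_mul_self_nonpos hin (hR x)
    have h2 := hin.nonneg (p x)
    rw [hG]
    by_contra hle
    have hp : p x = 0 := hin.eq_zero (by linarith)
    have hRx : R x = 0 := eq_zero_of_trace_mul_self_eq_zero hin (hR x)
      (by change LinearMap.trace ℝ _ (R x * R x) = 0; linarith)
    have hq : q x = 0 := hK.faithful (hRx.trans (map_zero _).symm)
    refine hx ?_
    rw [← isotropyPart_add_tangentPart (σ := σ) x]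
    exact (congrArg₂ (· + ·) (congrArg Subtype.val hq) (congrArg Subtype.val hp)).trans
      (add_zero (0 : 𝔤))
  · have hq : q (σ x) = q x := Subtype.ext (isotropyPart_sigma hσ x)
    have hq' : q (σ y) = q y := Subtype.ext (isotropyPart_sigma hσ y)
    have hp : ∀ x, p (σ x) = (-(1 / 2) : ℝ) • p x + (√3 / 2) • J σ (p x) := fun x =>
      Subtype.ext ((tangentPart_sigma x).trans (sigma_eq_sigmaJ _))
    have h3 : √3 * √3 = 3 := Real.mul_self_sqrt (by norm_num)
    rw [hG, hG, hp, hp]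
    simp only [R, LinearMap.comp_apply, hq, hq', map_add, map_smul, LinearMap.add_apply,
      LinearMap.smul_apply, hg.hermitian, hcross, smul_eq_mul]
    linear_combination (1 / 4 : ℝ) * g (p x) (p y) * h3
  · have hp : ∀ x, p ⁅F, x⁆ = isotropyRep σ ⟨F, hF⟩ (p x) := fun x =>
      Subtype.ext (tangentPart_lie_isotropy hF x)
    have hq : ∀ x, q ⁅F, x⁆ = ⁅(⟨F, hF⟩ : isotropy σ), q x⁆ := fun x =>
      Subtype.ext (isotropyPart_lie_isotropy hF x)
    have hRF : ∀ x, R ⁅F, x⁆ = isotropyRep σ ⟨F, hF⟩ * R x - R x * isotropyRep σ ⟨F, hF⟩ := fun x =>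
      (congrArg (isotropyRep σ) (hq x)).trans (LieHom.map_lie _ _ _)
    have h1 := hK.skew hg.invariant ⟨F, hF⟩ (p x) (p y)
    have h2 := LinearMap.trace_mul_comm ℝ (isotropyRep σ ⟨F, hF⟩) (R x * R y)
    rw [hG, hG, hp, hp, hRF, hRF, sub_mul, mul_sub, map_sub, map_sub, mul_assoc, mul_assoc]
    rw [mul_assoc] at h2
    linarith

/-- The transvection algebra as a subalgebra. -/
def transvectionSubalgebra (σ : 𝔤 ≃ₗ⁅ℝ⁆ 𝔤) (hσ : ∀ x, σ (σ (σ x)) = x) : LieSubalgebra ℝ 𝔤 :=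
  { transvection σ with
    lie_mem' := by
      have hT : ∀ x ∈ tangent σ, x ∈ transvection σ := fun x hx => Submodule.mem_sup_left hx
      have hTT : ∀ x ∈ tangent σ, ∀ y ∈ tangent σ, ⁅x, y⁆ ∈ transvection σ := fun x hx y hy =>
        Submodule.mem_sup_right (Submodule.subset_span ⟨x, hx, y, hy, rfl⟩)
      have hle : ∀ {S : Submodule ℝ 𝔤}, (∀ x ∈ tangent σ, x ∈ S) →
          (∀ x ∈ tangent σ, ∀ y ∈ tangent σ, ⁅x, y⁆ ∈ S) → ∀ x ∈ transvection σ, x ∈ S := by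
        intro S h1 h2 x hx
        refine sup_le (c := S) h1 (Submodule.span_le.mpr ?_) hx
        rintro _ ⟨v, hv, w, hw, rfl⟩
        exact h2 v hv w hw
      have key : ∀ v ∈ tangent σ, ∀ y ∈ transvection σ, ⁅v, y⁆ ∈ transvection σ := by
        intro v hv
        refine hle (S := (transvection σ).comap (LieAlgebra.ad ℝ 𝔤 v)) (hTT v hv)
          fun x hx y hy => ?_
        change ⁅v, ⁅x, y⁆⁆ ∈ transvection σ
        rw [← isotropyPart_add_tangentPart (σ := σ) ⁅x, y⁆, lie_add, ← lie_skew]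
        exact add_mem (neg_mem (hT _ (lie_isotropy_tangent σ _ (isotropyPart_mem hσ _) v hv)))
          (hTT v hv _ (tangentPart_mem σ hσ _))
      intro x y hx hy
      refine hle (S := (transvection σ).comap ((LieModule.toEnd ℝ 𝔤 𝔤).toLinearMap.flip y))
        (fun v hv => key v hv y hy) (fun v hv w hw => ?_) x hx
      change ⁅⁅v, w⁆, y⁆ ∈ transvection σ
      rw [lie_lie]
      exact sub_mem (key v hv _ (key w hw y hy)) (key w hw _ (key v hv y hy)) }

omit [Module.Finite ℝ 𝔤] in
theorem sigma_mem_transvectionSubalgebra {hσ : ∀ x, σ (σ (σ x)) = x} :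
    ∀ x ∈ transvectionSubalgebra σ hσ, σ x ∈ transvectionSubalgebra σ hσ := by
  intro x hx
  refine sup_le (c := (transvection σ).comap (σ : 𝔤 →ₗ[ℝ] 𝔤)) (fun y hy => ?_)
    (Submodule.span_le.mpr ?_) hx
  · exact Submodule.mem_sup_left (sigma_mem_tangent hy)
  · rintro _ ⟨v, hv, w, hw, rfl⟩
    change σ ⁅v, w⁆ ∈ transvection σ
    rw [LieEquiv.map_lie]
    exact Submodule.mem_sup_right (Submodule.subset_span ⟨_, sigma_mem_tangent hv, _,
      sigma_mem_tangent hw, rfl⟩)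

omit [Module.Finite ℝ 𝔤] in
theorem isTransvectionAlgebra_restrictEquiv (hσ : ∀ x, σ (σ (σ x)) = x)
    {G : LinearMap.BilinForm ℝ 𝔤} (hG : IsInner G) (hGσ : ∀ x y, G (σ x) (σ y) = G x y)
    (hs : ∀ F ∈ isotropy σ, ∀ x y, G ⁅F, x⁆ y + G x ⁅F, y⁆ = 0)
    (hf : Function.Injective (isotropyRep σ)) :
    IsTransvectionAlgebra
      (restrictEquiv hσ (sigma_mem_transvectionSubalgebra (σ := σ) (hσ := hσ)))
      (G.compl₁₂ (transvectionSubalgebra σ hσ).toSubmodule.subtype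
        (transvectionSubalgebra σ hσ).toSubmodule.subtype) := by
  set τ := restrictEquiv hσ (sigma_mem_transvectionSubalgebra (σ := σ) (hσ := hσ)) with hτ
  have hI : ∀ {x : transvectionSubalgebra σ hσ}, x ∈ isotropy τ ↔ (x : 𝔤) ∈ isotropy σ :=
    mem_isotropy_restrictEquiv hσ _
  have hT : ∀ {x : transvectionSubalgebra σ hσ}, x ∈ tangent τ ↔ (x : 𝔤) ∈ tangent σ :=
    mem_tangent_restrictEquiv hσ _
  have hVT : ∀ v ∈ tangent σ, v ∈ transvectionSubalgebra σ hσ := fun v hv =>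
    Submodule.mem_sup_left hv
  refine ⟨fun x => Subtype.ext (hσ x), hG.restrict _, fun x y => hGσ x y,
    fun F hF x y => hs F (hI.mp hF) x y, fun F hF h0 => ?_, ?_⟩
  · have h1 : (⟨F, hI.mp hF⟩ : isotropy σ) = 0 := by
      refine hf ?_
      rw [map_zero]
      refine LinearMap.ext fun v => Subtype.ext ?_
      have h2 : ⁅(F : 𝔤), (v : 𝔤)⁆ = 0 := congrArg Subtype.val (h0 ⟨v, hVT v v.2⟩ (hT.mpr v.2))
      exact h2
    have h2 : (F : 𝔤) = 0 := congrArg Subtype.val h1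
    exact Subtype.ext h2
  · rw [eq_top_iff]
    rintro ⟨x, hx⟩ -
    have h1 : x ∈ (transvection τ).map (transvectionSubalgebra σ hσ).toSubmodule.subtype := by
      refine sup_le (c := (transvection τ).map (transvectionSubalgebra σ hσ).toSubmodule.subtype)
        (fun y hy => ?_) (Submodule.span_le.mpr ?_) hx
      · exact ⟨⟨y, hVT y hy⟩, Submodule.mem_sup_left (hT.mpr hy), rfl⟩
      · rintro _ ⟨v, hv, w, hw, rfl⟩
        exact ⟨⁅⟨v, hVT v hv⟩, ⟨w, hVT w hw⟩⁆, Submodule.mem_sup_right (Submodule.subset_span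
          ⟨_, hT.mpr hv, _, hT.mpr hw, rfl⟩), rfl⟩
    obtain ⟨y, hy, hyx⟩ := h1
    rwa [show (⟨x, hx⟩ : transvectionSubalgebra σ hσ) = y from Subtype.ext hyx.symm]

end

end ThreeSymmetric

namespace ThreeSymmetric

noncomputable section

attribute [local instance 100] LieRing.ofAssociativeRing

/-! ## Images of a splitting -/

section Transport

variable {𝔤 𝔤' : Type*} [LieRing 𝔤] [LieAlgebra ℝ 𝔤] [LieRing 𝔤'] [LieAlgebra ℝ 𝔤']
  {σ : 𝔤 ≃ₗ⁅ℝ⁆ 𝔤} {τ : 𝔤' ≃ₗ⁅ℝ⁆ 𝔤'} {f : 𝔤' →ₗ⁅ℝ⁆ 𝔤}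

theorem map_mem_isotropy_iff (hf : Function.Injective f) (hfσ : ∀ x, f (τ x) = σ (f x)) {x : 𝔤'} :
    f x ∈ isotropy σ ↔ x ∈ isotropy τ := by
  rw [mem_isotropy, mem_isotropy, ← hfσ, hf.eq_iff]

theorem map_mem_tangent_iff (hf : Function.Injective f) (hfσ : ∀ x, f (τ x) = σ (f x)) {x : 𝔤'} :
    f x ∈ tangent σ ↔ x ∈ tangent τ := by
  rw [mem_tangent, mem_tangent, ← hfσ, ← hfσ, ← map_add, ← map_add, map_eq_zero_iff f hf]

theorem map_sigmaJ (hfσ : ∀ x, f (τ x) = σ (f x)) (x : 𝔤') : f (sigmaJ τ x) = sigmaJ σ (f x) := by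
  rw [sigmaJ_apply, sigmaJ_apply, map_smul, map_add, map_smul, hfσ]

theorem IsSemisimplePiece.map [Module.Finite ℝ 𝔤'] (hf : Function.Injective f)
    (hfσ : ∀ x, f (τ x) = σ (f x)) {L : LieSubalgebra ℝ 𝔤'} (hL : IsSemisimplePiece τ L) :
    IsSemisimplePiece σ (L.map f) where
  killing := isKilling_map hf hL.killing
  sigma_mem := by
    rintro _ ⟨x, hx, rfl⟩
    exact ⟨τ x, hL.sigma_mem x hx, hfσ x⟩
  eq_zero_of_isotropy := by
    rintro _ ⟨F, hF, rfl⟩ hF' h0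
    have h1 : F = 0 := hL.eq_zero_of_isotropy F hF ((map_mem_isotropy_iff hf hfσ).mp hF')
      fun x hx hxV => hf ((LieHom.map_lie f F x).trans ((h0 (f x) ⟨x, hx, rfl⟩
        ((map_mem_tangent_iff hf hfσ).mpr hxV)).trans (map_zero f).symm))
    exact (congrArg f h1).trans (map_zero f)
  eq_zero_of_tangent := by
    rintro _ ⟨x, hx, rfl⟩ hx' h0
    have h1 : x = 0 := hL.eq_zero_of_tangent x hx ((map_mem_tangent_iff hf hfσ).mp hx')
      fun F hF hFI => hf ((LieHom.map_lie f F x).trans ((h0 (f F) ⟨F, hF, rfl⟩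
        ((map_mem_isotropy_iff hf hfσ).mpr hFI)).trans (map_zero f).symm))
    exact (congrArg f h1).trans (map_zero f)

theorem IsNilpotentFactor.map (hf : Function.Injective f)
    (hfσ : ∀ x, f (τ x) = σ (f x)) {N : LieSubalgebra ℝ 𝔤'} (hN : IsNilpotentFactor τ N) :
    IsNilpotentFactor σ (N.map f) where
  le_tangent := by
    rintro _ ⟨x, hx, rfl⟩
    exact (map_mem_tangent_iff hf hfσ).mpr (hN.le_tangent hx)
  map_mem := by
    rintro _ ⟨x, hx, rfl⟩
    exact ⟨τ x, hN.map_mem x hx, hfσ x⟩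
  two_step := by
    rintro _ ⟨x, hx, rfl⟩ _ ⟨y, hy, rfl⟩ _ ⟨z, hz, rfl⟩
    change ⁅f x, ⁅f y, f z⁆⁆ = 0
    rw [← LieHom.map_lie, ← LieHom.map_lie, hN.two_step x hx y hy z hz, map_zero]

theorem IsSemidirect.map (hf : Function.Injective f) {S L : LieSubalgebra ℝ 𝔤'}
    {V : Submodule ℝ 𝔤'} (h : IsSemidirect S V L) :
    IsSemidirect (S.map f) (V.map (f : 𝔤' →ₗ[ℝ] 𝔤)) (L.map f) where
  sup_eq := (Submodule.map_sup V L.toSubmodule (f : 𝔤' →ₗ[ℝ] 𝔤)).symm.trans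
    (congrArg (Submodule.map (f : 𝔤' →ₗ[ℝ] 𝔤)) h.sup_eq)
  disjoint := Submodule.disjoint_map (f := (f : 𝔤' →ₗ[ℝ] 𝔤)) hf h.disjoint
  abelian := by
    rintro _ ⟨x, hx, rfl⟩ _ ⟨y, hy, rfl⟩
    change ⁅f x, f y⁆ = 0
    rw [← LieHom.map_lie, h.abelian x hx y hy, map_zero]
  lie_mem := by
    rintro _ ⟨x, hx, rfl⟩ _ ⟨y, hy, rfl⟩
    exact ⟨⁅x, y⁆, h.lie_mem x hx y hy, LieHom.map_lie f x y⟩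

theorem IsMixedPiece.map (hf : Function.Injective f)
    (hfσ : ∀ x, f (τ x) = σ (f x)) {S L : LieSubalgebra ℝ 𝔤'} {V : Submodule ℝ 𝔤'}
    (hM : IsMixedPiece τ S V L) :
    IsMixedPiece σ (S.map f) (V.map (f : 𝔤' →ₗ[ℝ] 𝔤)) (L.map f) where
  semidirect := hM.semidirect.map hf
  le_tangent := by
    rintro _ ⟨x, hx, rfl⟩
    exact (map_mem_tangent_iff hf hfσ).mpr (hM.le_tangent x hx)
  simple := isSimple_map hf hM.simple
  sigma_mem := by
    rintro _ ⟨x, hx, rfl⟩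
    exact ⟨τ x, hM.sigma_mem x hx, hfσ x⟩
  sigmaJ_mem := by
    rintro _ ⟨x, hx, rfl⟩
    exact ⟨_, hM.sigmaJ_mem x hx, map_sigmaJ hfσ x⟩
  lie_mem_isotropy := by
    rintro _ ⟨x, hx, rfl⟩ hx' _ ⟨y, hy, rfl⟩ hy'
    change ⁅f x, f y⁆ ∈ isotropy σ
    rw [← LieHom.map_lie, map_mem_isotropy_iff hf hfσ]
    exact hM.lie_mem_isotropy x hx ((map_mem_tangent_iff hf hfσ).mp hx') y hy
      ((map_mem_tangent_iff hf hfσ).mp hy')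
  eq_zero_of_isotropy := by
    rintro _ ⟨F, hF, rfl⟩ hF' h0
    have h1 : F = 0 := hM.eq_zero_of_isotropy F hF ((map_mem_isotropy_iff hf hfσ).mp hF')
      fun x hx hxV => hf ((LieHom.map_lie f F x).trans ((h0 (f x) ⟨x, hx, rfl⟩
        ((map_mem_tangent_iff hf hfσ).mpr hxV)).trans (map_zero f).symm))
    exact (congrArg f h1).trans (map_zero f)
  faithful := by
    rintro _ ⟨x, hx, rfl⟩ h0
    have h1 : x = 0 := hM.faithful x hx fun v hv => hf ((LieHom.map_lie f x v).trans
      ((h0 (f v) ⟨v, hv, rfl⟩).trans (map_zero f).symm))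
    exact (congrArg f h1).trans (map_zero f)
  exists_center := by
    obtain ⟨z, hz, hzI, hzJ, hzV⟩ := hM.exists_center
    refine ⟨f z, ⟨z, hz, rfl⟩, (map_mem_isotropy_iff hf hfσ).mpr hzI, ?_, ?_⟩
    · rintro _ ⟨x, hx, rfl⟩ hx'
      exact (LieHom.map_lie f z x).symm.trans ((congrArg f (hzJ x hx
        ((map_mem_tangent_iff hf hfσ).mp hx'))).trans (map_sigmaJ hfσ x))
    · rintro _ ⟨v, hv, rfl⟩ h0
      have h1 : v = 0 := hzV v hv (hf ((LieHom.map_lie f z v).trans (h0.trans (map_zero f).symm)))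
      exact (congrArg f h1).trans (map_zero f)

theorem IsDirectProduct.map {ι : Type*} (hf : Function.Injective f) {T : Submodule ℝ 𝔤'}
    {A : ι → LieSubalgebra ℝ 𝔤'} (h : IsDirectProduct T A) :
    IsDirectProduct (T.map (f : 𝔤' →ₗ[ℝ] 𝔤)) fun j => (A j).map f where
  independent := LinearMap.iSupIndep_map (f : 𝔤' →ₗ[ℝ] 𝔤) hf h.independent
  iSup_eq := (Submodule.map_iSup (f : 𝔤' →ₗ[ℝ] 𝔤) fun j => (A j).toSubmodule).symm.trans
    (congrArg (Submodule.map (f : 𝔤' →ₗ[ℝ] 𝔤)) h.iSup_eq)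
  lie_eq_zero := by
    rintro i j hij _ ⟨x, hx, rfl⟩ _ ⟨y, hy, rfl⟩
    change ⁅f x, f y⁆ = 0
    rw [← LieHom.map_lie, h.lie_eq_zero i j hij x hx y hy, map_zero]

theorem map_factors {r : ℕ} (L₀ N : LieSubalgebra ℝ 𝔤') (S : Fin r → LieSubalgebra ℝ 𝔤') :
    (fun j => (factors L₀ N S j).map f) =
      factors (L₀.map f) (N.map f) fun i => (S i).map f := by
  funext j
  cases j <;> rfl

end Transport

variable {𝔤 : Type*} [LieRing 𝔤] [LieAlgebra ℝ 𝔤] [Module.Finite ℝ 𝔤] {σ : 𝔤 ≃ₗ⁅ℝ⁆ 𝔤}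

theorem exists_splitting_transvection (hσ : ∀ x, σ (σ (σ x)) = x)
    {G : LinearMap.BilinForm ℝ 𝔤} (hG : IsInner G) (hGσ : ∀ x y, G (σ x) (σ y) = G x y)
    (hs : ∀ F ∈ isotropy σ, ∀ x y, G ⁅F, x⁆ y + G x ⁅F, y⁆ = 0)
    (hf : Function.Injective (isotropyRep σ)) :
    ∃ (r : ℕ) (L₀ N : LieSubalgebra ℝ 𝔤) (S : Fin r → LieSubalgebra ℝ 𝔤)
      (V : Fin r → Submodule ℝ 𝔤) (L : Fin r → LieSubalgebra ℝ 𝔤),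
      IsDirectProduct (transvection σ) (factors L₀ N S) ∧ IsSemisimplePiece σ L₀ ∧
        IsNilpotentFactor σ N ∧ ∀ i, IsMixedPiece σ (S i) (V i) (L i) := by
  obtain ⟨r, L₀, N, S, V, L, hD, hL₀, hN, hM⟩ :=
    (isTransvectionAlgebra_restrictEquiv hσ hG hGσ hs hf).exists_splitting
  let f := (transvectionSubalgebra σ hσ).incl
  have hfi : Function.Injective f := Subtype.val_injective
  refine ⟨r, L₀.map f, N.map f, fun i => (S i).map f, fun i => (V i).map (f : _ →ₗ[ℝ] 𝔤),
    fun i => (L i).map f, ?_, hL₀.map hfi fun _ => rfl, hN.map hfi fun _ => rfl,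
    fun i => (hM i).map hfi fun _ => rfl⟩
  have h1 := hD.map hfi
  rw [map_factors] at h1
  have h2 : (⊤ : Submodule ℝ (transvectionSubalgebra σ hσ)).map (f : _ →ₗ[ℝ] 𝔤) =
      transvection σ :=
    (Submodule.map_top _).trans (Submodule.range_subtype _)
  rwa [h2] at h1

end

end ThreeSymmetric

namespace ThreeSymmetric

noncomputable section

attribute [local instance 100] LieRing.ofAssociativeRing

/-! ## The splitting of the tangent space -/

variable {𝔤 : Type*} [LieRing 𝔤] [LieAlgebra ℝ 𝔤]

/-- A splitting of the transvection algebra into its algebraic pieces. -/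
structure IsSplitting {r : ℕ} (σ : 𝔤 ≃ₗ⁅ℝ⁆ 𝔤) (L₀ N : LieSubalgebra ℝ 𝔤)
    (S : Fin r → LieSubalgebra ℝ 𝔤) (V : Fin r → Submodule ℝ 𝔤) (L : Fin r → LieSubalgebra ℝ 𝔤) :
    Prop where
  cube : ∀ x, σ (σ (σ x)) = x
  directProduct : IsDirectProduct (transvection σ) (factors L₀ N S)
  semisimple : IsSemisimplePiece σ L₀
  nilpotent : IsNilpotentFactor σ N
  mixed : ∀ i, IsMixedPiece σ (S i) (V i) (L i)

namespace IsSplitting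

variable {σ : 𝔤 ≃ₗ⁅ℝ⁆ 𝔤} {r : ℕ} {L₀ N : LieSubalgebra ℝ 𝔤} {S : Fin r → LieSubalgebra ℝ 𝔤}
  {V : Fin r → Submodule ℝ 𝔤} {L : Fin r → LieSubalgebra ℝ 𝔤} (h : IsSplitting σ L₀ N S V L)

include h

theorem tangentFactors_eq (j : FactorIndex r) :
    tangentFactors σ L₀ N V L j = (factors L₀ N S j).toSubmodule ⊓ tangent σ := by
  rcases j with _ | _ | i
  · rfl
  · exact (inf_eq_left.mpr h.nilpotent.le_tangent).symm
  · exact (sup_inf_assoc_of_le _ (h.mixed i).le_tangent).symm.trans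
      (congrArg (· ⊓ tangent σ) (h.mixed i).semidirect.sup_eq)

theorem mem_tangentFactors {j : FactorIndex r} {x : 𝔤} :
    x ∈ tangentFactors σ L₀ N V L j ↔ x ∈ factors L₀ N S j ∧ x ∈ tangent σ := by
  rw [h.tangentFactors_eq]
  exact Iff.rfl

theorem sigma_mem (j : FactorIndex r) : ∀ x ∈ factors L₀ N S j, σ x ∈ factors L₀ N S j := by
  rcases j with _ | _ | i
  · exact h.semisimple.sigma_mem
  · exact h.nilpotent.map_mem
  · intro x hx
    change σ x ∈ (S i).toSubmodule
    have hx' : x ∈ (S i).toSubmodule := hx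
    rw [← (h.mixed i).semidirect.sup_eq] at hx' ⊢
    obtain ⟨v, hv, y, hy, rfl⟩ := Submodule.mem_sup.mp hx'
    rw [map_add]
    exact Submodule.add_mem_sup (sigma_mem_of_sigmaJ_mem hv ((h.mixed i).sigmaJ_mem v hv))
      ((h.mixed i).sigma_mem y hy)

theorem tangentPart_mem_tangentFactors {j : FactorIndex r} {x : 𝔤} (hx : x ∈ factors L₀ N S j) :
    tangentPart σ x ∈ tangentFactors σ L₀ N V L j :=
  h.mem_tangentFactors.mpr ⟨tangentPart_mem_of_sigma_mem (S := (factors L₀ N S j).toSubmodule)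
    (h.sigma_mem j) hx, tangentPart_mem σ h.cube x⟩

theorem sigmaJ_mem_tangentFactors (j : FactorIndex r) :
    ∀ x ∈ tangentFactors σ L₀ N V L j, sigmaJ σ x ∈ tangentFactors σ L₀ N V L j := fun x hx =>
  have hx' := h.mem_tangentFactors.mp hx
  h.mem_tangentFactors.mpr ⟨sigmaJ_mem_of_sigma_mem (S := (factors L₀ N S j).toSubmodule)
    (h.sigma_mem j) hx'.1, ThreeSymmetric.sigmaJ_mem σ x hx'.2⟩

theorem iSupIndep_tangentFactors : iSupIndep (tangentFactors σ L₀ N V L) :=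
  h.directProduct.independent.mono fun _ _ hx => (h.mem_tangentFactors.mp hx).1

theorem iSup_tangentFactors : ⨆ j, tangentFactors σ L₀ N V L j = tangent σ := by
  refine le_antisymm (iSup_le fun _ _ hx => (h.mem_tangentFactors.mp hx).2) fun x hx => ?_
  have hx' : x ∈ transvection σ := Submodule.mem_sup_left hx
  rw [← h.directProduct.iSup_eq] at hx'
  rw [← tangentPart_of_tangent σ x hx]
  exact mem_of_mem_iSup (S := (⨆ j, tangentFactors σ L₀ N V L j).comap (tangentPart σ))
    (fun j y hy => Submodule.mem_iSup_of_mem j (h.tangentPart_mem_tangentFactors hy)) hx'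

/-- The torsion of a vector of a factor with any other vector lies in this factor. -/
theorem tangentPart_lie_mem {j : FactorIndex r} {x y : 𝔤} (hx : x ∈ tangent σ)
    (hy : y ∈ tangentFactors σ L₀ N V L j) :
    tangentPart σ ⁅x, y⁆ ∈ tangentFactors σ L₀ N V L j := by
  refine h.tangentPart_mem_tangentFactors ?_
  rw [← h.iSup_tangentFactors] at hx
  refine mem_of_mem_iSup (S := (factors L₀ N S j).toSubmodule.comap
    ((LieModule.toEnd ℝ 𝔤 𝔤).toLinearMap.flip y)) (fun i z hz => ?_) hx
  change ⁅z, y⁆ ∈ factors L₀ N S j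
  have hz' := (h.mem_tangentFactors.mp hz).1
  have hy' := (h.mem_tangentFactors.mp hy).1
  by_cases hij : i = j
  · subst hij
    exact LieSubalgebra.lie_mem _ hz' hy'
  · rw [h.directProduct.lie_eq_zero i j hij z hz' y hy']
    exact zero_mem _

/-- In a mixed factor the element z alone suffices: it has no kernel on V, acts as J on the tangent
part of L, and V meets L trivially. -/
theorem eq_zero_of_isotropy_lie {j : FactorIndex r} (hj : j ≠ .nilpotent) {x : 𝔤}
    (hx : x ∈ tangentFactors σ L₀ N V L j)
    (h0 : ∀ F ∈ factors L₀ N S j, F ∈ isotropy σ → ⁅F, x⁆ = 0) : x = 0 := by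
  rcases j with _ | _ | i
  · exact h.semisimple.eq_zero_of_tangent x hx.1 hx.2 h0
  · exact absurd rfl hj
  · have hM := h.mixed i
    obtain ⟨z, hz, hzI, hzJ, hzV⟩ := hM.exists_center
    obtain ⟨v, hv, y, hy, rfl⟩ := Submodule.mem_sup.mp hx
    have hzS : z ∈ (S i).toSubmodule := by
      rw [← hM.semidirect.sup_eq]
      exact Submodule.mem_sup_right hz
    have h1 : ⁅z, v⁆ + ⁅z, y⁆ = 0 := by
      rw [← lie_add]
      exact h0 z hzS hzI
    have h2 : ⁅z, v⁆ = 0 := by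
      refine Submodule.disjoint_def.mp hM.semidirect.disjoint _ (hM.semidirect.lie_mem z hz v hv) ?_
      rw [eq_neg_of_add_eq_zero_left h1]
      exact neg_mem ((L i).lie_mem hz hy.1)
    rw [h2, zero_add, hzJ y hy.1 hy.2] at h1
    have h3 := sigmaJ_sigmaJ hy.2
    rw [h1, map_zero, eq_comm, neg_eq_zero] at h3
    rw [hzV v hv h2, h3, add_zero]

variable [Module.Finite ℝ 𝔤]

/-- A vector of the factor orthogonal to all these brackets is fixed by the isotropy elements of the
factor, by skewness, and so vanishes. This carries the orthogonality of the splitting. -/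
theorem tangentFactors_le_span {G : LinearMap.BilinForm ℝ 𝔤} (hG : IsInner G)
    (hs : ∀ F ∈ isotropy σ, ∀ x y, G ⁅F, x⁆ y + G x ⁅F, y⁆ = 0) {j : FactorIndex r}
    (hj : j ≠ .nilpotent) : tangentFactors σ L₀ N V L j ≤
      Submodule.span ℝ {z | ∃ F ∈ factors L₀ N S j, F ∈ isotropy σ ∧
        ∃ y ∈ tangentFactors σ L₀ N V L j, z = ⁅F, y⁆} := by
  intro x hx
  set W := Submodule.span ℝ {z | ∃ F ∈ factors L₀ N S j, F ∈ isotropy σ ∧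
    ∃ y ∈ tangentFactors σ L₀ N V L j, z = ⁅F, y⁆} with hW
  have hlie : ∀ F ∈ factors L₀ N S j, F ∈ isotropy σ → ∀ y ∈ tangentFactors σ L₀ N V L j,
      ⁅F, y⁆ ∈ tangentFactors σ L₀ N V L j := fun F hF hFI y hy =>
    have hy' := h.mem_tangentFactors.mp hy
    h.mem_tangentFactors.mpr ⟨LieSubalgebra.lie_mem _ hF hy'.1,
      lie_isotropy_tangent σ F hFI y hy'.2⟩
  have hWE : W ≤ tangentFactors σ L₀ N V L j := by
    refine Submodule.span_le.mpr ?_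
    rintro _ ⟨F, hF, hFI, y, hy, rfl⟩
    exact hlie F hF hFI y hy
  obtain ⟨P, hP, hP'⟩ := hG.exists_proj W
  have hu : x - P x ∈ tangentFactors σ L₀ N V L j := sub_mem hx (hWE (hP x))
  rw [sub_eq_zero.mp (h.eq_zero_of_isotropy_lie hj hu fun F hF hFI => hG.eq_zero ?_)]
  · exact hP x
  · rw [eq_neg_of_add_eq_zero_left (hs F hFI _ _), hP' x _ (Submodule.subset_span
      ⟨F, hF, hFI, _, hlie F hF hFI _ hu, rfl⟩), neg_zero]

/-- The factors are orthogonal for every symmetric bilinear form invariant under the isotropy algebra. -/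
theorem orthogonal {G : LinearMap.BilinForm ℝ 𝔤} (hG : IsInner G)
    (hs : ∀ F ∈ isotropy σ, ∀ x y, G ⁅F, x⁆ y + G x ⁅F, y⁆ = 0) {B : LinearMap.BilinForm ℝ 𝔤}
    (hB : ∀ x y, B x y = B y x) (hBs : ∀ F ∈ isotropy σ, ∀ x y, B ⁅F, x⁆ y + B x ⁅F, y⁆ = 0)
    {i j : FactorIndex r} (hij : i ≠ j) {x y : 𝔤} (hx : x ∈ tangentFactors σ L₀ N V L i)
    (hy : y ∈ tangentFactors σ L₀ N V L j) : B x y = 0 := by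
  have key : ∀ i j, i ≠ j → i ≠ .nilpotent → ∀ x ∈ tangentFactors σ L₀ N V L i,
      ∀ y ∈ tangentFactors σ L₀ N V L j, B x y = 0 := by
    intro i j hij hi x hx y hy
    refine Submodule.span_le (p := LinearMap.ker (B.flip y)) |>.mpr ?_
      (h.tangentFactors_le_span hG hs hi hx)
    rintro _ ⟨F, hF, hFI, z, hz, rfl⟩
    change B ⁅F, z⁆ y = 0
    rw [eq_neg_of_add_eq_zero_left (hBs F hFI z y), h.directProduct.lie_eq_zero i j hij F hF y
      (h.mem_tangentFactors.mp hy).1, map_zero, neg_zero]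
  -- The nilpotent factor has no isotropy of its own, so the other factor supplies the isotropy
  -- elements by symmetry of B.
  by_cases hi : i = .nilpotent
  · rw [hB]
    exact key j i hij.symm (fun hj => hij (hi.trans hj.symm)) y hy x hx
  · exact key i j hij hi x hx y hy

theorem orthogonal_metric {G : LinearMap.BilinForm ℝ 𝔤} (hG : IsInner G)
    (hs : ∀ F ∈ isotropy σ, ∀ x y, G ⁅F, x⁆ y + G x ⁅F, y⁆ = 0)
    {K : Subgroup (tangent σ ≃ₗ[ℝ] tangent σ)} (hK : Integrates (isotropyRep σ) (J σ) K)
    {g : LinearMap.BilinForm ℝ (tangent σ)} (hg : IsInvariantMetric σ K g)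
    {i j : FactorIndex r} (hij : i ≠ j) {x y : tangent σ}
    (hx : (x : 𝔤) ∈ tangentFactors σ L₀ N V L i) (hy : (y : 𝔤) ∈ tangentFactors σ L₀ N V L j) :
    g x y = 0 := by
  let p : 𝔤 →ₗ[ℝ] tangent σ := (tangentPart σ).codRestrict _ (tangentPart_mem σ h.cube)
  have hp : ∀ v : tangent σ, p v = v := fun v => Subtype.ext (tangentPart_of_tangent σ v v.2)
  -- The metric is extended by zero on 𝔥; the result need only be symmetric and invariant, not
  -- definite.
  have h1 : g.compl₁₂ p p x y = 0 := by
    refine h.orthogonal hG hs (fun v w => hg.symm _ _) (fun F hF v w => ?_) hij hx hy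
    have hpF : ∀ v, p ⁅F, v⁆ = isotropyRep σ ⟨F, hF⟩ (p v) := fun v =>
      Subtype.ext (tangentPart_lie_isotropy hF v)
    rw [LinearMap.compl₁₂_apply, LinearMap.compl₁₂_apply, hpF, hpF]
    exact hK.skew hg.invariant ⟨F, hF⟩ (p v) (p w)
  rwa [LinearMap.compl₁₂_apply, hp, hp] at h1

omit h [Module.Finite ℝ 𝔤] in
/-- The Koszul formula for the intrinsic torsion. -/
theorem _root_.ThreeSymmetric.IsIntrinsicTorsion.koszul (hσ : ∀ x, σ (σ (σ x)) = x)
    {g : LinearMap.BilinForm ℝ (tangent σ)} (hg : ∀ v w, g v w = g w v)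
    {η : tangent σ →ₗ[ℝ] Module.End ℝ (tangent σ)} (hη : IsIntrinsicTorsion σ g η)
    (x y w : tangent σ) :
    2 * g (η x y) w = g ⟨torsion σ x y, tangentPart_mem σ hσ _⟩ w -
      g ⟨torsion σ y w, tangentPart_mem σ hσ _⟩ x - g ⟨torsion σ x w, tangentPart_mem σ hσ _⟩ y := by
  have ht : ∀ v w, (⟨torsion σ v w, tangentPart_mem σ hσ _⟩ : tangent σ) = η v w - η w v :=
    fun v w => Subtype.ext (hη.torsion_eq v w).symm
  rw [ht, ht, ht]
  simp only [map_sub, LinearMap.sub_apply]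
  have h1 := hη.skew x y w
  have h2 := hη.skew y x w
  have h3 := hη.skew w x y
  rw [hg y] at h1
  rw [hg x] at h2 h3
  linarith

/-- Each term of the Koszul formula vanishes when paired with a vector of another factor, because
torsion with a vector of a factor stays in that factor and different factors commute. The component
outside the factor is then orthogonal to itself. -/
theorem intrinsicTorsion_mem {G : LinearMap.BilinForm ℝ 𝔤} (hG : IsInner G)
    (hs : ∀ F ∈ isotropy σ, ∀ x y, G ⁅F, x⁆ y + G x ⁅F, y⁆ = 0)
    {K : Subgroup (tangent σ ≃ₗ[ℝ] tangent σ)} (hK : Integrates (isotropyRep σ) (J σ) K)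
    {g : LinearMap.BilinForm ℝ (tangent σ)} (hg : IsInvariantMetric σ K g)
    {η : tangent σ →ₗ[ℝ] Module.End ℝ (tangent σ)} (hη : IsIntrinsicTorsion σ g η)
    {j : FactorIndex r} (x : tangent σ) {y : tangent σ}
    (hy : (y : 𝔤) ∈ tangentFactors σ L₀ N V L j) :
    ((η x y : tangent σ) : 𝔤) ∈ tangentFactors σ L₀ N V L j := by
  have horth : ∀ k, k ≠ j → ∀ w : tangent σ, (w : 𝔤) ∈ tangentFactors σ L₀ N V L k →
      g (η x y) w = 0 := by
    intro k hk w hw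
    have h1 := hη.koszul h.cube hg.symm x y w
    have e1 : g ⟨torsion σ x y, tangentPart_mem σ h.cube _⟩ w = 0 :=
      h.orthogonal_metric hG hs hK hg hk.symm (h.tangentPart_lie_mem x.2 hy) hw
    have e2 : g ⟨torsion σ x w, tangentPart_mem σ h.cube _⟩ y = 0 :=
      h.orthogonal_metric hG hs hK hg hk (h.tangentPart_lie_mem x.2 hw) hy
    rw [e1, e2] at h1
    have h2 : torsion σ y w = 0 := by
      rw [torsion, h.directProduct.lie_eq_zero j k hk.symm y (h.mem_tangentFactors.mp hy).1 w
        (h.mem_tangentFactors.mp hw).1, map_zero]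
    have e3 : (⟨torsion σ y w, tangentPart_mem σ h.cube _⟩ : tangent σ) = 0 := Subtype.ext h2
    rw [e3, map_zero, LinearMap.zero_apply] at h1
    linarith
  have hsum : ((η x y : tangent σ) : 𝔤) ∈ ⨆ j, tangentFactors σ L₀ N V L j := by
    rw [h.iSup_tangentFactors]
    exact (η x y).2
  rw [iSup_split_single _ j] at hsum
  obtain ⟨a, ha, b, hb, hab⟩ := Submodule.mem_sup.mp hsum
  have haT := (h.mem_tangentFactors.mp ha).2
  have hbT : b ∈ tangent σ := iSup₂_le (f := fun k (_ : k ≠ j) => tangentFactors σ L₀ N V L k)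
    (fun k _ z hz => (h.mem_tangentFactors.mp hz).2) hb
  have hperp : ∀ u : tangent σ, (∀ k, k ≠ j → ∀ w : tangent σ,
      (w : 𝔤) ∈ tangentFactors σ L₀ N V L k → g u w = 0) → g u ⟨b, hbT⟩ = 0 := by
    intro u hu
    obtain ⟨c, hc, hcb⟩ := iSup₂_le (f := fun k (_ : k ≠ j) => tangentFactors σ L₀ N V L k)
      (a := (LinearMap.ker (g u)).map (tangent σ).subtype)
      (fun k hk z hz => ⟨⟨z, (h.mem_tangentFactors.mp hz).2⟩, hu k hk _ hz, rfl⟩) hb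
    rwa [← show c = ⟨b, hbT⟩ from Subtype.ext hcb]
  have h1 := hperp _ horth
  have h2 : g ⟨a, haT⟩ ⟨b, hbT⟩ = 0 := hperp _ fun k hk w hw =>
    h.orthogonal_metric hG hs hK hg hk.symm ha hw
  have h3 : η x y = ⟨a, haT⟩ + ⟨b, hbT⟩ := Subtype.ext hab.symm
  rw [h3, map_add, LinearMap.add_apply, h2, zero_add] at h1
  have h4 : (⟨b, hbT⟩ : tangent σ) = 0 := by
    by_contra hne
    exact (hg.pos _ hne).ne' h1
  rw [h3, h4, add_zero]
  exact ha

end IsSplitting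

end

end ThreeSymmetric

/-! ### The main theorem. -/

theorem mainTheorem10 {𝔤 : Type*} [LieRing 𝔤] [LieAlgebra ℝ 𝔤] [Module.Finite ℝ 𝔤]
    (σ : 𝔤 ≃ₗ⁅ℝ⁆ 𝔤) (hσ : ThreeSymmetric.IsRiemannian3Symmetric σ) :
    ∃ (r : ℕ) (L₀ N : LieSubalgebra ℝ 𝔤) (S : Fin r → LieSubalgebra ℝ 𝔤)
      (V : Fin r → Submodule ℝ 𝔤) (L : Fin r → LieSubalgebra ℝ 𝔤),
      -- the transvection algebra is the direct product of its factors
      ThreeSymmetric.IsDirectProduct (ThreeSymmetric.transvection σ)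
        (ThreeSymmetric.factors L₀ N S) ∧
      ThreeSymmetric.IsSemisimpleFactor σ L₀ ∧
      ThreeSymmetric.IsNilpotentFactor σ N ∧
      (∀ i, ThreeSymmetric.IsMixedFactor σ (S i) (V i) (L i)) ∧
      -- the corresponding splitting of the tangent space
      iSupIndep (ThreeSymmetric.tangentFactors σ L₀ N V L) ∧
      ⨆ j, ThreeSymmetric.tangentFactors σ L₀ N V L j = ThreeSymmetric.tangent σ ∧
      (∀ j, ∀ x ∈ ThreeSymmetric.tangentFactors σ L₀ N V L j,
        ThreeSymmetric.sigmaJ σ x ∈ ThreeSymmetric.tangentFactors σ L₀ N V L j) ∧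
      ∀ (K : Subgroup (ThreeSymmetric.tangent σ ≃ₗ[ℝ] ThreeSymmetric.tangent σ)),
        ThreeSymmetric.Integrates (ThreeSymmetric.isotropyRep σ) (ThreeSymmetric.J σ) K →
        ∀ g : LinearMap.BilinForm ℝ (ThreeSymmetric.tangent σ),
          ThreeSymmetric.IsInvariantMetric σ K g →
          (∀ i j, i ≠ j → ∀ x y : ThreeSymmetric.tangent σ,
            (x : 𝔤) ∈ ThreeSymmetric.tangentFactors σ L₀ N V L i →
            (y : 𝔤) ∈ ThreeSymmetric.tangentFactors σ L₀ N V L j → g x y = 0) ∧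
          ∀ η, ThreeSymmetric.IsIntrinsicTorsion σ g η →
            ∀ j, ∀ x y : ThreeSymmetric.tangent σ,
              (y : 𝔤) ∈ ThreeSymmetric.tangentFactors σ L₀ N V L j →
              ((η x y : ThreeSymmetric.tangent σ) : 𝔤) ∈
                ThreeSymmetric.tangentFactors σ L₀ N V L j := by
  obtain ⟨K₀, hK₀⟩ := hσ.compact
  obtain ⟨G, hG, hGσ, hs⟩ := hK₀.exists_form hσ.cube
  obtain ⟨r, L₀, N, S, V, L, hD, hL₀, hN, hM⟩ :=
    ThreeSymmetric.exists_splitting_transvection hσ.cube hG hGσ hs hK₀.faithful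
  have h : ThreeSymmetric.IsSplitting σ L₀ N S V L := ⟨hσ.cube, hD, hL₀, hN, hM⟩
  exact ⟨r, L₀, N, S, V, L, hD, hL₀.isSemisimpleFactor hσ.cube hG hs, hN,
    fun i => (hM i).isMixedFactor hσ.cube hG hs, h.iSupIndep_tangentFactors, h.iSup_tangentFactors,
    h.sigmaJ_mem_tangentFactors, fun K hK g hg =>
      ⟨fun i j hij x y hx hy => h.orthogonal_metric hG hs hK hg hij hx hy,
        fun η hη j x y hy => h.intrinsicTorsion_mem hG hs hK hg hη x hy⟩⟩
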